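/- Let $V=\bigoplus_{n\ge 0}V_n$ (with $\dim V_n<\infty$, $V_n=\ker(L(0)-n)$) be a vertex operator algebra over $\mathbb C$ with vacuum $\mathbf 1$ and Virasoro modes $L(n)$, which is simple, isomorphic as a $V$-module to its contragredient module, and of strong CFT type ($V_0=\mathbb C\mathbf 1$ and $L(1)V_1=0$). Then $V$ has a unique bilinear form $\langle\cdot,\cdot\rangle$ with $\langle\mathbf 1,\mathbf 1\rangle=1$ that is invariant, i.e. $\langle Y(u,z)v,w\rangle=\langle v,Y(e^{zL(1)}(-z^{-2})^{L(0)}u,z^{-1})w\rangle$; it is non-degenerate. For $u_1,\dots,u_N\in V$ let $Z^{(0)}(u_1,x_1;\dots;u_N,x_N)$ be the rational function, with poles only at $x_i=x_j$ ($i\ne j$), whose expansion in the domain $|x_1|>\dots>|x_N|$ is $\langle\mathbf 1,Y(u_1,x_1)\cdots Y(u_N,x_N)\mathbf 1\rangle$. For $v_1,\dots,v_n\in V$ of weights $\mathrm{wt}(v_i)$, the genus one formal $n$-point function is the formal power series in $\rho$ $$Z^{(1)}_V(\boldsymbol v,\boldsymbol y;w_1,w_{-1},\rho)=\sum_{k\ge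 0}\rho^k\sum_{b}Z^{(0)}(v_1,y_1;\dots;v_n,y_n;b,w_1;\bar b,w_{-1}),$$ where $b$ runs over any basis of $V_k$ and $\bar b$ over the dual basis with respect to $\langle\cdot,\cdot\rangle$, and $\mathcal F^{(1)}_V(\boldsymbol v,\boldsymbol y)=Z^{(1)}_V(\boldsymbol v,\boldsymbol y)\prod_i dy_i^{\mathrm{wt}(v_i)}$. For distinct $W_1,W_{-1}\in\mathbb C$ and a formal parameter $q$ the sewing parameters are $$w_{\pm1}=\frac{W_{\pm 1}-qW_{\mp 1}}{1-q},\qquad \rho=-\frac{q(W_{-1}-W_1)^2}{(1-q)^2},$$ so that, for fixed pairwise distinct $z_1,\dots,z_n\in\mathbb C\setminus\{W_1,W_{-1}\}$, $Z^{(1)}_V(\boldsymbol v,\boldsymbol z)$ becomes a formal power series in $q$. Zhu's trace function is the formal power series in $q$ $$Z^{\mathrm{Zhu}}_V(\boldsymbol v,\boldsymbol\zeta;q)=\mathrm{tr}_V\left(Y(e^{\mathrm{wt}(v_1)\zeta_1}v_1,e^{\zeta_1})\cdots Y(e^{\mathrm{wt}(v_n)\zeta_n}v_n,e^{\zeta_n})\,q^{L(0)}\right),$$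 the coefficient of $q^m$ being the value at $x_i=e^{\zeta_i}$ of the rational function, with poles only at $x_i=0$ and $x_i=x_j$ ($i\neq j$), whose expansion in $|x_1|>\dots>|x_n|>0$ is $\mathrm{tr}_{V_m}(Y(e^{\mathrm{wt}(v_1)\zeta_1}v_1,x_1)\cdots Y(e^{\mathrm{wt}(v_n)\zeta_n}v_n,x_n))$. **Theorem.** All the formal series above are expansions of rational functions as stated, and if $v_1,\dots,v_n$ are quasiprimary (homogeneous with $L(1)v_i=0$) and inserted at $z_1,\dots,z_n$, then, as formal power series in $q$, $$\mathcal F^{(1)}_V(\boldsymbol v,\boldsymbol z)=Z^{\mathrm{Zhu}}_V(\boldsymbol v,\boldsymbol\zeta;q)\prod_{i=1}^n d\zeta_i^{\mathrm{wt}(v_i)},\qquad \zeta_i=\log\frac{z_i-W_{-1}}{z_i-W_1},$$ for any local holomorphic branches of the logarithms; i.e. $Z^{(1)}_V(\boldsymbol v,\boldsymbol z)=Z^{\mathrm{Zhu}}_V(\boldsymbol v,\boldsymbol\zeta;q)\prod_i\left(\frac{d\zeta_i}{dz_i}\right)^{\mathrm{wt}(v_i)}$. -/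

import Mathlib

open scoped PowerSeries

noncomputable section

/-! ### Vertex operator algebras -/

/-- A vertex operator algebra over `ℂ`. Lower truncation is part of Mathlib's `VertexOperator` (a linear map from `V` to Laurent series), and `ncoeff (Y u) n` is the
mode `u(n)` in `Y(u,z) = ∑ u(n) z^{-n-1}`. -/
structure VOA (V : Type*) [AddCommGroup V] [Module ℂ V] where
  /-- the state-field map -/
  Y : V →ₗ[ℂ] VertexOperator ℂ V
  /-- the vacuum vector -/
  vac : V
  /-- the conformal vector -/
  conf : V
  /-- the central charge -/
  charge : ℂ
  /-- creativity, `u(-1) 𝟙 = u` -/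
  create : ∀ u, VertexOperator.ncoeff (Y u) (-1) vac = u
  /-- creativity, `u(n) 𝟙 = 0` for `n ≥ 0` -/
  annihilate : ∀ u, ∀ n : ℤ, 0 ≤ n → VertexOperator.ncoeff (Y u) n vac = 0
  /-- locality, `(x-y)^N [Y(u,x), Y(v,y)] = 0` for some `N`: the coefficient of
  `x^{-m-1} y^{-k-1}` -/
  locality : ∀ u v, ∃ N : ℕ, ∀ m k : ℤ,
    ∑ i ∈ Finset.range (N + 1), ((-1 : ℂ) ^ i * (N.choose i : ℂ)) •
      ⁅VertexOperator.ncoeff (Y u) (m + N - i), VertexOperator.ncoeff (Y v) (k + i)⁆ = 0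
  /-- the Virasoro relations for `L(n) = ω(n+1)` -/
  virasoro : ∀ m n : ℤ,
    ⁅VertexOperator.ncoeff (Y conf) (m + 1), VertexOperator.ncoeff (Y conf) (n + 1)⁆ =
      ((m : ℂ) - n) • VertexOperator.ncoeff (Y conf) (m + n + 1) +
      (if m = -n then charge / 12 * ((m : ℂ) ^ 3 - m) else 0) • (1 : Module.End ℂ V)
  /-- translation, `Y(L(-1)u, z) = ∂ Y(u,z)` -/
  translation : ∀ u, ∀ n : ℤ,
    VertexOperator.ncoeff (Y (VertexOperator.ncoeff (Y conf) 0 u)) n =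
      (-(n : ℂ)) • VertexOperator.ncoeff (Y u) (n - 1)
  /-- `V = ⨁_{n ≥ 0} V_n` with `V_n = {v | L(0) v = n v}` -/
  grading : DirectSum.IsInternal fun n : ℕ =>
    Module.End.eigenspace (VertexOperator.ncoeff (Y conf) 1) (n : ℂ)
  /-- `dim V_n < ∞` -/
  finite_dim : ∀ n : ℕ, FiniteDimensional ℂ
    (Module.End.eigenspace (VertexOperator.ncoeff (Y conf) 1) (n : ℂ))
  /-- `𝟙 ∈ V_0` -/
  vac_weight : VertexOperator.ncoeff (Y conf) 1 vac = 0
  /-- `ω ∈ V_2` -/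
  conf_weight : VertexOperator.ncoeff (Y conf) 1 conf = (2 : ℂ) • conf

namespace VOA

variable {V : Type*} [AddCommGroup V] [Module ℂ V] (A : VOA V)

/-- The mode `u(n)`. -/
def mode (u : V) (n : ℤ) : Module.End ℂ V := VertexOperator.ncoeff (A.Y u) n

/-- `L(n) = ω(n+1)`. -/
def L (n : ℤ) : Module.End ℂ V := A.mode A.conf (n + 1)

/-- The space `V_n` of vectors of weight `n`. -/
def wtSpace (n : ℕ) : Submodule ℂ V := Module.End.eigenspace (A.L 0) (n : ℂ)

theorem isInternal_wtSpace : DirectSum.IsInternal A.wtSpace := A.grading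

instance (n : ℕ) : FiniteDimensional ℂ (A.wtSpace n) := A.finite_dim n

/-- The projection `V → V_n` along the grading. -/
def proj (n : ℕ) : V →ₗ[ℂ] A.wtSpace n :=
  DirectSum.component ℂ ℕ (fun k => A.wtSpace k) n ∘ₗ
    (LinearEquiv.ofBijective (DirectSum.coeLinearMap A.wtSpace)
      A.isInternal_wtSpace).symm.toLinearMap

/-- `v` is quasiprimary of weight `N`. -/
def IsQuasiprimary (N : ℕ) (v : V) : Prop := v ∈ A.wtSpace N ∧ A.L 1 v = 0

/-- Simplicity: `V` is nonzero and has no submodules other than `0` and `V` that are stable under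
all modes. -/
def IsSimple : Prop :=
  Nontrivial V ∧ ∀ I : Submodule ℂ V, (∀ u, ∀ n : ℤ, ∀ v ∈ I, A.mode u n v ∈ I) → I = ⊥ ∨ I = ⊤

/-- Strong CFT type: `V_0 = ℂ 𝟙` and `L(1) V_1 = 0`. -/
def IsStrongCFTType : Prop :=
  A.wtSpace 0 = Submodule.span ℂ {A.vac} ∧ ∀ v ∈ A.wtSpace 1, A.L 1 v = 0

/-- For `u` of weight `N`, the mode `u†(n)` of the adjoint vertex operator
`Y†(u,z) = ∑ u†(n) z^{-n-1} = Y(e^{z L(1)} (-z^{-2})^{L(0)} u, z^{-1})`. (The exponential series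
stops since `L(1)^j u` has weight `N - j`.) -/
def adjMode (N : ℕ) (u : V) (n : ℤ) : Module.End ℂ V :=
  (-1 : ℂ) ^ N • ∑ j ∈ Finset.range (N + 1),
    ((j.factorial : ℂ)⁻¹) • A.mode ((A.L 1 ^ j) u) (2 * N - n - 2 - j)

/-- The underlying space `⨁ V_n^*` of the contragredient module `V'`: functionals on `V` that
vanish on `V_n` for all large `n`. -/
def restrictedDual : Submodule ℂ (Module.Dual ℂ V) where
  carrier := {f | ∃ K : ℕ, ∀ n, K ≤ n → ∀ v ∈ A.wtSpace n, f v = 0}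
  zero_mem' := ⟨0, fun _ _ _ _ => rfl⟩
  add_mem' := by
    rintro f g ⟨K, hK⟩ ⟨K', hK'⟩
    refine ⟨max K K', fun n hn v hv => ?_⟩
    rw [LinearMap.add_apply, hK n (le_trans (le_max_left _ _) hn) v hv,
      hK' n (le_trans (le_max_right _ _) hn) v hv, add_zero]
  smul_mem' := by
    rintro c f ⟨K, hK⟩
    refine ⟨K, fun n hn v hv => ?_⟩
    rw [LinearMap.smul_apply, hK n hn v hv, smul_zero]

/-- `V` is isomorphic, as a `V`-module, to its contragredient module `V'`, on which `u(n)` acts by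
the transpose of `u†(n)`. -/
def IsSelfDual : Prop :=
  ∃ φ : V ≃ₗ[ℂ] A.restrictedDual, ∀ (N : ℕ), ∀ u ∈ A.wtSpace N, ∀ (n : ℤ) (v w : V),
    (φ (A.mode u n v) : Module.Dual ℂ V) w = (φ v : Module.Dual ℂ V) (A.adjMode N u n w)

/-- `⟨·,·⟩` is invariant, `⟨Y(u,z)v, w⟩ = ⟨v, Y†(u,z)w⟩`, and normalised by `⟨𝟙,𝟙⟩ = 1`. -/
def IsLiZ (B : LinearMap.BilinForm ℂ V) : Prop :=
  (∀ (N : ℕ), ∀ u ∈ A.wtSpace N, ∀ (n : ℤ) (v w : V),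
    B (A.mode u n v) w = B v (A.adjMode N u n w)) ∧ B A.vac A.vac = 1

variable {A}

theorem L_lie (m n : ℤ) (v : V) : A.L m (A.L n v) - A.L n (A.L m v) =
    ((m : ℂ) - n) • A.L (m + n) v +
      (if m = -n then A.charge / 12 * ((m : ℂ) ^ 3 - m) else 0) • v := by
  have h := congrArg (fun T : Module.End ℂ V => T v) (A.virasoro m n)
  simpa [L, mode, Ring.lie_def, LinearMap.add_apply, LinearMap.smul_apply, -smul_ite, -ite_smul, -ite_eq_right_iff] using h

theorem L_one_conf : A.L 1 A.conf = 0 := by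
  have h2 : A.L (-2) A.vac = A.conf := by
    have := A.create A.conf
    simpa [L, mode] using this
  have h1 : A.L 1 A.vac = 0 := A.annihilate A.conf (1 + 1) (by norm_num)
  have h3 : A.L (-1) A.vac = 0 := by
    simpa [L, mode] using A.annihilate A.conf 0 le_rfl
  have h := L_lie (A := A) 1 (-2) A.vac
  rw [h2, h1, map_zero] at h
  norm_num [h3] at h
  exact h

theorem conf_mem : A.conf ∈ A.wtSpace 2 :=
  Module.End.mem_eigenspace_iff.2 (by simpa [L, mode] using A.conf_weight)

theorem vac_mem : A.vac ∈ A.wtSpace 0 :=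
  Module.End.mem_eigenspace_iff.2 (by simpa [L, mode] using A.vac_weight)

theorem adjMode_conf : A.adjMode 2 A.conf 1 = A.L 0 := by
  have h0 : A.mode 0 = 0 := by ext n v; simp [mode]
  simp [adjMode, Finset.sum_range_succ, pow_two, L_one_conf, h0]
  simp [L, mode]

theorem induction_wt {p : V → Prop} (hw : ∀ n, ∀ v ∈ A.wtSpace n, p v)
    (hadd : ∀ u v, p u → p v → p (u + v)) (v : V) : p v := by
  have hv : v ∈ ⨆ n, A.wtSpace n := by
    rw [A.isInternal_wtSpace.submodule_iSup_eq_top]; trivial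
  exact Submodule.iSup_induction A.wtSpace (motive := p) hv hw
    (hw 0 0 (Submodule.zero_mem _)) hadd

/-- A functional of the form `⟨𝟙, ·⟩` is supported on `V_0`. -/
theorem functional_eq_zero {f : Module.Dual ℂ V} (hf : ∀ w, f (A.L 0 w) = 0) {n : ℕ} (hn : n ≠ 0)
    {v : V} (hv : v ∈ A.wtSpace n) : f v = 0 := by
  have h := hf v
  rw [Module.End.mem_eigenspace_iff.1 hv, map_smul, smul_eq_mul] at h
  exact (mul_eq_zero.1 h).resolve_left (Nat.cast_ne_zero.2 hn)

theorem existsUnique_liZ (hs : A.IsSimple) (hc : A.IsStrongCFTType) (hd : A.IsSelfDual) :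
    ∃! B : LinearMap.BilinForm ℂ V, A.IsLiZ B := by
  have L0vac : A.mode A.conf 1 A.vac = 0 := A.vac_weight
  obtain ⟨φ, hφ⟩ := hd
  have hvac : A.vac ≠ 0 := by
    intro h
    have := hs.1
    obtain ⟨u, hu⟩ := exists_ne (0 : V)
    exact hu (by have := A.create u; rw [h, map_zero] at this; exact this.symm)
  have hne : (φ A.vac : Module.Dual ℂ V) A.vac ≠ 0 := by
    intro h
    have hf : ∀ w, (φ A.vac : Module.Dual ℂ V) (A.L 0 w) = 0 := by
      intro w
      rw [← adjMode_conf, ← hφ 2 _ conf_mem, L0vac, map_zero]; rfl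
    apply hvac
    apply φ.injective
    rw [map_zero]
    apply Subtype.ext
    ext v
    refine induction_wt (A := A) (p := fun v => (φ A.vac : Module.Dual ℂ V) v = 0) ?_ ?_ v
    · intro n v hv
      by_cases hn : n = 0
      · subst hn
        rw [hc.1] at hv
        obtain ⟨c, rfl⟩ := Submodule.mem_span_singleton.1 hv
        simp [h]
      · exact functional_eq_zero hf hn hv
    · intro u v hu hv
      rw [map_add, hu, hv, add_zero]
  refine ⟨((φ A.vac : Module.Dual ℂ V) A.vac)⁻¹ • (A.restrictedDual.subtype ∘ₗ φ.toLinearMap),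
    ⟨?_, ?_⟩, ?_⟩
  · intro N u hu n v w
    simp [hφ N u hu n v w]
  · simp [hne]
  · have key : ∀ B B' : LinearMap.BilinForm ℂ V, A.IsLiZ B → A.IsLiZ B' → B = B' := by
      intro B B' hB hB'
      have h1 : B A.vac = B' A.vac := by
        have van : ∀ B : LinearMap.BilinForm ℂ V, A.IsLiZ B → ∀ w, B A.vac (A.L 0 w) = 0 := by
          intro B hB w
          rw [← adjMode_conf, ← hB.1 2 _ conf_mem, L0vac, map_zero]; rfl
        ext v
        refine induction_wt (A := A) (p := fun v => B A.vac v = B' A.vac v) ?_ ?_ v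
        · intro n v hv
          by_cases hn : n = 0
          · subst hn
            rw [hc.1] at hv
            obtain ⟨c, rfl⟩ := Submodule.mem_span_singleton.1 hv
            simp [hB.2, hB'.2]
          · rw [functional_eq_zero (van B hB) hn hv, functional_eq_zero (van B' hB') hn hv]
        · intro u v hu hv
          rw [map_add, map_add, hu, hv]
      ext u w
      refine induction_wt (A := A) (p := fun u => B u w = B' u w) ?_ ?_ u
      · intro n u hu
        have hcr : A.mode u (-1) A.vac = u := A.create u
        rw [← hcr, hB.1 n u hu, hB'.1 n u hu, h1]
      · intro u v hu hv
        simp [hu, hv]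
    intro B hB
    refine key _ _ hB ⟨?_, ?_⟩
    · intro N u hu n v w
      simp [hφ N u hu n v w]
    · simp [hne]

/-- The Li-Zamolodchikov metric: the unique normalised invariant bilinear form of a simple
self-dual vertex operator algebra of strong CFT type. -/
def liZ (hs : A.IsSimple) (hc : A.IsStrongCFTType) (hd : A.IsSelfDual) :
    LinearMap.BilinForm ℂ V :=
  (existsUnique_liZ hs hc hd).choose

/-! ### Rational functions and their expansions -/

/-- The polynomial `∏_{i<j} (x_i - x_j)`. -/
def diagonals (N : ℕ) : MvPolynomial (Fin N) ℂ :=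
  ∏ i, ∏ j ∈ Finset.Ioi i, (MvPolynomial.X i - MvPolynomial.X j)

/-- The polynomial `∏_i x_i`. -/
def axes (N : ℕ) : MvPolynomial (Fin N) ℂ := ∏ i, MvPolynomial.X i

/-- The formal series `∑_k f(k) ∏_i x_i^{-k_i-1}` is, in the domain
`|x_1| > ⋯ > |x_N| > 0`, the (absolutely convergent) expansion of the rational function
`P / D^M`. -/
def IsExpansion {N : ℕ} (f : (Fin N → ℤ) → ℂ) (D P : MvPolynomial (Fin N) ℂ) (M : ℕ) : Prop :=
  ∀ x : Fin N → ℂ, (∀ i, x i ≠ 0) → (∀ i j, i < j → ‖x j‖ < ‖x i‖) →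
    HasSum (fun k : Fin N → ℤ => f k * ∏ i, x i ^ (-(k i) - 1))
      (MvPolynomial.eval x P / MvPolynomial.eval x D ^ M)

/-- The formal series with coefficients `f` extends to a rational function whose poles lie on
`D = 0`. -/
def IsRationalSeries {N : ℕ} (f : (Fin N → ℤ) → ℂ) (D : MvPolynomial (Fin N) ℂ) : Prop :=
  ∃ (P : MvPolynomial (Fin N) ℂ) (M : ℕ), IsExpansion f D P M

open Classical in
/-- The value, at a point `x` with coordinates in a commutative `ℂ`-algebra `S` at which `D` is
invertible, of the rational function to which the formal series with coefficients `f` extends. -/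
def ratValue {N : ℕ} (f : (Fin N → ℤ) → ℂ) (D : MvPolynomial (Fin N) ℂ)
    {S : Type*} [CommRing S] [Algebra ℂ S] (x : Fin N → S) : S :=
  if h : IsRationalSeries f D then
    MvPolynomial.aeval x h.choose * Ring.inverse (MvPolynomial.aeval x D) ^ h.choose_spec.choose
  else 0

variable (A)

/-- The coefficients of `Y(v_1,x_1) ⋯ Y(v_n,x_n)`: the operators `v_1(k_1) ⋯ v_n(k_n)`. -/
def prodModes {n : ℕ} (v : Fin n → V) (k : Fin n → ℤ) : Module.End ℂ V :=
  (List.ofFn fun i => A.mode (v i) (k i)).prod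

/-- The coefficients of the genus zero `n`-point function
`Z⁽⁰⁾(v,x) = ⟨𝟙, Y(v_1,x_1) ⋯ Y(v_n,x_n) 𝟙⟩` as a formal series. -/
def genusZeroSeries (B : LinearMap.BilinForm ℂ V) {n : ℕ} (v : Fin n → V) (k : Fin n → ℤ) : ℂ :=
  B A.vac (A.prodModes v k A.vac)

/-- The rational genus zero `n`-point function `Z⁽⁰⁾(v_1,x_1;…;v_n,x_n)`, evaluated at points
`x_i` of a commutative `ℂ`-algebra whose differences are invertible. -/
def genusZero (B : LinearMap.BilinForm ℂ V) {n : ℕ} (v : Fin n → V)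
    {S : Type*} [CommRing S] [Algebra ℂ S] (x : Fin n → S) : S :=
  ratValue (A.genusZeroSeries B v) (diagonals n) x

/-- The coefficients of `tr_{V_m} (Y(v_1,x_1) ⋯ Y(v_n,x_n))`, the coefficient of `q^m` in
`tr_V (Y(v_1,x_1) ⋯ Y(v_n,x_n) q^{L(0)})`, as a formal series. -/
def traceSeries (m : ℕ) {n : ℕ} (v : Fin n → V) (k : Fin n → ℤ) : ℂ :=
  LinearMap.trace ℂ (A.wtSpace m) (A.proj m ∘ₗ A.prodModes v k ∘ₗ (A.wtSpace m).subtype)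

/-- Zhu's trace function
`tr_V (Y(e^{wt(v_1) ζ_1} v_1, e^{ζ_1}) ⋯ Y(e^{wt(v_n) ζ_n} v_n, e^{ζ_n}) q^{L(0)})`,
a formal power series in `q`. -/
def zhuTrace {n : ℕ} (wt : Fin n → ℕ) (v : Fin n → V) (ζ : Fin n → ℂ) : ℂ⟦X⟧ :=
  PowerSeries.mk fun m =>
    ratValue (A.traceSeries m fun i => Complex.exp (wt i * ζ i) • v i) (axes n * diagonals n)
      fun i => Complex.exp (ζ i)

/-- The genus one `n`-point function
`Z⁽¹⁾(v,y; w_1,w_{-1},ρ) = ∑_{k ≥ 0} ρ^k ∑_{b ∈ V_k} Z⁽⁰⁾(v,y; b,w_1; b̄,w_{-1})`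
for homogeneous bases `b`, `b̄` of `V` that are dual to each other. Its arguments `y`, `w_{±1}`, `ρ`
are power series in one variable, where `ρ` has no constant term: the `m`-th coefficient then
involves only the terms with `k ≤ m`. -/
def genusOne (B : LinearMap.BilinForm ℂ V) {ι : ℕ → Type*} [∀ k, Fintype (ι k)]
    (b b' : ∀ k, Module.Basis (ι k) ℂ (A.wtSpace k)) {n : ℕ} (v : Fin n → V)
    (y : Fin n → ℂ⟦X⟧) (w w' ρ : ℂ⟦X⟧) : ℂ⟦X⟧ :=
  PowerSeries.mk fun m => PowerSeries.coeff m (∑ k ∈ Finset.range (m + 1), ρ ^ k *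
    ∑ i : ι k, A.genusZero B (Fin.append v ![(b k i : V), (b' k i : V)]) (Fin.append y ![w, w']))

end VOA

/-- `w_a = (W_a - q W_{-a}) / (1 - q)` as a power series in `q`; the arguments are `W_a`, `W_{-a}`. -/
def schottkyW (W W' : ℂ) : ℂ⟦X⟧ :=
  (PowerSeries.C W - PowerSeries.X * PowerSeries.C W') * (1 - PowerSeries.X)⁻¹

/-- `ρ = - q (W_{-1} - W_1)^2 / (1 - q)^2` as a power series in `q`; the arguments are `W_1`,
`W_{-1}`. -/
def schottkyRho (W W' : ℂ) : ℂ⟦X⟧ :=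
  -(PowerSeries.X * PowerSeries.C ((W' - W) ^ 2)) * ((1 - PowerSeries.X) ^ 2)⁻¹

end

/-! Genus zero functions are translation invariant, so the handle may be attached at `W_{-1} = 0`
and `W_1 = a`. Then `w = w_1 = a/(1-q)`, `w_{-1} = -q w` and `ρ = -q w²`. Put `σ = 1/w` and expand
in `|w| > |x_i| > |w_{-1}|`, which places `Y(b,w)` at the far left. Invariance of the form turns
`⟨𝟙, Y(b,w) ·⟩` into powers of `L(1)`, creativity gives `Y(b̄,w_{-1})𝟙 = e^{w_{-1} L(-1)} b̄`, and
the sum over dual bases becomes a trace. Cyclicity brings the powers of `L(-1)` on the right round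
to the left, where they cancel, by alternating signs, against those adjoint to the `L(1)^j b`. What
remains is `tr(e^{σ L(1)} Y(v_1,y_1)⋯Y(v_n,y_n) q^{L(0)})` (`IsLiZ.coeff_sum_genusZero`).

Since `tr(X L(1) q^{L(0)}) = q tr(L(1) X q^{L(0)})`, each `L(1)` under this trace acts as `ad
L(1)/(1-q)` (`gradedTrace_L_one_pow_mul`), so the exponential becomes `e^{s ad L(1)}` with `s =
σ/(1-q) = 1/a`. On quasiprimary vectors `ad L(1)` is the operator `∑ (x_i² ∂_i + 2 wt_i x_i)`, whose
exponential moves `y` to `y/(1-sy)` with the factor `(1-sy)^{-2wt}` (`taylor_mul_prod`). For `s =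
1/a` the new point is `-a e^ζ`; homogeneity of the trace removes `-a`, and the remaining factors
combine to `(dζ/dz)^{wt}`.

All of this is carried out algebraically. Formal series are a module over polynomials, and a
rational series is a truncated one that some power of the denominator turns into a polynomial;
`eq_ratValue_mul` then lets any summation compatible with multiplication by the variables compute
values. Powers of `q` are cut off at `q^{m+1} = 0`, and `σ` is at first a formal Laurent variable,
specialised to `1/w` by `exists_transfer`. The brackets of `L(0)`, `L(±1)` with modes are not
axioms; they come from Dong's lemma and the uniqueness of fields (`residueField_eq`). -/

noncomputable section

/-! ### Formal series in several variables -/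

namespace FormalSeries

section Action

variable {σ τ : Type*} {U U' : Type*} [AddCommGroup U] [Module ℂ U] [AddCommGroup U'] [Module ℂ U']

/-- Multiplication of formal series `∑ f(k) ∏ x_i^{-k_i-1}` by polynomials. -/
def act : MvPolynomial σ ℂ →ₐ[ℂ] Module.End ℂ ((σ → ℤ) → U) :=
  AddMonoidAlgebra.lift ℂ (Module.End ℂ ((σ → ℤ) → U)) (σ →₀ ℕ)
    { toFun := fun m => LinearMap.funLeft ℂ U fun k i => k i + (m.toAdd i : ℤ)
      map_one' := by ext f k; simp [LinearMap.funLeft]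
      map_mul' := fun m m' => by
        ext f k
        simp only [LinearMap.funLeft_apply, Module.End.mul_apply]
        congr 1
        funext i
        simp [add_assoc] }

theorem act_monomial (m : σ →₀ ℕ) (c : ℂ) (f : (σ → ℤ) → U) (k : σ → ℤ) :
    act (MvPolynomial.monomial m c) f k = c • f (fun i => k i + (m i : ℤ)) := by
  have : (act (MvPolynomial.monomial m c) : Module.End ℂ ((σ → ℤ) → U)) = c • _ :=
    AddMonoidAlgebra.lift_single _ _ _
  rw [this]
  rfl

theorem act_C (c : ℂ) (f : (σ → ℤ) → U) : act (MvPolynomial.C c) f = c • f := by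
  funext k
  rw [← MvPolynomial.monomial_zero', act_monomial]
  simp

theorem act_X [DecidableEq σ] (i : σ) (f : (σ → ℤ) → U) (k : σ → ℤ) :
    act (MvPolynomial.X i) f k = f (k + Pi.single i 1) := by
  rw [MvPolynomial.X, act_monomial, one_smul]
  congr 1
  funext j
  by_cases h : i = j
  · subst h; simp
  · simp [Finsupp.single_eq_of_ne (Ne.symm h), Pi.single_eq_of_ne (Ne.symm h)]

theorem act_mul (p q : MvPolynomial σ ℂ) (f : (σ → ℤ) → U) : act (p * q) f = act p (act q f) := by
  rw [map_mul]; rfl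

theorem act_comm (p q : MvPolynomial σ ℂ) (f : (σ → ℤ) → U) :
    act p (act q f) = act q (act p f) := by
  rw [← act_mul, mul_comm, act_mul]

theorem act_add (p q : MvPolynomial σ ℂ) (f : (σ → ℤ) → U) :
    act (p + q) f = act p f + act q f := by
  rw [map_add]; rfl

theorem act_sub (p q : MvPolynomial σ ℂ) (f : (σ → ℤ) → U) :
    act (p - q) f = act p f - act q f := by
  rw [map_sub]; rfl

theorem act_one (f : (σ → ℤ) → U) : act 1 f = f := by rw [map_one]; rfl

theorem act_eq_zero_of_dvd {p q : MvPolynomial σ ℂ} (h : p ∣ q) {f : (σ → ℤ) → U}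
    (hf : act p f = 0) : act q f = 0 := by
  obtain ⟨r, rfl⟩ := h
  rw [mul_comm, act_mul, hf, map_zero]

/-- Properties of series that are stable under linear combinations and multiplication by variables
are stable under multiplication by polynomials. -/
theorem act_mem [DecidableEq σ] (S : Submodule ℂ ((σ → ℤ) → U))
    (hS : ∀ f ∈ S, ∀ i, act (MvPolynomial.X i) f ∈ S) (p : MvPolynomial σ ℂ) {f : (σ → ℤ) → U}
    (hf : f ∈ S) : act p f ∈ S := by
  induction p using MvPolynomial.induction_on with
  | C a => rw [act_C]; exact S.smul_mem _ hf
  | add p q hp hq => rw [act_add]; exact S.add_mem hp hq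
  | mul_X p i hp => rw [mul_comm, act_mul]; exact hS _ hp i

/-- Multiplication by a polynomial in some of the variables, for a series that depends on the other
variables through a linear map. -/
theorem act_rename [DecidableEq σ] [DecidableEq τ] (ι : σ → τ) (hι : Function.Injective ι)
    (Φ : (τ → ℤ) → U →ₗ[ℂ] U') (hΦ : ∀ k i, Φ (k + Pi.single (ι i) 1) = Φ k)
    (p : MvPolynomial σ ℂ) (F : (σ → ℤ) → U) :
    act (MvPolynomial.rename ι p) (fun k => Φ k (F (k ∘ ι))) =
      fun k => Φ k (act p F (k ∘ ι)) := by
  induction p using MvPolynomial.induction_on generalizing F with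
  | C a => funext k; simp
  | add p q hp hq => funext k; simp [hp, hq]
  | mul_X p i hp =>
    rw [map_mul, MvPolynomial.rename_X, act_mul]
    have : act (MvPolynomial.X (ι i)) (fun k => Φ k (F (k ∘ ι))) =
        fun k => Φ k (act (MvPolynomial.X i) F (k ∘ ι)) := by
      funext k
      rw [act_X, act_X, hΦ]
      congr 2
      funext j
      by_cases h : j = i
      · subst h; simp
      · simp [Pi.single_eq_of_ne h, Pi.single_eq_of_ne (hι.ne h)]
    rw [this, hp, act_mul]

theorem act_comp (ℓ : U →ₗ[ℂ] U') (p : MvPolynomial σ ℂ) (F : (σ → ℤ) → U) :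
    act p (fun k => ℓ (F k)) = fun k => ℓ (act p F k) := by
  classical
  have := act_rename (id : σ → σ) Function.injective_id (fun _ => ℓ) (fun _ _ => rfl) p F
  simpa using this

/-- The series of the constant function `1`. -/
def one [DecidableEq σ] [Fintype σ] : (σ → ℤ) → ℂ := fun k => if k = fun _ => -1 then 1 else 0

/-- The index `k` stands for the exponent `-k-1`, so `x^m` sits at the index `-1-m`. -/
theorem act_one_apply [DecidableEq σ] [Fintype σ] (p : MvPolynomial σ ℂ) (m : σ →₀ ℕ) :
    act p one (fun i => -1 - (m i : ℤ)) = p.coeff m := by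
  induction p using MvPolynomial.induction_on' with
  | monomial u a =>
    rw [act_monomial, MvPolynomial.coeff_monomial]
    simp only [one, smul_eq_mul, mul_ite, mul_one, mul_zero]
    refine if_congr ?_ rfl rfl
    rw [funext_iff, Finsupp.ext_iff]
    refine forall_congr' fun i => ?_
    omega
  | add p q hp hq => rw [act_add, Pi.add_apply, hp, hq, MvPolynomial.coeff_add]

theorem act_one_injective [DecidableEq σ] [Fintype σ] {p q : MvPolynomial σ ℂ}
    (h : act p one = act q one) : p = q := by
  ext m
  rw [← act_one_apply, h, act_one_apply]

/-- A finitely supported series with nonnegative exponents is a polynomial. -/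
theorem exists_act_one [DecidableEq σ] [Fintype σ] {f : (σ → ℤ) → ℂ} (hf : f.support.Finite)
    (h : ∀ k i, 0 ≤ k i → f k = 0) : ∃ p : MvPolynomial σ ℂ, f = act p one := by
  -- On the support `k i < 0`, so the exponent `-1 - k i` is a natural number.
  refine ⟨∑ k ∈ hf.toFinset,
    MvPolynomial.monomial (Finsupp.equivFunOnFinite.symm fun i => (-1 - k i).toNat) (f k), ?_⟩
  funext k
  rw [map_sum, LinearMap.sum_apply, Finset.sum_apply]
  have key : ∀ l ∈ hf.toFinset, act (MvPolynomial.monomial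
      (Finsupp.equivFunOnFinite.symm fun i => (-1 - l i).toNat) (f l)) one k =
      if l = k then f k else 0 := by
    intro l hl
    have hneg : ∀ i, l i < 0 := fun i => by
      by_contra hc
      exact (by simpa using hl : f l ≠ 0) (h l i (not_lt.1 hc))
    rw [act_monomial]
    simp only [one, smul_eq_mul, mul_ite, mul_one, mul_zero, Finsupp.equivFunOnFinite_symm_apply_apply]
    by_cases hlk : l = k
    · subst hlk
      rw [if_pos rfl, if_pos]
      funext i
      have := hneg i
      omega
    · rw [if_neg hlk, if_neg]
      intro hc
      apply hlk
      funext i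
      have h1 := hneg i
      have h2 := congrFun hc i
      omega
  rw [Finset.sum_congr rfl key, Finset.sum_ite_eq']
  by_cases hk : f k = 0
  · simp [hk]
  · simp [hk]

end Action

/-! ### Rationality and convergence -/

section Rational

variable {N : ℕ}

/-- The series that are truncated as an expansion in `|x_1| > ⋯ > |x_N|` is. -/
def truncated (N : ℕ) : Submodule ℂ ((Fin N → ℤ) → ℂ) where
  -- The shift by `t` multiplies the monomial by `(x_i / x_j)^t`: along each such line only finitely
  -- many positive powers of `x_i / x_j` occur.
  carrier := {f | ∀ i j, i < j → ∀ k, ∃ T : ℕ, ∀ t : ℕ, T ≤ t →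
    f (k + t • (Pi.single j 1 - Pi.single i 1)) = 0}
  zero_mem' := fun _ _ _ _ => ⟨0, fun _ _ => rfl⟩
  add_mem' := by
    intro f g hf hg i j hij k
    obtain ⟨T, hT⟩ := hf i j hij k
    obtain ⟨T', hT'⟩ := hg i j hij k
    refine ⟨max T T', fun t ht => ?_⟩
    rw [Pi.add_apply, hT t (le_trans (le_max_left _ _) ht),
      hT' t (le_trans (le_max_right _ _) ht), add_zero]
  smul_mem' := by
    intro c f hf i j hij k
    obtain ⟨T, hT⟩ := hf i j hij k
    exact ⟨T, fun t ht => by rw [Pi.smul_apply, hT t ht, smul_zero]⟩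

theorem act_mem_truncated (p : MvPolynomial (Fin N) ℂ) {f : (Fin N → ℤ) → ℂ}
    (hf : f ∈ truncated N) : act p f ∈ truncated N := by
  refine act_mem _ (fun f hf l i j hij k => ?_) p hf
  obtain ⟨T, hT⟩ := hf i j hij (k + Pi.single l 1)
  refine ⟨T, fun t ht => ?_⟩
  rw [act_X, add_right_comm]
  exact hT t ht

/-- The domain `|x_1| > ⋯ > |x_N| > 0`. -/
def domain (N : ℕ) : Set (Fin N → ℂ) := {x | (∀ i, x i ≠ 0) ∧ ∀ i j, i < j → ‖x j‖ < ‖x i‖}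

theorem prod_zpow_add {x : Fin N → ℂ} (hx : ∀ i, x i ≠ 0) (k l : Fin N → ℤ) :
    ∏ i, x i ^ (-((k + l) i) - 1) = (∏ i, x i ^ (-(k i) - 1)) * ∏ i, x i ^ (-(l i)) := by
  rw [← Finset.prod_mul_distrib]
  refine Finset.prod_congr rfl fun i _ => ?_
  rw [← zpow_add₀ (hx i), Pi.add_apply]
  congr 1
  ring

theorem prod_zpow_single (x : Fin N → ℂ) (i : Fin N) (c : ℤ) :
    ∏ l, x l ^ (-((Pi.single i c : Fin N → ℤ) l)) = x i ^ (-c) := by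
  rw [Finset.prod_eq_single i]
  · simp
  · intro l _ hl
    simp [Pi.single_eq_of_ne hl]
  · simp

theorem hasSum_act_X {f : (Fin N → ℤ) → ℂ} {x : Fin N → ℂ} (hx : ∀ i, x i ≠ 0) (i : Fin N)
    {v : ℂ} (h : HasSum (fun k => f k * ∏ l, x l ^ (-(k l) - 1)) v) :
    HasSum (fun k => act (MvPolynomial.X i) f k * ∏ l, x l ^ (-(k l) - 1)) (x i * v) := by
  have := (Equiv.addRight (Pi.single i 1 : Fin N → ℤ)).hasSum_iff.2 (h.mul_left (x i))
  refine (iff_of_eq (congrArg (HasSum · _) (funext fun k => ?_))).2 this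
  rw [Function.comp_apply, Equiv.coe_addRight, act_X, prod_zpow_add hx, prod_zpow_single, zpow_neg_one]
  have := hx i
  field_simp

theorem hasSum_act {f : (Fin N → ℤ) → ℂ} {x : Fin N → ℂ} (hx : ∀ i, x i ≠ 0)
    (p : MvPolynomial (Fin N) ℂ) {v : ℂ}
    (h : HasSum (fun k => f k * ∏ l, x l ^ (-(k l) - 1)) v) :
    HasSum (fun k => act p f k * ∏ l, x l ^ (-(k l) - 1)) (MvPolynomial.eval x p * v) := by
  induction p using MvPolynomial.induction_on with
  | C a =>
    rw [act_C, MvPolynomial.eval_C]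
    simpa [mul_assoc] using h.mul_left a
  | add p q hp hq =>
    rw [act_add, map_add, add_mul]
    simpa [add_mul] using hp.add hq
  | mul_X p i hp =>
    rw [mul_comm, act_mul, map_mul, MvPolynomial.eval_X, mul_assoc]
    exact hasSum_act_X hx i hp

theorem hasSum_one (x : Fin N → ℂ) :
    HasSum (fun k => (one k : ℂ) * ∏ l, x l ^ (-(k l) - 1)) 1 := by
  have := hasSum_single (f := fun k => (one k : ℂ) * ∏ l, x l ^ (-(k l) - 1)) (fun _ => -1)
    (fun k hk => by simp [one, hk])
  simpa [one] using this

theorem hasSum_mul_of_hasSum {ι κ : Type*} {F : ι → ℂ} {G : κ → ℂ} {a b : ℂ} (hF : HasSum F a)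
    (hG : HasSum G b) : HasSum (fun p : ι × κ => F p.1 * G p.2) (a * b) :=
  hF.mul hG (summable_mul_of_summable_norm (f := F) (g := G) hF.summable.norm hG.summable.norm)

theorem prod_zpow_shift {x : Fin N → ℂ} (hx : ∀ i, x i ≠ 0) (i j : Fin N) (k : Fin N → ℤ)
    (t : ℕ) :
    (∏ l, x l ^ (-((k + (t • (Pi.single j 1 - Pi.single i 1) - Pi.single i 1 : Fin N → ℤ)) l) - 1)) *
      ((x i)⁻¹ * (x j / x i) ^ t) = ∏ l, x l ^ (-(k l) - 1) := by
  have h : ((t • (Pi.single j 1 - Pi.single i 1) - Pi.single i 1 : Fin N → ℤ)) =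
      Pi.single j (t : ℤ) + Pi.single i (-(t : ℤ) - 1) := by
    funext l
    simp only [Pi.add_apply, Pi.sub_apply, Pi.smul_apply, Pi.single_apply]
    split_ifs <;> (simp; try ring)
  rw [h, prod_zpow_add hx]
  simp only [Pi.add_apply, neg_add]
  simp only [fun l => zpow_add₀ (hx l), Finset.prod_mul_distrib]
  rw [prod_zpow_single, prod_zpow_single]
  have e : -(-(t : ℤ) - 1) = t + 1 := by ring
  rw [e, zpow_add₀ (hx i), zpow_neg, zpow_natCast, zpow_natCast, zpow_one, div_pow]
  have hi := hx i
  have hj := hx j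
  field_simp

/-- The reindexing of the double series in the expansion of `1 / (x_i - x_j)`. -/
def shiftEquiv (e e' : Fin N → ℤ) : (Fin N → ℤ) × ℕ ≃ (Fin N → ℤ) × ℕ where
  toFun p := (p.1 + (p.2 • e - e'), p.2)
  invFun p := (p.1 - (p.2 • e - e'), p.2)
  left_inv _ := Prod.ext (add_sub_cancel_right _ _) rfl
  right_inv _ := Prod.ext (sub_add_cancel _ _) rfl

/-- Dividing by `x_i - x_j` through the geometric series in `x_j / x_i`: the contributions to a
fixed coefficient telescope, and truncation makes them finite in number. -/
theorem hasSum_act_sub_fiber {f : (Fin N → ℤ) → ℂ} (hf : f ∈ truncated N) {i j : Fin N}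
    (hij : i < j) (k : Fin N → ℤ) :
    HasSum (fun t : ℕ => act (MvPolynomial.X i - MvPolynomial.X j) f
      (k + (t • (Pi.single j 1 - Pi.single i 1) - Pi.single i 1))) (f k) := by
  obtain ⟨T, hT⟩ := hf i j hij k
  have hgt : ∀ t : ℕ, act (MvPolynomial.X i - MvPolynomial.X j) f
      (k + (t • (Pi.single j 1 - Pi.single i 1) - Pi.single i 1)) =
      f (k + t • (Pi.single j 1 - Pi.single i 1)) -
        f (k + (t + 1) • (Pi.single j 1 - Pi.single i 1)) := by
    intro t
    rw [act_sub, Pi.sub_apply, act_X, act_X, add_smul, one_smul]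
    congr 2 <;> abel
  have h5 : ∑ t ∈ Finset.range T, act (MvPolynomial.X i - MvPolynomial.X j) f
      (k + (t • (Pi.single j 1 - Pi.single i 1) - Pi.single i 1)) = f k := by
    rw [Finset.sum_congr rfl fun t _ => hgt t]
    refine (Finset.sum_range_sub' (fun t : ℕ => f (k + t • (Pi.single j 1 - Pi.single i 1)))
      T).trans ?_
    rw [hT T le_rfl, zero_smul, add_zero, sub_zero]
  rw [← h5]
  refine hasSum_sum_of_ne_finset_zero fun t ht => ?_
  rw [Finset.mem_range, not_lt] at ht
  rw [hgt, hT t ht, hT (t + 1) (by omega), sub_zero]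

/-- The product with the geometric series of `1/(x_i - x_j)` is an absolutely convergent double sum.
Regrouped by `shiftEquiv`, each fibre sums to one term of the series of `f`. -/
theorem hasSum_of_act_sub {f : (Fin N → ℤ) → ℂ} (hf : f ∈ truncated N) {x : Fin N → ℂ}
    (hx : x ∈ domain N) {i j : Fin N} (hij : i < j) {v : ℂ}
    (h : HasSum (fun k => act (MvPolynomial.X i - MvPolynomial.X j) f k *
      ∏ l, x l ^ (-(k l) - 1)) v) :
    HasSum (fun k => f k * ∏ l, x l ^ (-(k l) - 1)) (v / (x i - x j)) := by
  have hxi := hx.1 i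
  have hlt : ‖x j / x i‖ < 1 := by
    rw [norm_div, div_lt_one (norm_pos_iff.2 hxi)]
    exact hx.2 i j hij
  have h1 : HasSum (fun t : ℕ => (x i)⁻¹ * (x j / x i) ^ t) ((x i - x j)⁻¹) := by
    have := (hasSum_geometric_of_norm_lt_one hlt).mul_left (x i)⁻¹
    rwa [← mul_inv, mul_sub, mul_one, mul_div_cancel₀ _ hxi] at this
  have h2 := hasSum_mul_of_hasSum h h1
  rw [← div_eq_mul_inv] at h2
  have h3 := (shiftEquiv (Pi.single j 1 - Pi.single i 1) (Pi.single i 1)).hasSum_iff.2 h2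
  refine h3.prod_fiberwise fun k => ?_
  have h6 := (hasSum_act_sub_fiber hf hij k).mul_right (∏ l, x l ^ (-(k l) - 1))
  refine (iff_of_eq (congrArg (HasSum · _) (funext fun t => ?_))).1 h6
  rw [Function.comp_apply, ← prod_zpow_shift hx.1 i j k t, ← mul_assoc]
  rfl

/-- Polynomials whose action on truncated series can be undone in the domain. -/
def divisors (N : ℕ) : Submonoid (MvPolynomial (Fin N) ℂ) where
  carrier := {p | ∀ x ∈ domain N, MvPolynomial.eval x p ≠ 0 ∧ ∀ f ∈ truncated N, ∀ v,
    HasSum (fun k => act p f k * ∏ l, x l ^ (-(k l) - 1)) v →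
    HasSum (fun k => f k * ∏ l, x l ^ (-(k l) - 1)) (v / MvPolynomial.eval x p)}
  one_mem' := by
    intro x _
    refine ⟨by simp, fun f _ v h => ?_⟩
    rw [act_one] at h
    simpa using h
  mul_mem' := by
    intro p q hp hq x hx
    refine ⟨by rw [map_mul]; exact mul_ne_zero (hp x hx).1 (hq x hx).1, fun f hf v h => ?_⟩
    rw [act_mul] at h
    rw [map_mul, ← div_div]
    exact (hq x hx).2 f hf _ ((hp x hx).2 _ (act_mem_truncated q hf) _ h)

theorem sub_mem_divisors {i j : Fin N} (hij : i < j) :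
    (MvPolynomial.X i - MvPolynomial.X j : MvPolynomial (Fin N) ℂ) ∈ divisors N := by
  intro x hx
  refine ⟨fun hc => ?_, fun f hf v h => ?_⟩
  · have hc' : x i = x j := by simpa [sub_eq_zero] using hc
    exact absurd (hx.2 i j hij) (by rw [hc']; exact lt_irrefl _)
  · simpa using hasSum_of_act_sub hf hx hij h

theorem X_mem_divisors (i : Fin N) : (MvPolynomial.X i : MvPolynomial (Fin N) ℂ) ∈ divisors N := by
  intro x hx
  refine ⟨by simpa using hx.1 i, fun f hf v h => ?_⟩
  have hxi := hx.1 i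
  have := (Equiv.subRight (Pi.single i 1 : Fin N → ℤ)).hasSum_iff.2 (h.mul_left (x i)⁻¹)
  rw [MvPolynomial.eval_X, div_eq_inv_mul]
  refine (iff_of_eq (congrArg (HasSum · _) (funext fun k => ?_))).2 this
  rw [Function.comp_apply, Equiv.subRight_apply, act_X, sub_add_cancel, sub_eq_add_neg, ← Pi.single_neg, prod_zpow_add hx.1,
    prod_zpow_single, neg_neg, zpow_one]
  field_simp

theorem diagonals_mem_divisors (N : ℕ) : VOA.diagonals N ∈ divisors N :=
  Submonoid.prod_mem _ fun _ _ => Submonoid.prod_mem _ fun _ hj =>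
    sub_mem_divisors (Finset.mem_Ioi.1 hj)

theorem axes_mem_divisors (N : ℕ) : VOA.axes N ∈ divisors N :=
  Submonoid.prod_mem _ fun i _ => X_mem_divisors i

theorem isExpansion_of_act_eq {f : (Fin N → ℤ) → ℂ} (hf : f ∈ truncated N)
    {D P : MvPolynomial (Fin N) ℂ} (hD : D ∈ divisors N) {M : ℕ}
    (h : act (D ^ M) f = act P one) : VOA.IsExpansion f D P M := by
  intro x hx hx'
  have h1 := hasSum_act hx P (hasSum_one x)
  rw [← h, mul_one] at h1
  have := ((divisors N).pow_mem hD M x ⟨hx, hx'⟩).2 f hf _ h1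
  rwa [map_pow] at this

theorem eq_of_eval_domain {p q : MvPolynomial (Fin N) ℂ}
    (h : ∀ x ∈ domain N, MvPolynomial.eval x p = MvPolynomial.eval x q) : p = q := by
  -- The domain contains the product of the real intervals `(N-i, N-i+1)`, which are positive,
  -- disjoint and decreasing in `i`; a product of infinite sets determines a polynomial.
  refine MvPolynomial.funext_set (fun i : Fin N => (fun r : ℝ => (r : ℂ)) ''
    Set.Ioo ((N : ℝ) - i) (N - i + 1)) (fun i => ?_) fun x hx => h x ?_
  · exact (Set.Ioo_infinite (by linarith)).image Complex.ofReal_injective.injOn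
  · have hx' : ∀ i : Fin N, ∃ r : ℝ, ((N : ℝ) - i < r ∧ r < N - i + 1) ∧ (r : ℂ) = x i :=
      fun i => hx i (Set.mem_univ _)
    choose r hr hrx using hx'
    have hpos : ∀ i, 0 < r i := fun i => by
      have h1 : ((i : ℕ) : ℝ) < N := by exact_mod_cast i.2
      linarith [(hr i).1]
    refine ⟨fun i => ?_, fun i j hij => ?_⟩
    · rw [← hrx]
      exact_mod_cast (hpos i).ne'
    · rw [← hrx, ← hrx, Complex.norm_real, Complex.norm_real, Real.norm_of_nonneg (hpos i).le,
        Real.norm_of_nonneg (hpos j).le]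
      have h1 : ((i : ℕ) : ℝ) + 1 ≤ (j : ℕ) := by exact_mod_cast hij
      linarith [(hr i).1, (hr j).2]

/-- The series that extend to rational functions with poles on `D = 0`. -/
def rational (D : MvPolynomial (Fin N) ℂ) : Submodule ℂ ((Fin N → ℤ) → ℂ) where
  carrier := {f | f ∈ truncated N ∧ ∃ (M : ℕ) (P : MvPolynomial (Fin N) ℂ),
    act (D ^ M) f = act P one}
  zero_mem' := ⟨Submodule.zero_mem _, 0, 0, by simp⟩
  add_mem' := by
    rintro f g ⟨hf, M, P, h⟩ ⟨hg, M', P', h'⟩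
    refine ⟨Submodule.add_mem _ hf hg, M + M', D ^ M' * P + D ^ M * P', ?_⟩
    rw [map_add, act_add, act_mul, ← h, act_mul, ← h', ← act_mul, ← act_mul, pow_add,
      mul_comm (D ^ M')]
  smul_mem' := by
    rintro c f ⟨hf, M, P, h⟩
    refine ⟨Submodule.smul_mem _ c hf, M, MvPolynomial.C c * P, ?_⟩
    rw [map_smul, h, act_mul, act_C]

theorem act_mem_rational {D : MvPolynomial (Fin N) ℂ} (p : MvPolynomial (Fin N) ℂ)
    {f : (Fin N → ℤ) → ℂ} (hf : f ∈ rational D) : act p f ∈ rational D := by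
  obtain ⟨hf, M, P, h⟩ := hf
  exact ⟨act_mem_truncated p hf, M, p * P, by rw [act_comm, h, act_mul]⟩

theorem isRationalSeries_of_mem {D : MvPolynomial (Fin N) ℂ} (hD : D ∈ divisors N)
    {f : (Fin N → ℤ) → ℂ} (hf : f ∈ rational D) : VOA.IsRationalSeries f D := by
  obtain ⟨hf, M, P, h⟩ := hf
  exact ⟨P, M, isExpansion_of_act_eq hf hD h⟩

section Value

variable {D : MvPolynomial (Fin N) ℂ}

/-- `ratValue` chooses some fraction `P' / D^M'`. Any other one has the same sum on the domain, so
the cross-multiplied polynomials agree there and hence everywhere; the choice is immaterial. -/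
theorem exists_ratValue_eq (hD : D ∈ divisors N) {f : (Fin N → ℤ) → ℂ} (hf : f ∈ truncated N) {M : ℕ}
    {P : MvPolynomial (Fin N) ℂ} (h : act (D ^ M) f = act P one) :
    ∃ (M' : ℕ) (P' : MvPolynomial (Fin N) ℂ), P * D ^ M' = P' * D ^ M ∧
      ∀ {S : Type _} [CommRing S] [Algebra ℂ S] (a : Fin N → S),
        VOA.ratValue f D a =
          MvPolynomial.aeval a P' * Ring.inverse (MvPolynomial.aeval a D) ^ M' := by
  have hr : VOA.IsRationalSeries f D := ⟨P, M, isExpansion_of_act_eq hf hD h⟩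
  refine ⟨hr.choose_spec.choose, hr.choose, ?_, fun {S} _ _ a => ?_⟩
  · refine eq_of_eval_domain fun x hx => ?_
    have h1 := isExpansion_of_act_eq hf hD h x hx.1 hx.2
    have h2 := hr.choose_spec.choose_spec x hx.1 hx.2
    have h3 := h1.unique h2
    have hne := (hD x hx).1
    rw [div_eq_div_iff (pow_ne_zero _ hne) (pow_ne_zero _ hne)] at h3
    simpa using h3
  · rw [VOA.ratValue, dif_pos hr]

/-- The value of the rational function `P / D^M`. -/
theorem pow_mul_ratValue (hD : D ∈ divisors N) {S : Type*} [CommRing S] [Algebra ℂ S]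
    {a : Fin N → S} (ha : IsUnit (MvPolynomial.aeval a D)) {f : (Fin N → ℤ) → ℂ} (hf : f ∈ truncated N) {M : ℕ}
    {P : MvPolynomial (Fin N) ℂ} (h : act (D ^ M) f = act P one) :
    MvPolynomial.aeval a D ^ M * VOA.ratValue f D a = MvPolynomial.aeval a P := by
  obtain ⟨M', P', h1, h2⟩ := exists_ratValue_eq hD hf h
  rw [h2 a]
  have h3 := congrArg (MvPolynomial.aeval a) h1
  simp only [map_mul, map_pow] at h3
  obtain ⟨u, hu⟩ := ha
  rw [← hu] at h3 ⊢
  rw [Ring.inverse_unit, mul_comm, mul_right_comm, ← h3, mul_assoc, ← mul_pow]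
  simp

variable {S : Type*} [CommRing S] [Algebra ℂ S] {a : Fin N → S}

/-- Values of rational functions are computed by any linear summation method that is compatible
with multiplication by the variables. -/
theorem eq_ratValue_mul (hD : D ∈ divisors N) (ha : IsUnit (MvPolynomial.aeval a D))
    (K : Submodule ℂ ((Fin N → ℤ) → ℂ))
    (hK : ∀ f ∈ K, ∀ i, act (MvPolynomial.X i) f ∈ K) (E : ((Fin N → ℤ) → ℂ) → S)
    (hadd : ∀ f ∈ K, ∀ g ∈ K, E (f + g) = E f + E g)
    (hsmul : ∀ c : ℂ, ∀ f ∈ K, E (c • f) = c • E f)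
    (hX : ∀ f ∈ K, ∀ i, E (act (MvPolynomial.X i) f) = a i * E f) (hone : one ∈ K)
    {f : (Fin N → ℤ) → ℂ} (hfr : f ∈ truncated N) {M : ℕ}
    {P : MvPolynomial (Fin N) ℂ} {g : (Fin N → ℤ) → ℂ} (hg : g ∈ K)
    (h : act (D ^ M) f = act P one) (hgf : act (D ^ M) g = act (D ^ M) f) :
    E g = VOA.ratValue f D a * E one := by
  have key : ∀ p : MvPolynomial (Fin N) ℂ, ∀ f ∈ K, E (act p f) = MvPolynomial.aeval a p * E f := by
    intro p
    induction p using MvPolynomial.induction_on with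
    | C c => intro f hf; rw [act_C, hsmul c f hf, MvPolynomial.aeval_C, Algebra.smul_def]
    | add p q hp hq =>
      intro f hf
      rw [act_add, hadd _ (act_mem K hK p hf) _ (act_mem K hK q hf), hp f hf, hq f hf, map_add,
        add_mul]
    | mul_X p i hp =>
      intro f hf
      rw [act_mul, hp _ (hK f hf i), hX f hf, map_mul, MvPolynomial.aeval_X, mul_assoc]
  -- On `K` the map `E` is linear over polynomials acting through their values at `a`, so the
  -- relation `D^M g = P · 1` can be evaluated and the unit `D(a)^M` cancelled.
  have h1 := key (D ^ M) g hg
  rw [hgf, h, key P _ hone, ← pow_mul_ratValue hD ha hfr h, map_pow, mul_assoc] at h1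
  exact ((ha.pow M).mul_left_cancel h1).symm

theorem ratValue_act (hD : D ∈ divisors N) (ha : IsUnit (MvPolynomial.aeval a D))
    (p : MvPolynomial (Fin N) ℂ) {f : (Fin N → ℤ) → ℂ} (hf : f ∈ rational D) :
    VOA.ratValue (act p f) D a = MvPolynomial.aeval a p * VOA.ratValue f D a := by
  obtain ⟨hf, M, P, h⟩ := hf
  have h1 := pow_mul_ratValue hD ha hf h
  have h2 := pow_mul_ratValue hD ha (act_mem_truncated p hf) (M := M) (P := p * P)
    (by rw [act_comm, h, act_mul])
  refine (ha.pow M).mul_left_cancel ?_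
  rw [h2, mul_left_comm, h1, map_mul]

theorem ratValue_add (hD : D ∈ divisors N) (ha : IsUnit (MvPolynomial.aeval a D))
    {f g : (Fin N → ℤ) → ℂ} (hf : f ∈ rational D) (hg : g ∈ rational D) :
    VOA.ratValue (f + g) D a = VOA.ratValue f D a + VOA.ratValue g D a := by
  obtain ⟨hf, M, P, h⟩ := hf
  obtain ⟨hg, M', P', h'⟩ := hg
  have h1 := pow_mul_ratValue hD ha hf h
  have h2 := pow_mul_ratValue hD ha hg h'
  have h3 := pow_mul_ratValue hD ha (Submodule.add_mem _ hf hg) (M := M + M')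
    (P := D ^ M' * P + D ^ M * P') (by
      rw [map_add, act_add, act_mul, ← h, act_mul, ← h', ← act_mul, ← act_mul, pow_add,
        mul_comm (D ^ M')])
  refine (ha.pow (M + M')).mul_left_cancel ?_
  rw [h3, map_add, map_mul, map_mul, ← h1, ← h2, map_pow, map_pow]
  ring

theorem ratValue_smul (hD : D ∈ divisors N) (ha : IsUnit (MvPolynomial.aeval a D)) (c : ℂ)
    {f : (Fin N → ℤ) → ℂ} (hf : f ∈ rational D) :
    VOA.ratValue (c • f) D a = c • VOA.ratValue f D a := by
  rw [← act_C, ratValue_act hD ha _ hf, MvPolynomial.aeval_C, Algebra.smul_def]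

/-- Evaluation of rational functions at a point. -/
def value (hD : D ∈ divisors N) (ha : IsUnit (MvPolynomial.aeval a D)) : rational D →ₗ[ℂ] S where
  toFun f := VOA.ratValue f.1 D a
  map_add' f g := ratValue_add hD ha f.2 g.2
  map_smul' c f := ratValue_smul hD ha c f.2

theorem one_mem_truncated (N : ℕ) : one ∈ truncated N := by
  intro i j hij k
  refine ⟨(-k j).toNat, fun t ht => ?_⟩
  rw [one, if_neg]
  intro hc
  have := congrFun hc j
  simp [Pi.single_eq_of_ne hij.ne'] at this
  omega

theorem one_mem_rational : one ∈ rational D :=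
  ⟨one_mem_truncated N, 0, 1, by simp⟩

theorem ratValue_one (hD : D ∈ divisors N) (ha : IsUnit (MvPolynomial.aeval a D)) :
    VOA.ratValue one D a = 1 := by
  have := pow_mul_ratValue hD ha (one_mem_truncated N) (M := 0) (P := 1) (by simp)
  simpa using this

theorem map_ratValue (hD : D ∈ divisors N) (ha : IsUnit (MvPolynomial.aeval a D)) {S' : Type*}
    [CommRing S'] [Algebra ℂ S'] (φ : S →ₐ[ℂ] S') {f : (Fin N → ℤ) → ℂ} (hf : f ∈ rational D) :
    φ (VOA.ratValue f D a) = VOA.ratValue f D fun i => φ (a i) := by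
  obtain ⟨hf, M, P, h⟩ := hf
  have h1 := pow_mul_ratValue hD ha hf h
  have hφ : ∀ p : MvPolynomial (Fin N) ℂ,
      MvPolynomial.aeval (fun i => φ (a i)) p = φ (MvPolynomial.aeval a p) := fun p =>
    (MvPolynomial.comp_aeval_apply a φ p).symm
  have ha' : IsUnit (MvPolynomial.aeval (fun i => φ (a i)) D) := by rw [hφ]; exact ha.map φ
  have h2 := pow_mul_ratValue hD ha' hf h
  refine (ha'.pow M).mul_left_cancel ?_
  rw [h2, hφ, hφ, ← map_pow, ← map_mul, h1]

end Value

end Rational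
end FormalSeries

/-! ### Commutators with the Virasoro modes -/

namespace VOA

open FormalSeries

variable {V : Type*} [AddCommGroup V] [Module ℂ V] {A : VOA V}

section Bracket

variable {R : Type*} [Ring R] (x y z : R)

theorem bracket_sub : ⁅x, y - z⁆ = ⁅x, y⁆ - ⁅x, z⁆ := by simp only [Ring.lie_def]; noncomm_ring

theorem sub_bracket : ⁅x - y, z⁆ = ⁅x, z⁆ - ⁅y, z⁆ := by simp only [Ring.lie_def]; noncomm_ring

theorem bracket_add : ⁅x, y + z⁆ = ⁅x, y⁆ + ⁅x, z⁆ := by simp only [Ring.lie_def]; noncomm_ring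

theorem neg_bracket : ⁅-x, y⁆ = -⁅x, y⁆ := by simp only [Ring.lie_def]; noncomm_ring

theorem bracket_bracket : ⁅x, ⁅y, z⁆⁆ = ⁅⁅x, y⁆, z⁆ + ⁅y, ⁅x, z⁆⁆ := by
  simp only [Ring.lie_def]; noncomm_ring

theorem sum_bracket {ι : Type*} (s : Finset ι) (f : ι → R) :
    ⁅∑ i ∈ s, f i, y⁆ = ∑ i ∈ s, ⁅f i, y⁆ := by
  simp only [Ring.lie_def, Finset.sum_mul, Finset.mul_sum, Finset.sum_sub_distrib]

variable [Algebra ℂ R]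

theorem bracket_smul (c : ℂ) : ⁅x, c • y⁆ = c • ⁅x, y⁆ := by
  simp only [Ring.lie_def, mul_smul_comm, smul_mul_assoc, smul_sub]

theorem smul_bracket (c : ℂ) : ⁅c • x, y⁆ = c • ⁅x, y⁆ := by
  simp only [Ring.lie_def, mul_smul_comm, smul_mul_assoc, smul_sub]

/-- The linear map `⁅x, ·⁆`. -/
def bracketLeft : R →ₗ[ℂ] R := LinearMap.mulLeft ℂ x - LinearMap.mulRight ℂ x

theorem bracketLeft_apply : bracketLeft x y = ⁅x, y⁆ := rfl

end Bracket

theorem exists_mode_eq_zero (u v : V) : ∃ B : ℤ, ∀ n, B ≤ n → A.mode u n v = 0 := by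
  refine ⟨-(HahnSeries.order ((HahnModule.of ℂ).symm (A.Y u v))), fun n hn => ?_⟩
  exact VertexOperator.ncoeff_eq_zero_of_lt_order _ _ _ (by omega)

theorem mode_smul (c : ℂ) (u : V) (n : ℤ) : A.mode (c • u) n = c • A.mode u n := by
  simp [mode]

theorem mode_zero (n : ℤ) : A.mode 0 n = 0 := by
  simp [mode]

theorem act_sub_pow {U : Type*} [AddCommGroup U] [Module ℂ U] {σ : Type*} [DecidableEq σ]
    (i j : σ) (N : ℕ) (F : (σ → ℤ) → U) (k : σ → ℤ) :
    act ((MvPolynomial.X i - MvPolynomial.X j) ^ N) F k =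
      ∑ l ∈ Finset.range (N + 1), ((-1 : ℂ) ^ l * (N.choose l : ℂ)) •
        F (k + (Pi.single i ((N : ℤ) - l) + Pi.single j (l : ℤ))) := by
  have h : (MvPolynomial.X i - MvPolynomial.X j : MvPolynomial σ ℂ) ^ N =
      ∑ l ∈ Finset.range (N + 1), MvPolynomial.monomial
        (Finsupp.single i (N - l) + Finsupp.single j l) ((-1 : ℂ) ^ l * (N.choose l : ℂ)) := by
    rw [sub_eq_add_neg, add_comm, add_pow]
    refine Finset.sum_congr rfl fun l _ => ?_
    rw [neg_pow, ← mul_one (((-1 : ℂ) ^ l * (N.choose l : ℂ))), ← one_mul (1 : ℂ),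
      ← MvPolynomial.C_mul_monomial, ← MvPolynomial.monomial_mul, ← MvPolynomial.X_pow_eq_monomial,
      ← MvPolynomial.X_pow_eq_monomial]
    simp only [map_mul, map_pow, map_neg, map_one, map_natCast]
    ring
  rw [h, map_sum, LinearMap.sum_apply, Finset.sum_apply]
  refine Finset.sum_congr rfl fun l hl => ?_
  rw [act_monomial]
  congr 2
  funext s
  have : l ≤ N := by simpa [Nat.lt_succ_iff] using hl
  simp only [Finsupp.add_apply, Pi.add_apply, Finsupp.single_apply, Pi.single_apply]
  by_cases h1 : i = s <;> by_cases h2 : j = s <;> simp [h1, h2, eq_comm] <;> omega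

variable (A) in
/-- The commutator `[Y(u,x), Y(v,y)]`, as a series in `x = x_0` and `y = x_1`. -/
def lieSeries (u v : V) (k : Fin 2 → ℤ) : Module.End ℂ V := ⁅A.mode u (k 0), A.mode v (k 1)⁆

theorem exists_act_lieSeries (u v : V) : ∃ N : ℕ,
    act ((MvPolynomial.X 0 - MvPolynomial.X 1) ^ N) (A.lieSeries u v) = 0 := by
  obtain ⟨N, hN⟩ := A.locality u v
  refine ⟨N, funext fun k => ?_⟩
  rw [act_sub_pow, Pi.zero_apply, ← hN (k 0) (k 1)]
  refine Finset.sum_congr rfl fun l _ => ?_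
  simp [lieSeries, mode, add_sub_assoc]

/-- Locality for series in several variables. -/
theorem act_pow_eq_zero {σ : Type*} [DecidableEq σ] (i j : σ) (hij : i ≠ j) {N : ℕ} {u v : V}
    (hN : act ((MvPolynomial.X 0 - MvPolynomial.X 1) ^ N) (A.lieSeries u v) = 0)
    {U : Type*} [AddCommGroup U] [Module ℂ U]
    (Φ : (σ → ℤ) → Module.End ℂ V →ₗ[ℂ] U)
    (hi : ∀ k, Φ (k + Pi.single i 1) = Φ k) (hj : ∀ k, Φ (k + Pi.single j 1) = Φ k) :
    act ((MvPolynomial.X i - MvPolynomial.X j) ^ N)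
      (fun k => Φ k ⁅A.mode u (k i), A.mode v (k j)⁆) = 0 := by
  have h := act_rename (![i, j] : Fin 2 → σ) (by
      intro a b hab
      fin_cases a <;> fin_cases b <;> simp_all) Φ (fun k a => by fin_cases a <;> simp [hi, hj])
    ((MvPolynomial.X 0 - MvPolynomial.X 1) ^ N) (A.lieSeries u v)
  rw [hN] at h
  simpa [lieSeries, Pi.zero_def] using h

/-! ### Dong's lemma and uniqueness -/

/-- Expand `(y-x)^{2N}` as `((z-x) - (z-y))^{2N}`. Each term contains `(z-y)^N` or `(z-x)^N`; in the
latter case the remaining `(y-x)^N` completes the second annihilator. -/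
theorem act_pow_three_mul {σ : Type*} [DecidableEq σ] {F : (σ → ℤ) → Module.End ℂ V} (x y z : σ) {N : ℕ}
    (h1 : act ((MvPolynomial.X z - MvPolynomial.X y) ^ N) F = 0)
    (h2 : act ((MvPolynomial.X z - MvPolynomial.X x) ^ N * (MvPolynomial.X y - MvPolynomial.X x) ^ N)
      F = 0) :
    act ((MvPolynomial.X y - MvPolynomial.X x) ^ (3 * N)) F = 0 := by
  have e : ((MvPolynomial.X y - MvPolynomial.X x) ^ (3 * N) : MvPolynomial σ ℂ) =
      (MvPolynomial.X y - MvPolynomial.X x) ^ N *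
      (-(MvPolynomial.X z - MvPolynomial.X y) + (MvPolynomial.X z - MvPolynomial.X x)) ^ (2 * N) := by
    have : (-(MvPolynomial.X z - MvPolynomial.X y) + (MvPolynomial.X z - MvPolynomial.X x) :
      MvPolynomial σ ℂ) = MvPolynomial.X y - MvPolynomial.X x := by ring
    rw [this, ← pow_add]
    congr 1
    ring
  rw [e, add_pow, Finset.mul_sum, map_sum, LinearMap.sum_apply]
  refine Finset.sum_eq_zero fun l hl => ?_
  have hl' : l ≤ 2 * N := by simpa [Nat.lt_succ_iff] using hl
  by_cases h : N ≤ l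
  · refine act_eq_zero_of_dvd ?_ h1
    rw [neg_pow, mul_assoc, mul_assoc]
    exact Dvd.dvd.mul_left (Dvd.dvd.mul_left (Dvd.dvd.mul_right (pow_dvd_pow _ h) _) _) _
  · refine act_eq_zero_of_dvd ?_ h2
    rw [mul_comm ((MvPolynomial.X z - MvPolynomial.X x) ^ N)]
    exact mul_dvd_mul dvd_rfl
      (Dvd.dvd.mul_right (Dvd.dvd.mul_left (pow_dvd_pow _ (by omega)) _) _)

variable (A) in
/-- The coefficients of the field `Res_x (x-y)^j [Y(a,x), Y(u,y)]`. -/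
def residueField (a u : V) (j : ℕ) (n : ℤ) : Module.End ℂ V :=
  ∑ i ∈ Finset.range (j + 1), ((-1 : ℂ) ^ i * (j.choose i : ℂ)) • ⁅A.mode a (j - i), A.mode u (n + i)⁆

variable (A) in
/-- The iterated commutator `[[Y(a,z), Y(u,y)], Y(v,x)]`. -/
def lieLieSeries (a u v : V) (k : Fin 3 → ℤ) : Module.End ℂ V :=
  ⁅⁅A.mode a (k 0), A.mode u (k 1)⁆, A.mode v (k 2)⁆

/-- The heart of Dong's lemma. Locality of `a` and `u` gives the annihilator `(z-y)^N`; the Jacobi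
identity, through the brackets `[u,v]` and `[a,v]`, gives `(y-x)^N (z-x)^N`. -/
theorem exists_act_lieLieSeries (a u v : V) : ∃ N : ℕ,
    act ((MvPolynomial.X 1 - MvPolynomial.X 2) ^ N) (A.lieLieSeries a u v) = 0 := by
  obtain ⟨N₁, h₁⟩ := exists_act_lieSeries (A := A) a u
  obtain ⟨N₂, h₂⟩ := exists_act_lieSeries (A := A) a v
  obtain ⟨N₃, h₃⟩ := exists_act_lieSeries (A := A) u v
  have h₁' := act_eq_zero_of_dvd (pow_dvd_pow _ (by omega : N₁ ≤ N₁ + N₂ + N₃)) h₁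
  have h₂' := act_eq_zero_of_dvd (pow_dvd_pow _ (by omega : N₂ ≤ N₁ + N₂ + N₃)) h₂
  have h₃' := act_eq_zero_of_dvd (pow_dvd_pow _ (by omega : N₃ ≤ N₁ + N₂ + N₃)) h₃
  refine ⟨3 * (N₁ + N₂ + N₃), act_pow_three_mul 2 1 0 ?_ ?_⟩
  · have := act_pow_eq_zero (σ := Fin 3) 0 1 (by decide) h₁'
      (fun k => -bracketLeft (A.mode v (k 2))) (fun k => by simp) (fun k => by simp)
    refine Eq.trans (congrArg _ (funext fun k => ?_)) this
    simp only [lieLieSeries, LinearMap.neg_apply, bracketLeft_apply, Ring.lie_def]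
    noncomm_ring
  · have e1 := act_pow_eq_zero (σ := Fin 3) 1 2 (by decide) h₃'
      (fun k => bracketLeft (A.mode a (k 0))) (fun k => by simp) (fun k => by simp)
    have e2 := act_pow_eq_zero (σ := Fin 3) 0 2 (by decide) h₂'
      (fun k => bracketLeft (A.mode u (k 1))) (fun k => by simp) (fun k => by simp)
    have e3 : A.lieLieSeries a u v =
        (fun k => bracketLeft (A.mode a (k 0)) ⁅A.mode u (k 1), A.mode v (k 2)⁆) -
        fun k => bracketLeft (A.mode u (k 1)) ⁅A.mode a (k 0), A.mode v (k 2)⁆ := by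
      funext k
      simp only [lieLieSeries, Pi.sub_apply, bracketLeft_apply]
      rw [bracket_bracket, add_sub_cancel_right]
    rw [e3, map_sub, act_eq_zero_of_dvd (Dvd.intro_left _ rfl) e1,
      act_eq_zero_of_dvd (Dvd.intro _ rfl) e2, sub_zero]

/-- The residue is the coefficient of index `0` in the first variable, which the factor `(y-x)^N`
does not involve. -/
theorem act_pow_residueField (a u v : V) (j : ℕ) : ∃ N : ℕ,
    act ((MvPolynomial.X 0 - MvPolynomial.X 1) ^ N)
      (fun k : Fin 2 → ℤ => ⁅A.residueField a u j (k 0), A.mode v (k 1)⁆) = 0 := by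
  obtain ⟨N, hN⟩ := exists_act_lieLieSeries (A := A) a u v
  refine ⟨N, funext fun k => ?_⟩
  have h : act ((MvPolynomial.X 1 - MvPolynomial.X 2) ^ N)
      (act ((MvPolynomial.X 0 - MvPolynomial.X 1) ^ j) (A.lieLieSeries a u v)) ![0, k 0, k 1] = 0 := by
    rw [act_comm, hN, map_zero, Pi.zero_apply]
  rw [act_sub_pow] at h ⊢
  rw [Pi.zero_apply, ← h]
  refine Finset.sum_congr rfl fun l _ => ?_
  rw [act_sub_pow, residueField, sum_bracket]
  congr 1
  refine Finset.sum_congr rfl fun i _ => ?_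
  rw [smul_bracket]
  simp only [lieLieSeries, Pi.add_apply]
  simp

/-- A field that is local to all vertex operators and annihilates the vacuum is zero. -/
theorem field_eq_zero {φ : ℤ → Module.End ℂ V} (hφ : ∀ n, φ n A.vac = 0)
    (hloc : ∀ v, ∃ N : ℕ, act ((MvPolynomial.X 0 - MvPolynomial.X 1) ^ N)
      (fun k : Fin 2 → ℤ => ⁅φ (k 0), A.mode v (k 1)⁆) = 0) (n : ℤ) : φ n = 0 := by
  ext v
  obtain ⟨N, hN⟩ := hloc v
  -- At the index `(n - N, -1)`, applied to the vacuum, the terms with `φ` on the right vanish, and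
  -- so do those with `v(l-1)𝟙` for `l ≥ 1`; only `φ(n) v(-1)𝟙 = φ(n) v` is left.
  have h := congrArg (fun T : Module.End ℂ V => T A.vac) (congrFun hN ![n - N, -1])
  rw [act_sub_pow, Finset.sum_range_succ'] at h
  have h0 : ∀ l : ℕ, A.mode v l A.vac = 0 := fun l => A.annihilate v _ (by omega)
  have hc : A.mode v (-1) A.vac = v := A.create v
  simpa [Ring.lie_def, hφ, h0, hc, LinearMap.sum_apply] using h

/-- Both sides are local to every vertex operator, the left by Dong's lemma, so it is enough to
compare them on the vacuum. -/
theorem residueField_eq (a u : V) (j : ℕ)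
    (h : ∀ n, A.residueField a u j n A.vac = A.mode (A.mode a j u) n A.vac) (n : ℤ) :
    A.residueField a u j n = A.mode (A.mode a j u) n := by
  rw [← sub_eq_zero]
  refine field_eq_zero (φ := fun n => A.residueField a u j n - A.mode (A.mode a j u) n)
    (fun n => by rw [LinearMap.sub_apply, h, sub_self]) (fun v => ?_) n
  obtain ⟨N₁, h₁⟩ := act_pow_residueField (A := A) a u v j
  obtain ⟨N₂, h₂⟩ := exists_act_lieSeries (A := A) (A.mode a j u) v
  refine ⟨max N₁ N₂, ?_⟩
  have h₁' := act_eq_zero_of_dvd (pow_dvd_pow _ (le_max_left N₁ N₂)) h₁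
  have h₂' := act_eq_zero_of_dvd (pow_dvd_pow _ (le_max_right N₁ N₂)) h₂
  have : (fun k : Fin 2 → ℤ => ⁅A.residueField a u j (k 0) - A.mode (A.mode a j u) (k 0),
      A.mode v (k 1)⁆) = (fun k : Fin 2 → ℤ => ⁅A.residueField a u j (k 0), A.mode v (k 1)⁆) -
      A.lieSeries (A.mode a j u) v := by
    funext k
    exact sub_bracket _ _ _
  rw [this, map_sub, h₁', h₂', sub_zero]

/-! ### Translation and the Möbius generators -/

theorem mode_conf (n : ℤ) : A.mode A.conf n = A.L (n - 1) := by simp [L]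

theorem L_neg_one_vac : A.L (-1) A.vac = 0 := A.annihilate A.conf 0 le_rfl

theorem L_zero_vac : A.L 0 A.vac = 0 := A.annihilate A.conf 1 (by norm_num)

theorem L_one_vac : A.L 1 A.vac = 0 := A.annihilate A.conf 2 (by norm_num)

theorem mode_L_neg_one (u : V) (n : ℤ) : A.mode (A.L (-1) u) n = (-(n : ℂ)) • A.mode u (n - 1) :=
  A.translation u n

/-- The coefficients of `Y(u,z)𝟙 = e^{zL(-1)} u`, by iterating the translation axiom. -/
theorem mode_vac_succ (u : V) (m : ℕ) : A.mode u (-(m : ℤ) - 1) A.vac =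
    ((m.factorial : ℂ)⁻¹) • (A.L (-1) ^ m) u := by
  induction m generalizing u with
  | zero => simpa [mode] using A.create u
  | succ m ih =>
    have h := congrArg (fun T : Module.End ℂ V => T A.vac) (mode_L_neg_one (A := A) u (-(m : ℤ) - 1))
    simp only [LinearMap.smul_apply] at h
    rw [ih] at h
    have e : (-((m + 1 : ℕ) : ℤ) - 1) = -(m : ℤ) - 1 - 1 := by push_cast; ring
    have hne : ((m : ℂ) + 1) ≠ 0 := by exact_mod_cast Nat.succ_ne_zero m
    rw [e, pow_succ, Module.End.mul_apply, Nat.factorial_succ, Nat.cast_mul, mul_inv, mul_smul, h,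
      smul_smul]
    have : (((m + 1 : ℕ) : ℂ)⁻¹ * -((-(m : ℤ) - 1 : ℤ) : ℂ)) = 1 := by
      push_cast
      field_simp
      ring
    rw [this, one_smul]

theorem mode_vac_nonneg (u : V) {n : ℤ} (hn : 0 ≤ n) : A.mode u n A.vac = 0 := A.annihilate u n hn

/-- The case `j = 0`, `a = ω` of `residueField_eq`; on the vacuum both sides are explicit by
`mode_vac_succ`. -/
theorem L_neg_one_lie (u : V) (n : ℤ) :
    ⁅A.L (-1), A.mode u n⁆ = A.mode (A.L (-1) u) n := by
  have key : ∀ n, A.residueField A.conf u 0 n = ⁅A.L (-1), A.mode u n⁆ := fun n => by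
    simp [residueField, mode_conf]
  have h := residueField_eq (A := A) A.conf u 0 (fun n => ?_) n
  · rw [key] at h
    simpa [mode_conf] using h
  · rw [key, Ring.lie_def, LinearMap.sub_apply, Module.End.mul_apply, Module.End.mul_apply,
      L_neg_one_vac, map_zero, sub_zero]
    simp only [Nat.cast_zero, mode_conf, zero_sub]
    by_cases hn : 0 ≤ n
    · rw [mode_vac_nonneg u hn, mode_vac_nonneg _ hn, map_zero]
    · obtain ⟨m, rfl⟩ : ∃ m : ℕ, n = -(m : ℤ) - 1 := ⟨(-n - 1).toNat, by omega⟩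
      rw [mode_vac_succ, mode_vac_succ, map_smul, ← Module.End.mul_apply, ← pow_succ', pow_succ,
        Module.End.mul_apply]

theorem lie_mode_L_neg_one (u : V) (n : ℤ) :
    ⁅A.L (-1), A.mode u n⁆ = (-(n : ℂ)) • A.mode u (n - 1) := by
  rw [L_neg_one_lie, mode_L_neg_one]

/-- A translation covariant field is creative once it is regular on the vacuum. -/
theorem field_vac {φ : ℤ → Module.End ℂ V} (h : ∀ n, ⁅A.L (-1), φ n⁆ = (-(n : ℂ)) • φ (n - 1))
    (h0 : ∀ n, 0 ≤ n → φ n A.vac = 0) (n : ℤ) :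
    φ n A.vac = A.mode (φ (-1) A.vac) n A.vac := by
  by_cases hn : 0 ≤ n
  · rw [h0 n hn, mode_vac_nonneg _ hn]
  obtain ⟨m, rfl⟩ : ∃ m : ℕ, n = -(m : ℤ) - 1 := ⟨(-n - 1).toNat, by omega⟩
  clear hn
  induction m with
  | zero => simpa [mode] using (A.create (φ (-1) A.vac)).symm
  | succ m ih =>
    have h1 := congrArg (fun T : Module.End ℂ V => T A.vac) (h (-(m : ℤ) - 1))
    have h2 := congrArg (fun T : Module.End ℂ V => T A.vac)
      (lie_mode_L_neg_one (A := A) (φ (-1) A.vac) (-(m : ℤ) - 1))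
    simp only [Ring.lie_def, LinearMap.sub_apply, Module.End.mul_apply, L_neg_one_vac, map_zero,
      sub_zero, LinearMap.smul_apply] at h1 h2
    rw [ih, h2] at h1
    have e : (-((m + 1 : ℕ) : ℤ) - 1) = -(m : ℤ) - 1 - 1 := by push_cast; ring
    have hne : -((-(m : ℤ) - 1 : ℤ) : ℂ) ≠ 0 := by
      rw [← Int.cast_neg]
      exact Int.cast_ne_zero.2 (by omega)
    rw [e]
    exact (smul_right_injective V hne h1).symm

/-- The case `j = 1`, where the residue is `[L(0),u(n)] - [L(-1),u(n+1)]`. By the Jacobi identity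
and the case `j = 0` it is translation covariant, so `field_vac` reduces the comparison on the
vacuum to the mode `-1`. -/
theorem lie_L_mode (u : V) (n : ℤ) :
    ⁅A.L 0, A.mode u n⁆ = A.mode (A.L 0 u) n + A.mode (A.L (-1) u) (n + 1) := by
  have key : ∀ n, A.residueField A.conf u 1 n =
      ⁅A.L 0, A.mode u n⁆ - ⁅A.L (-1), A.mode u (n + 1)⁆ := fun n => by
    simp [residueField, mode_conf, Finset.sum_range_succ, sub_eq_add_neg]
  have h := residueField_eq (A := A) A.conf u 1 (fun n => ?_) n
  · rw [key, sub_eq_iff_eq_add, L_neg_one_lie] at h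
    simpa [mode_conf] using h
  · have hL : ⁅A.L (-1), A.L 0⁆ = -A.L (-1) := by
      ext v
      have := L_lie (A := A) (-1) 0 v
      simpa [Ring.lie_def] using this
    rw [field_vac (φ := A.residueField A.conf u 1)]
    · congr 2
      rw [key]
      simp [Ring.lie_def, L_zero_vac, L_neg_one_vac, mode_vac_nonneg, mode_conf]
      rw [show A.mode u (-1) A.vac = u from A.create u]
    · intro n
      rw [key, key, bracket_sub, bracket_bracket, hL, lie_mode_L_neg_one, lie_mode_L_neg_one,
        bracket_smul, bracket_smul, neg_bracket, lie_mode_L_neg_one, lie_mode_L_neg_one]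
      simp only [sub_add_cancel, add_sub_cancel_right, smul_sub, lie_mode_L_neg_one]
      push_cast
      module
    · intro n hn
      rw [key]
      simp [Ring.lie_def, L_zero_vac, L_neg_one_vac, mode_vac_nonneg, hn, add_nonneg]

/-- The case `j = 2`, by the same argument; it also needs `[L(-1),L(1)] = -2 L(0)`. -/
theorem lie_L_one_mode (u : V) (n : ℤ) :
    ⁅A.L 1, A.mode u n⁆ = A.mode (A.L 1 u) n + (2 : ℂ) • A.mode (A.L 0 u) (n + 1) +
      A.mode (A.L (-1) u) (n + 2) := by
  have key : ∀ n, A.residueField A.conf u 2 n =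
      ⁅A.L 1, A.mode u n⁆ - (2 : ℂ) • ⁅A.L 0, A.mode u (n + 1)⁆ + ⁅A.L (-1), A.mode u (n + 2)⁆ :=
    fun n => by
    simp [residueField, mode_conf, Finset.sum_range_succ, sub_eq_add_neg]
  have h := residueField_eq (A := A) A.conf u 2 (fun n => ?_) n
  · rw [key, L_neg_one_lie, lie_L_mode] at h
    have h' : ⁅A.L 1, A.mode u n⁆ - (2 : ℂ) • (A.mode (A.L 0 u) (n + 1) +
        A.mode (A.L (-1) u) (n + 1 + 1)) + A.mode (A.L (-1) u) (n + 2) = A.mode (A.L 1 u) n := by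
      simpa [mode_conf] using h
    rw [← h', add_assoc n 1 1]
    norm_num
    module
  · have hL : ⁅A.L (-1), A.L 0⁆ = -A.L (-1) := by
      ext v
      have := L_lie (A := A) (-1) 0 v
      simpa [Ring.lie_def] using this
    have hL' : ⁅A.L (-1), A.L 1⁆ = (-2 : ℂ) • A.L 0 := by
      ext v
      have := L_lie (A := A) (-1) 1 v
      norm_num at this
      simpa [Ring.lie_def] using this
    rw [field_vac (φ := A.residueField A.conf u 2)]
    · congr 2
      rw [key]
      simp [Ring.lie_def, L_zero_vac, L_neg_one_vac, L_one_vac, mode_vac_nonneg, mode_conf]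
      rw [show A.mode u (-1) A.vac = u from A.create u]
    · intro n
      rw [key, key, bracket_add, bracket_sub, bracket_smul, bracket_bracket, hL',
        bracket_bracket _ (A.L 0), hL]
      simp only [lie_mode_L_neg_one, bracket_smul, smul_bracket, neg_bracket]
      have e1 : n + 1 - 1 = n := by ring
      have e2 : n + 2 - 1 = n + 1 := by ring
      have e3 : n - 1 + 1 = n := by ring
      have e4 : n - 1 + 2 = n + 1 := by ring
      simp only [e1, e2, e3, e4]
      push_cast
      module
    · intro n hn
      rw [key]
      simp [Ring.lie_def, L_zero_vac, L_neg_one_vac, L_one_vac, mode_vac_nonneg, hn, add_nonneg]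

end VOA

namespace VOA

open FormalSeries

variable {V : Type*} [AddCommGroup V] [Module ℂ V] {A : VOA V}

/-! ### The grading -/

theorem mem_wtSpace_iff {n : ℕ} {v : V} : v ∈ A.wtSpace n ↔ A.L 0 v = (n : ℂ) • v :=
  Module.End.mem_eigenspace_iff

theorem proj_of_mem {n : ℕ} {v : V} (hv : v ∈ A.wtSpace n) : A.proj n v = ⟨v, hv⟩ := by
  have h : (LinearEquiv.ofBijective (DirectSum.coeLinearMap A.wtSpace)
      A.isInternal_wtSpace).symm v = DirectSum.lof ℂ ℕ (fun k => A.wtSpace k) n ⟨v, hv⟩ :=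
    (LinearEquiv.symm_apply_eq _).2 (DirectSum.coeLinearMap_lof A.wtSpace n ⟨v, hv⟩).symm
  rw [proj, LinearMap.comp_apply, LinearEquiv.coe_coe, h, DirectSum.component.lof_self]

theorem proj_of_mem_ne {m n : ℕ} (hmn : m ≠ n) {v : V} (hv : v ∈ A.wtSpace n) :
    A.proj m v = 0 := by
  have h : (LinearEquiv.ofBijective (DirectSum.coeLinearMap A.wtSpace)
      A.isInternal_wtSpace).symm v = DirectSum.lof ℂ ℕ (fun k => A.wtSpace k) n ⟨v, hv⟩ :=
    (LinearEquiv.symm_apply_eq _).2 (DirectSum.coeLinearMap_lof A.wtSpace n ⟨v, hv⟩).symm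
  rw [proj, LinearMap.comp_apply, LinearEquiv.coe_coe, h, DirectSum.component.of, dif_neg hmn.symm]

theorem eq_zero_of_proj {v : V} (h : ∀ n, A.proj n v = 0) : v = 0 := by
  have : (LinearEquiv.ofBijective (DirectSum.coeLinearMap A.wtSpace)
      A.isInternal_wtSpace).symm v = 0 := DirectSum.ext_component ℂ fun n => h n
  simpa using this

theorem proj_L_zero (n : ℕ) (v : V) : A.proj n (A.L 0 v) = (n : ℂ) • A.proj n v := by
  refine induction_wt (A := A) (p := fun v => A.proj n (A.L 0 v) = (n : ℂ) • A.proj n v) ?_ ?_ v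
  · intro m v hv
    rw [mem_wtSpace_iff.1 hv, map_smul]
    by_cases h : n = m
    · rw [h]
    · rw [proj_of_mem_ne h hv, smul_zero, smul_zero]
  · intro u v hu hv
    simp only [map_add, hu, hv, smul_add]

theorem eq_zero_of_weight {v : V} {w : ℂ} (hv : A.L 0 v = w • v) (hw : ∀ n : ℕ, w ≠ n) : v = 0 := by
  refine eq_zero_of_proj (A := A) fun n => ?_
  have h := proj_L_zero (A := A) n v
  rw [hv, map_smul, ← sub_eq_zero, ← sub_smul, smul_eq_zero] at h
  exact h.resolve_left (sub_ne_zero.2 (hw n))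

theorem eq_zero_of_weight_neg {v : V} {w : ℤ} (hv : A.L 0 v = (w : ℂ) • v) (hw : w < 0) : v = 0 :=
  eq_zero_of_weight hv fun n h => by
    have : w = (n : ℤ) := by exact_mod_cast h
    omega

theorem mem_wtSpace_of_weight {v : V} {w : ℤ} (hv : A.L 0 v = (w : ℂ) • v) {n : ℕ} (hn : w = n) :
    v ∈ A.wtSpace n := by
  rw [mem_wtSpace_iff, hv, hn, Int.cast_natCast]

theorem lie_L_zero_mode {N : ℕ} {u : V} (hu : u ∈ A.wtSpace N) (n : ℤ) :
    ⁅A.L 0, A.mode u n⁆ = ((N : ℂ) - n - 1) • A.mode u n := by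
  rw [lie_L_mode, mem_wtSpace_iff.1 hu, mode_smul, mode_L_neg_one, add_sub_cancel_right]
  push_cast
  module

theorem lie_L_one_mode_of_mem {N : ℕ} {u : V} (hu : u ∈ A.wtSpace N) (n : ℤ) :
    ⁅A.L 1, A.mode u n⁆ = A.mode (A.L 1 u) n + (2 * (N : ℂ) - n - 2) • A.mode u (n + 1) := by
  rw [lie_L_one_mode, mem_wtSpace_iff.1 hu, mode_smul, mode_L_neg_one,
    show n + 2 - 1 = n + 1 by ring]
  push_cast
  module

theorem mode_weight {N : ℕ} {u v : V} (hu : u ∈ A.wtSpace N) {w : ℤ}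
    (hv : A.L 0 v = (w : ℂ) • v) (n : ℤ) :
    A.L 0 (A.mode u n v) = ((w + N - n - 1 : ℤ) : ℂ) • A.mode u n v := by
  have h := congrArg (fun T : Module.End ℂ V => T v) (lie_L_zero_mode (A := A) hu n)
  simp only [Ring.lie_def, LinearMap.sub_apply, Module.End.mul_apply, LinearMap.smul_apply, hv,
    map_smul] at h
  rw [sub_eq_iff_eq_add] at h
  rw [h]
  push_cast
  module

theorem L_one_weight {v : V} {w : ℤ} (hv : A.L 0 v = (w : ℂ) • v) :
    A.L 0 (A.L 1 v) = ((w - 1 : ℤ) : ℂ) • A.L 1 v := by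
  have := mode_weight (A := A) conf_mem hv 2
  rw [mode_conf] at this
  norm_num at this ⊢
  exact this.trans (congrArg (· • _) (by ring))

theorem L_neg_one_weight {v : V} {w : ℤ} (hv : A.L 0 v = (w : ℂ) • v) :
    A.L 0 (A.L (-1) v) = ((w + 1 : ℤ) : ℂ) • A.L (-1) v := by
  have := mode_weight (A := A) conf_mem hv 0
  rw [mode_conf] at this
  norm_num at this ⊢
  exact this.trans (congrArg (· • _) (by ring))

theorem weight_of_mem {n : ℕ} {v : V} (hv : v ∈ A.wtSpace n) : A.L 0 v = ((n : ℤ) : ℂ) • v := by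
  simpa using mem_wtSpace_iff.1 hv

theorem L_one_mem {n : ℕ} {v : V} (hv : v ∈ A.wtSpace (n + 1)) : A.L 1 v ∈ A.wtSpace n :=
  mem_wtSpace_of_weight (L_one_weight (weight_of_mem hv)) (by push_cast; ring)

theorem L_one_eq_zero {v : V} (hv : v ∈ A.wtSpace 0) : A.L 1 v = 0 :=
  eq_zero_of_weight_neg (L_one_weight (weight_of_mem hv)) (by norm_num)

theorem L_neg_one_mem {n : ℕ} {v : V} (hv : v ∈ A.wtSpace n) : A.L (-1) v ∈ A.wtSpace (n + 1) :=
  mem_wtSpace_of_weight (L_neg_one_weight (weight_of_mem hv)) (by push_cast; ring)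

theorem L_one_pow_mem {n j : ℕ} {v : V} (hv : v ∈ A.wtSpace (n + j)) :
    (A.L 1 ^ j) v ∈ A.wtSpace n := by
  induction j generalizing n with
  | zero => simpa using hv
  | succ j ih =>
    rw [pow_succ', Module.End.mul_apply]
    exact L_one_mem (ih (by rwa [add_right_comm, add_assoc]))

theorem L_one_pow_eq_zero {n j : ℕ} (h : n < j) {v : V} (hv : v ∈ A.wtSpace n) :
    (A.L 1 ^ j) v = 0 := by
  obtain ⟨i, rfl⟩ : ∃ i, j = i + (n + 1) := ⟨j - (n + 1), by omega⟩
  rw [pow_add, Module.End.mul_apply, pow_succ', Module.End.mul_apply,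
    L_one_eq_zero (L_one_pow_mem (by simpa using hv)), map_zero]

/-! ### The restricted dual -/

theorem comp_mode_mem {N : ℕ} {u : V} (hu : u ∈ A.wtSpace N) (k : ℤ) {ℓ : Module.Dual ℂ V}
    (h : ℓ ∈ A.restrictedDual) : ℓ ∘ₗ A.mode u k ∈ A.restrictedDual := by
  obtain ⟨K, hK⟩ := h
  refine ⟨K + k.natAbs + 1, fun n hn v hv => ?_⟩
  have := mode_weight hu (weight_of_mem hv) k
  rw [LinearMap.comp_apply]
  exact hK ((n : ℤ) + N - k - 1).toNat (by omega) _ (mem_wtSpace_of_weight this (by omega))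

theorem comp_proj_mem (m : ℕ) (ℓ : Module.Dual ℂ (A.wtSpace m)) :
    ℓ ∘ₗ A.proj m ∈ A.restrictedDual :=
  ⟨m + 1, fun n hn v hv => by
    rw [LinearMap.comp_apply, proj_of_mem_ne (by omega) hv, map_zero]⟩

/-! ### Products of vertex operators -/

theorem prodModes_zero (v : Fin 0 → V) (k : Fin 0 → ℤ) : A.prodModes v k = 1 := by
  simp [prodModes]

theorem prodModes_succ {n : ℕ} (v : Fin (n + 1) → V) (k : Fin (n + 1) → ℤ) :
    A.prodModes v k = A.mode (v 0) (k 0) * A.prodModes (v ∘ Fin.succ) (k ∘ Fin.succ) := by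
  simp [prodModes, List.ofFn_succ]

/-- A vertex operator commutes with a product of vertex operators up to powers of differences. -/
theorem exists_act_commutator {n : ℕ} (u : V) (v : Fin n → V) : ∃ M : ℕ,
    act ((∏ j : Fin n, (MvPolynomial.X 0 - MvPolynomial.X j.succ)) ^ M)
      (fun k : Fin (n + 1) → ℤ =>
        ⁅A.mode u (k 0), A.prodModes v (k ∘ Fin.succ)⁆) = 0 := by
  induction n with
  | zero =>
    refine ⟨0, ?_⟩
    have : (fun k : Fin 1 → ℤ => ⁅A.mode u (k 0), A.prodModes v (k ∘ Fin.succ)⁆) = 0 := by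
      funext k
      simp [prodModes_zero, Ring.lie_def]
    rw [this, map_zero]
  | succ n ih =>
    obtain ⟨M₁, h₁⟩ := exists_act_lieSeries (A := A) u (v 0)
    obtain ⟨M₂, h₂⟩ := ih (v ∘ Fin.succ)
    refine ⟨max M₁ M₂, ?_⟩
    have e1 := act_pow_eq_zero (σ := Fin (n + 2)) 0 1 (by simp) h₁
      (fun k => LinearMap.mulRight ℂ (A.prodModes (v ∘ Fin.succ) (k ∘ Fin.succ ∘ Fin.succ)))
      (fun k => by
        congr 2; funext l; simp [Fin.succ_ne_zero])
      (fun k => by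
        congr 2; funext l
        have : (l.succ.succ : Fin (n + 2)) ≠ 1 := by
          rw [← Fin.succ_zero_eq_one]; exact fun h => Fin.succ_ne_zero _ (Fin.succ_injective _ h)
        simp [Pi.single_eq_of_ne this])
    -- The inductive commutator involves all variables except `x_1`, which belongs to `v 0`.
    have e2 := act_rename (Fin.succAbove (1 : Fin (n + 2))) Fin.succAbove_right_injective
      (fun k => LinearMap.mulLeft ℂ (A.mode (v 0) (k 1)))
      (fun k i => by
        rw [Pi.add_apply, Pi.single_eq_of_ne (Fin.succAbove_ne 1 i).symm, add_zero])
      ((∏ j : Fin n, (MvPolynomial.X 0 - MvPolynomial.X j.succ)) ^ M₂)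
      (fun k : Fin (n + 1) → ℤ =>
        ⁅A.mode u (k 0), A.prodModes (v ∘ Fin.succ) (k ∘ Fin.succ)⁆)
    have hs : ∀ j : Fin n, Fin.succAbove (1 : Fin (n + 2)) j.succ = j.succ.succ := fun j =>
      Fin.one_succAbove_succ j
    have h0 : Fin.succAbove (1 : Fin (n + 2)) 0 = 0 := by simp
    have hss : ∀ k : Fin (n + 2) → ℤ, (k ∘ Fin.succAbove 1) ∘ Fin.succ = k ∘ Fin.succ ∘ Fin.succ :=
      fun k => funext fun j => congrArg k (hs j)
    have hp : MvPolynomial.rename (Fin.succAbove (1 : Fin (n + 2)))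
        ((∏ j : Fin n, (MvPolynomial.X 0 - MvPolynomial.X j.succ)) ^ M₂) =
        (∏ j : Fin n, (MvPolynomial.X 0 - MvPolynomial.X j.succ.succ) : MvPolynomial _ ℂ) ^ M₂ := by
      simp only [map_pow, map_prod, map_sub, MvPolynomial.rename_X, hs, h0]
    rw [h₂, hp] at e2
    simp only [Function.comp_apply, hss, h0, Pi.zero_apply, map_zero] at e2
    rw [← Pi.zero_def] at e2
    have e3 : (fun k : Fin (n + 2) → ℤ => ⁅A.mode u (k 0), A.prodModes v (k ∘ Fin.succ)⁆) =
        (fun k => LinearMap.mulRight ℂ (A.prodModes (v ∘ Fin.succ) (k ∘ Fin.succ ∘ Fin.succ))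
          ⁅A.mode u (k 0), A.mode (v 0) (k 1)⁆) +
        fun k => LinearMap.mulLeft ℂ (A.mode (v 0) (k 1))
          ⁅A.mode u (k 0), A.prodModes (v ∘ Fin.succ) (k ∘ Fin.succ ∘ Fin.succ)⁆ := by
      funext k
      rw [prodModes_succ]
      simp only [Pi.add_apply, LinearMap.mulRight_apply, LinearMap.mulLeft_apply, Ring.lie_def,
        Function.comp_apply, Fin.succ_zero_eq_one, Function.comp_assoc]
      noncomm_ring
    rw [e3, map_add, Fin.prod_univ_succ, Fin.succ_zero_eq_one, mul_pow,
      act_eq_zero_of_dvd (Dvd.dvd.mul_right (pow_dvd_pow _ (le_max_left M₁ M₂)) _) e1,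
      act_eq_zero_of_dvd (Dvd.dvd.mul_left (pow_dvd_pow _ (le_max_right M₁ M₂)) _) e2, add_zero]

/-- Series with bounded pole order in `x_i`. -/
def boundedAt {σ : Type*} (U : Type*) [AddCommGroup U] [Module ℂ U] (i : σ) (B : ℤ) :
    Submodule ℂ ((σ → ℤ) → U) where
  carrier := {F | ∀ k, B ≤ k i → F k = 0}
  zero_mem' := fun _ _ => rfl
  add_mem' := fun hf hg k hk => by rw [Pi.add_apply, hf k hk, hg k hk, add_zero]
  smul_mem' := fun c f hf k hk => by rw [Pi.smul_apply, hf k hk, smul_zero]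

theorem act_mem_boundedAt {σ : Type*} [DecidableEq σ] {U : Type*} [AddCommGroup U] [Module ℂ U]
    {i : σ} {B : ℤ} (p : MvPolynomial σ ℂ) {F : (σ → ℤ) → U} (hF : F ∈ boundedAt U i B) :
    act p F ∈ boundedAt U i B := by
  refine act_mem _ (fun F hF j k hk => ?_) p hF
  rw [act_X]
  refine hF _ ?_
  rw [Pi.add_apply, Pi.single_apply]
  split_ifs <;> omega

theorem diagonals_succ (n : ℕ) : diagonals (n + 1) =
    (∏ j : Fin n, (MvPolynomial.X 0 - MvPolynomial.X j.succ)) *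
      MvPolynomial.rename Fin.succ (diagonals n) := by
  simp [diagonals, Fin.prod_univ_succ, Fin.prod_Ioi_succ, map_prod]

/-- Powers of the differences allow the first vertex operator to be moved to the right end, where it
acts on `c` and its pole order is bounded. The other variables are covered by induction. -/
theorem exists_act_prodModes {n : ℕ} (v : Fin n → V) (c : V) {B : ℤ}
    (hB : ∀ i, ∀ k, B ≤ k → A.mode (v i) k c = 0) : ∃ M : ℕ, ∀ i,
    act (diagonals n ^ M) (fun k => A.prodModes v k c) ∈ boundedAt V i B := by
  induction n with
  | zero => exact ⟨0, fun i => i.elim0⟩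
  | succ n ih =>
    obtain ⟨M₁, h₁⟩ := ih (v ∘ Fin.succ) (fun i => hB i.succ)
    obtain ⟨M₂, h₂⟩ := exists_act_commutator (A := A) (v 0) (v ∘ Fin.succ)
    refine ⟨max M₁ M₂, fun i => ?_⟩
    rw [diagonals_succ, mul_pow]
    refine Fin.cases ?_ (fun i => ?_) i
    · obtain ⟨q, hq⟩ := pow_dvd_pow (∏ j : Fin n, (MvPolynomial.X 0 - MvPolynomial.X j.succ) :
        MvPolynomial (Fin (n + 1)) ℂ) (le_max_right M₁ M₂)
      rw [mul_comm, hq, mul_comm _ q, ← mul_assoc, act_mul]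
      refine act_mem_boundedAt _ ?_
      have e : (fun k : Fin (n + 1) → ℤ => A.prodModes v k c) =
          (fun k => LinearMap.applyₗ (R := ℂ) c
            ⁅A.mode (v 0) (k 0), A.prodModes (v ∘ Fin.succ) (k ∘ Fin.succ)⁆) +
          fun k => A.prodModes (v ∘ Fin.succ) (k ∘ Fin.succ) (A.mode (v 0) (k 0) c) := by
        funext k
        rw [prodModes_succ]
        simp [Ring.lie_def]
      rw [e, map_add, act_comp, h₂]
      simp only [Pi.zero_apply, map_zero]
      refine Submodule.add_mem _ (Submodule.zero_mem _) (act_mem_boundedAt _ fun k hk => ?_)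
      rw [hB 0 _ hk, map_zero]
    · obtain ⟨q, hq⟩ := pow_dvd_pow (MvPolynomial.rename (Fin.succ : Fin n → Fin (n + 1))
        (diagonals n)) (le_max_left M₁ M₂)
      rw [hq, mul_comm _ q, ← mul_assoc, act_mul]
      refine act_mem_boundedAt _ ?_
      have e := act_rename (Fin.succ : Fin n → Fin (n + 1)) (Fin.succ_injective n)
        (fun k => A.mode (v 0) (k 0))
        (fun k i => by rw [Pi.add_apply, Pi.single_eq_of_ne (Fin.succ_ne_zero i).symm, add_zero])
        (diagonals n ^ M₁) (fun k => A.prodModes (v ∘ Fin.succ) k c)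
      have e' : (fun k : Fin (n + 1) → ℤ => A.prodModes v k c) =
          fun k => A.mode (v 0) (k 0) (A.prodModes (v ∘ Fin.succ) (k ∘ Fin.succ) c) := by
        funext k
        rw [prodModes_succ]
        rfl
      rw [e', ← map_pow, e]
      intro k hk
      exact (congrArg _ (h₁ i (k ∘ Fin.succ) hk)).trans (map_zero _)

/-- The operators to the right of position `j` act first and are held fixed; the `j`-th is truncated
on the vector they produce, whatever stands to its left. -/
theorem prodModes_eq_zero {n : ℕ} (v : Fin n → V) (c : V) (j : Fin n) (k : Fin n → ℤ) :
    ∃ T : ℤ, ∀ k' : Fin n → ℤ, (∀ l, j < l → k' l = k l) → T ≤ k' j → A.prodModes v k' c = 0 := by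
  induction n with
  | zero => exact j.elim0
  | succ n ih =>
    refine Fin.cases ?_ (fun j => ?_) j
    · obtain ⟨T, hT⟩ := exists_mode_eq_zero (A := A) (v 0)
        (A.prodModes (v ∘ Fin.succ) (k ∘ Fin.succ) c)
      refine ⟨T, fun k' hk' h => ?_⟩
      have : k' ∘ Fin.succ = k ∘ Fin.succ := funext fun l => hk' l.succ (Fin.succ_pos l)
      rw [prodModes_succ, Module.End.mul_apply, this]
      exact hT _ h
    · obtain ⟨T, hT⟩ := ih (v ∘ Fin.succ) j (k ∘ Fin.succ)
      refine ⟨T, fun k' hk' h => ?_⟩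
      rw [prodModes_succ, Module.End.mul_apply,
        hT (k' ∘ Fin.succ) (fun l hl => hk' l.succ (Fin.succ_lt_succ_iff.2 hl)) h, map_zero]

theorem prodModes_mem_truncated {n : ℕ} (v : Fin n → V) (c : V) (ℓ : Module.Dual ℂ V) :
    (fun k => ℓ (A.prodModes v k c)) ∈ truncated n := by
  intro i j hij k
  -- Since `i < j`, moving along `e_j - e_i` leaves the indices beyond `j` unchanged.
  obtain ⟨T, hT⟩ := prodModes_eq_zero (A := A) v c j k
  refine ⟨(T - k j).toNat, fun t ht => ?_⟩
  beta_reduce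
  rw [hT, map_zero]
  · intro l hl
    simp [Pi.single_eq_of_ne hl.ne', Pi.single_eq_of_ne (hij.trans hl).ne']
  · simp [Pi.single_eq_of_ne hij.ne']
    omega

theorem prodModes_weight {n : ℕ} {wt : Fin n → ℕ} {v : Fin n → V}
    (hv : ∀ i, v i ∈ A.wtSpace (wt i)) {c : V} {w : ℤ} (hc : A.L 0 c = (w : ℂ) • c)
    (k : Fin n → ℤ) : A.L 0 (A.prodModes v k c) =
      ((w + ∑ i, ((wt i : ℤ) - k i - 1) : ℤ) : ℂ) • A.prodModes v k c := by
  induction n with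
  | zero => simpa [prodModes_zero] using hc
  | succ n ih =>
    rw [prodModes_succ, Module.End.mul_apply,
      mode_weight (hv 0) (ih (wt := wt ∘ Fin.succ) (v := v ∘ Fin.succ) (fun i => hv i.succ) (k ∘ Fin.succ)) (k 0),
      Fin.sum_univ_succ]
    congr 2
    simp only [Function.comp_apply]
    ring

/-- Series whose total degree is bounded below. -/
def boundedDegree (n : ℕ) : Submodule ℂ ((Fin n → ℤ) → ℂ) where
  carrier := {f | ∃ K : ℤ, ∀ k, ∑ i, k i < K → f k = 0}
  zero_mem' := ⟨0, fun _ _ => rfl⟩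
  add_mem' := by
    rintro f g ⟨K, hK⟩ ⟨K', hK'⟩
    refine ⟨min K K', fun k hk => ?_⟩
    rw [Pi.add_apply, hK k (by omega), hK' k (by omega), add_zero]
  smul_mem' := by
    rintro c f ⟨K, hK⟩
    exact ⟨K, fun k hk => by rw [Pi.smul_apply, hK k hk, smul_zero]⟩

theorem act_mem_boundedDegree {n : ℕ} (p : MvPolynomial (Fin n) ℂ) {f : (Fin n → ℤ) → ℂ}
    (hf : f ∈ boundedDegree n) : act p f ∈ boundedDegree n := by
  refine act_mem _ (fun f hf j => ?_) p hf
  obtain ⟨K, hK⟩ := hf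
  refine ⟨K - 1, fun k hk => ?_⟩
  rw [act_X]
  refine hK _ ?_
  simp only [Pi.add_apply, Finset.sum_add_distrib, Finset.sum_pi_single', Finset.mem_univ, if_true]
  omega

/-- The weight of `v_1(k_1)⋯v_n(k_n)c` grows as `∑ k_i` decreases, and `ℓ` vanishes in large
weights. -/
theorem prodModes_mem_boundedDegree {n : ℕ} {wt : Fin n → ℕ} {v : Fin n → V}
    (hv : ∀ i, v i ∈ A.wtSpace (wt i)) {ℓ : Module.Dual ℂ V} (hℓ : ℓ ∈ A.restrictedDual) (c : V) :
    (fun k => ℓ (A.prodModes v k c)) ∈ boundedDegree n := by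
  refine induction_wt (A := A) (p := fun c => (fun k => ℓ (A.prodModes v k c)) ∈ boundedDegree n)
    ?_ ?_ c
  · intro m c hc
    obtain ⟨K, hK⟩ := hℓ
    refine ⟨(m : ℤ) + ∑ i, ((wt i : ℤ) - 1) - K, fun k hk => ?_⟩
    have h := prodModes_weight hv (weight_of_mem hc) k
    have e : ∑ i, ((wt i : ℤ) - k i - 1) = ∑ i, ((wt i : ℤ) - 1) - ∑ i, k i := by
      rw [← Finset.sum_sub_distrib]
      exact Finset.sum_congr rfl fun i _ => by ring
    refine hK ((m : ℤ) + ∑ i, ((wt i : ℤ) - k i - 1)).toNat (by omega) _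
      (mem_wtSpace_of_weight h (by omega))
  · intro c c' h h'
    have := Submodule.add_mem _ h h'
    convert this using 1
    funext k
    simp

/-- Every index is bounded above and their sum below, hence each index is bounded below too. -/
theorem finite_support {n : ℕ} {f : (Fin n → ℤ) → ℂ} {B : ℤ} (h : ∀ i, f ∈ boundedAt ℂ i B)
    (h' : f ∈ boundedDegree n) : f.support.Finite := by
  obtain ⟨K, hK⟩ := h'
  refine (Fintype.piFinset fun _ : Fin n =>
    Finset.Icc (K - n * |B|) |B|).finite_toSet.subset fun k hk => ?_
  rw [Finset.mem_coe, Fintype.mem_piFinset]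
  have hlt : ∀ i, k i ≤ |B| := fun i => by
    by_contra hc
    exact hk (h i k (by linarith [le_abs_self B, not_le.1 hc]))
  intro i
  rw [Finset.mem_Icc]
  refine ⟨?_, hlt i⟩
  have h1 : K ≤ ∑ l, k l := by
    by_contra hc
    exact hk (hK k (not_le.1 hc))
  rw [← Finset.add_sum_erase _ _ (Finset.mem_univ i)] at h1
  have h2 : ∑ l ∈ Finset.univ.erase i, k l ≤ ∑ _l ∈ Finset.univ.erase i, |B| :=
    Finset.sum_le_sum fun l _ => hlt l
  have h3 : ∑ _l ∈ Finset.univ.erase i, |B| ≤ n * |B| := by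
    rw [Finset.sum_const, nsmul_eq_mul]
    refine mul_le_mul_of_nonneg_right ?_ (abs_nonneg B)
    have := Finset.card_erase_le (s := (Finset.univ : Finset (Fin n))) (a := i)
    rw [Finset.card_univ, Fintype.card_fin] at this
    exact_mod_cast this
  linarith

theorem act_axes_pow {n : ℕ} (B : ℕ) (f : (Fin n → ℤ) → ℂ) (k : Fin n → ℤ) :
    act (axes n ^ B) f k = f (fun i => k i + B) := by
  have : (axes n ^ B : MvPolynomial (Fin n) ℂ) =
      MvPolynomial.monomial (Finsupp.equivFunOnFinite.symm fun _ => B) 1 := by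
    rw [MvPolynomial.monomial_eq, Finsupp.prod_fintype _ _ (by simp)]
    simp [axes, Finset.prod_pow]
  rw [this, act_monomial]
  simp

/-- Matrix elements of products of vertex operators extend to rational functions. -/
theorem prodModes_mem_rational {n : ℕ} {wt : Fin n → ℕ} {v : Fin n → V}
    (hv : ∀ i, v i ∈ A.wtSpace (wt i)) {ℓ : Module.Dual ℂ V} (hℓ : ℓ ∈ A.restrictedDual) (c : V) :
    (fun k => ℓ (A.prodModes v k c)) ∈ rational (axes n * diagonals n) := by
  refine ⟨prodModes_mem_truncated v c ℓ, ?_⟩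
  have hB : ∃ B : ℕ, ∀ i, ∀ k, (B : ℤ) ≤ k → A.mode (v i) k c = 0 := by
    choose B hB using fun i => exists_mode_eq_zero (A := A) (v i) c
    refine ⟨∑ i, (B i).toNat, fun i k hk => hB i k ?_⟩
    have : (B i).toNat ≤ ∑ i, (B i).toNat :=
      Finset.single_le_sum (f := fun i => (B i).toNat) (fun _ _ => Nat.zero_le _)
        (Finset.mem_univ i)
    omega
  obtain ⟨B, hB⟩ := hB
  obtain ⟨M, hM⟩ := exists_act_prodModes v c hB
  set g : (Fin n → ℤ) → ℂ := act (diagonals n ^ M) (fun k => ℓ (A.prodModes v k c)) with hg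
  have h1 : ∀ i, g ∈ boundedAt ℂ i B := fun i k hk => by
    rw [hg, act_comp]
    exact (congrArg ℓ (hM i k hk)).trans (map_zero _)
  -- The factor `(∏ x_i)^B` clears the poles at `x_i = 0`, so that all exponents become nonnegative.
  have h2 : ∀ i, act (axes n ^ B) g ∈ boundedAt ℂ i 0 := fun i k hk => by
    rw [act_axes_pow]
    exact h1 i _ (by omega)
  obtain ⟨P, hP⟩ := exists_act_one (finite_support h2 (act_mem_boundedDegree _
    (act_mem_boundedDegree _ (prodModes_mem_boundedDegree hv hℓ c)))) (fun k i hk => h2 i k hk)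
  refine ⟨B + M, axes n ^ M * diagonals n ^ B * P, ?_⟩
  rw [act_mul, ← hP, hg, ← act_mul, ← act_mul]
  congr 2
  ring

/-- Genus zero correlation functions extend to rational functions. -/
theorem prodModes_vac_mem_rational {n : ℕ} {wt : Fin n → ℕ} {v : Fin n → V}
    (hv : ∀ i, v i ∈ A.wtSpace (wt i)) {ℓ : Module.Dual ℂ V} (hℓ : ℓ ∈ A.restrictedDual) :
    (fun k => ℓ (A.prodModes v k A.vac)) ∈ rational (diagonals n) := by
  refine ⟨prodModes_mem_truncated v _ ℓ, ?_⟩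
  -- On the vacuum there are no poles at `x_i = 0`, so the axes are not needed in the denominator.
  obtain ⟨M, hM⟩ := exists_act_prodModes (A := A) v A.vac (B := 0)
    (fun i k hk => mode_vac_nonneg _ hk)
  have h1 : ∀ i, act (diagonals n ^ M) (fun k => ℓ (A.prodModes v k A.vac)) ∈ boundedAt ℂ i 0 :=
    fun i k hk => by
      rw [act_comp]
      exact (congrArg ℓ (hM i k hk)).trans (map_zero _)
  obtain ⟨P, hP⟩ := exists_act_one (finite_support h1 (act_mem_boundedDegree _
    (prodModes_mem_boundedDegree hv hℓ _))) (fun k i hk => h1 i k hk)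
  exact ⟨M, P, hP⟩

/-! ### Traces -/

variable (A) in
/-- The trace over `V_m` of the weight zero part of an operator. -/
def tr (m : ℕ) : Module.End ℂ V →ₗ[ℂ] ℂ :=
  LinearMap.trace ℂ (A.wtSpace m) ∘ₗ (LinearMap.llcomp ℂ (A.wtSpace m) V (A.wtSpace m) (A.proj m)) ∘ₗ
    LinearMap.lcomp ℂ V (A.wtSpace m).subtype

theorem tr_apply (m : ℕ) (T : Module.End ℂ V) :
    A.tr m T = LinearMap.trace ℂ (A.wtSpace m) (A.proj m ∘ₗ T ∘ₗ (A.wtSpace m).subtype) := rfl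

/-- `R` carries `V_m` to `V_{m'}` and commutes with the projections, so this is cyclicity of the
trace for maps between two finite-dimensional spaces. -/
theorem tr_mul_comm {m m' : ℕ} (T R : Module.End ℂ V) (R' : A.wtSpace m →ₗ[ℂ] A.wtSpace m')
    (h : ∀ v, A.proj m' (R v) = R' (A.proj m v)) (h' : ∀ v : A.wtSpace m, R v = R' v) :
    A.tr m (T * R) = A.tr m' (R * T) := by
  have e1 : A.proj m ∘ₗ (T * R) ∘ₗ (A.wtSpace m).subtype =
      (A.proj m ∘ₗ T ∘ₗ (A.wtSpace m').subtype) ∘ₗ R' := by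
    ext v
    simp [h']
  have e2 : A.proj m' ∘ₗ (R * T) ∘ₗ (A.wtSpace m').subtype =
      R' ∘ₗ (A.proj m ∘ₗ T ∘ₗ (A.wtSpace m').subtype) := by
    ext v
    simp [h]
  rw [tr_apply, tr_apply, e1, e2, LinearMap.trace_comp_comm']

theorem proj_L_one (m : ℕ) (v : V) : (A.proj m (A.L 1 v) : V) = A.L 1 (A.proj (m + 1) v) := by
  refine induction_wt (A := A)
    (p := fun v => (A.proj m (A.L 1 v) : V) = A.L 1 (A.proj (m + 1) v)) ?_ ?_ v
  · intro n v hv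
    rcases n with _ | n
    · rw [L_one_eq_zero hv, proj_of_mem_ne (by omega) hv]
      simp
    · by_cases h : m = n
      · subst h
        rw [proj_of_mem (L_one_mem hv), proj_of_mem hv]
      · rw [proj_of_mem_ne h (L_one_mem hv), proj_of_mem_ne (by omega) hv]
        simp
  · intro u v hu hv
    simp [hu, hv]

theorem proj_L_neg_one (m : ℕ) (v : V) :
    (A.proj (m + 1) (A.L (-1) v) : V) = A.L (-1) (A.proj m v) := by
  refine induction_wt (A := A)
    (p := fun v => (A.proj (m + 1) (A.L (-1) v) : V) = A.L (-1) (A.proj m v)) ?_ ?_ v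
  · intro n v hv
    by_cases h : m = n
    · subst h
      rw [proj_of_mem (L_neg_one_mem hv), proj_of_mem hv]
    · rw [proj_of_mem_ne (by omega) (L_neg_one_mem hv), proj_of_mem_ne h hv]
      simp
  · intro u v hu hv
    simp [hu, hv]

theorem proj_zero_L_neg_one (v : V) : A.proj 0 (A.L (-1) v) = 0 := by
  refine induction_wt (A := A) (p := fun v => A.proj 0 (A.L (-1) v) = 0) ?_ ?_ v
  · intro n v hv
    rw [proj_of_mem_ne (by omega) (L_neg_one_mem hv)]
  · intro u v hu hv
    simp [hu, hv]

theorem tr_mul_L_one (m : ℕ) (T : Module.End ℂ V) :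
    A.tr (m + 1) (T * A.L 1) = A.tr m (A.L 1 * T) :=
  tr_mul_comm T (A.L 1) ((A.L 1).restrict fun _ hv => L_one_mem hv)
    (fun v => Subtype.ext (proj_L_one m v)) (fun _ => rfl)

theorem tr_zero_mul_L_one (T : Module.End ℂ V) : A.tr 0 (T * A.L 1) = 0 := by
  have : A.proj 0 ∘ₗ (T * A.L 1) ∘ₗ (A.wtSpace 0).subtype = 0 := by
    ext v
    simp [L_one_eq_zero v.2]
  rw [tr_apply, this, map_zero]

theorem tr_mul_L_neg_one (m : ℕ) (T : Module.End ℂ V) :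
    A.tr m (T * A.L (-1)) = A.tr (m + 1) (A.L (-1) * T) :=
  tr_mul_comm T (A.L (-1)) ((A.L (-1)).restrict fun _ hv => L_neg_one_mem hv)
    (fun v => Subtype.ext (proj_L_neg_one m v)) (fun _ => rfl)

theorem tr_zero_L_neg_one_mul (T : Module.End ℂ V) : A.tr 0 (A.L (-1) * T) = 0 := by
  have : A.proj 0 ∘ₗ (A.L (-1) * T) ∘ₗ (A.wtSpace 0).subtype = 0 := by
    ext v
    simp [proj_zero_L_neg_one]
  rw [tr_apply, this, map_zero]

theorem tr_eq_sum {ι : Type*} [Fintype ι] [DecidableEq ι] {m : ℕ}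
    (b : Module.Basis ι ℂ (A.wtSpace m)) (T : Module.End ℂ V) :
    A.tr m T = ∑ i, b.coord i (A.proj m (T (b i))) := by
  rw [tr_apply, LinearMap.trace_eq_matrix_trace ℂ b, Matrix.trace]
  refine Finset.sum_congr rfl fun i _ => ?_
  rw [Matrix.diag_apply, LinearMap.toMatrix_apply]
  rfl

/-- Traces of products of vertex operators extend to rational functions. -/
theorem tr_prodModes_mem_rational {n : ℕ} {wt : Fin n → ℕ} {v : Fin n → V}
    (hv : ∀ i, v i ∈ A.wtSpace (wt i)) (m : ℕ) :
    (fun k => A.tr m (A.prodModes v k)) ∈ rational (axes n * diagonals n) := by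
  have : (fun k => A.tr m (A.prodModes v k)) = ∑ i,
      fun k => ((Module.finBasis ℂ (A.wtSpace m)).coord i ∘ₗ A.proj m)
        (A.prodModes v k (Module.finBasis ℂ (A.wtSpace m) i)) := by
    funext k
    rw [tr_eq_sum (Module.finBasis ℂ (A.wtSpace m)), Finset.sum_apply]
    rfl
  rw [this]
  exact Submodule.sum_mem _ fun i _ => prodModes_mem_rational hv (comp_proj_mem m _) _

end VOA

namespace FormalSeries

variable {N : ℕ}

/-! ### Infinitesimal special conformal transformations -/

/-- The differential operator `∑ (x_i² ∂_i + 2 wt_i x_i)`. -/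
def special (wt : Fin N → ℕ) : Module.End ℂ ((Fin N → ℤ) → ℂ) where
  toFun f k := ∑ i, (2 * (wt i : ℂ) - k i - 2) * f (k + Pi.single i 1)
  map_add' f g := by
    funext k
    simp [mul_add, Finset.sum_add_distrib]
  map_smul' c f := by
    funext k
    simp [Finset.mul_sum, mul_left_comm]

theorem special_apply (wt : Fin N → ℕ) (f : (Fin N → ℤ) → ℂ) (k : Fin N → ℤ) :
    special wt f k = ∑ i, (2 * (wt i : ℂ) - k i - 2) * f (k + Pi.single i 1) := rfl

theorem special_act_X (wt : Fin N → ℕ) (i : Fin N) (f : (Fin N → ℤ) → ℂ) :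
    special wt (act (MvPolynomial.X i) f) = act (MvPolynomial.X i) (special wt f) +
      act (MvPolynomial.X i) (act (MvPolynomial.X i) f) := by
  funext k
  have e : f (k + Pi.single i 1 + Pi.single i 1) =
      ∑ j, if j = i then f (k + Pi.single i 1 + Pi.single j 1) else 0 := by simp
  rw [Pi.add_apply, act_X, act_X, act_X, special_apply, special_apply, e,
    ← Finset.sum_add_distrib]
  refine Finset.sum_congr rfl fun j _ => ?_
  rw [act_X, add_right_comm k]
  by_cases h : j = i
  · subst h
    rw [if_pos rfl, Pi.add_apply, Pi.single_eq_same]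
    push_cast
    ring
  · rw [if_neg h, Pi.add_apply, Pi.single_eq_of_ne h, add_zero, add_zero]

/-- Iterates the commutator `[special, x_i] = x_i²`. Divided by `(j+1)!` this is the recursion `F =
s x_i F + x_i G` between the Taylor series `F` of `x_i f` and `G` of `f`, whence `F = x_i/(1 - s
x_i) · G`. -/
theorem special_pow_act_X (wt : Fin N → ℕ) (i : Fin N) (f : (Fin N → ℤ) → ℂ) (j : ℕ) :
    (special wt ^ (j + 1)) (act (MvPolynomial.X i) f) =
      ((j : ℂ) + 1) • act (MvPolynomial.X i) ((special wt ^ j) (act (MvPolynomial.X i) f)) +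
      act (MvPolynomial.X i) ((special wt ^ (j + 1)) f) := by
  induction j with
  | zero =>
    simp only [zero_add, pow_one, pow_zero, Module.End.one_apply, Nat.cast_zero, one_smul]
    rw [special_act_X, add_comm]
  | succ j ih =>
    have hs : ∀ m g, special wt ((special wt ^ m) g) = (special wt ^ (m + 1)) g := fun m g => by
      rw [pow_succ', Module.End.mul_apply]
    have e := congrArg (act (MvPolynomial.X i)) ih
    rw [map_add, map_smul] at e
    rw [← hs (j + 1)]
    conv_lhs => rw [ih]
    rw [map_add, map_smul, special_act_X, special_act_X, hs, hs, Nat.cast_succ]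
    linear_combination (norm := module) (-1 : ℂ) • e

theorem special_one (wt : Fin N → ℕ) :
    special wt one = act (∑ i, MvPolynomial.C (2 * (wt i : ℂ)) * MvPolynomial.X i) one := by
  funext k
  rw [special_apply, map_sum, LinearMap.sum_apply, Finset.sum_apply]
  refine Finset.sum_congr rfl fun i _ => ?_
  rw [act_mul, act_C, Pi.smul_apply, act_X, smul_eq_mul]
  by_cases h : k + Pi.single i 1 = fun _ => -1
  · have : k i = -2 := by
      have := congrFun h i
      rw [Pi.add_apply, Pi.single_eq_same] at this
      omega
    rw [this]
    push_cast
    ring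
  · simp [one, h]

theorem special_mem_truncated (wt : Fin N → ℕ) {f : (Fin N → ℤ) → ℂ} (hf : f ∈ truncated N) :
    special wt f ∈ truncated N := by
  intro i j hij k
  choose T hT using fun l => hf i j hij (k + Pi.single l 1)
  refine ⟨∑ l, T l, fun t ht => ?_⟩
  rw [special_apply]
  refine Finset.sum_eq_zero fun l _ => ?_
  rw [add_right_comm, hT l t, mul_zero]
  exact le_trans (Finset.single_le_sum (fun _ _ => Nat.zero_le _) (Finset.mem_univ l)) ht

theorem exists_special_act (wt : Fin N → ℕ) (p : MvPolynomial (Fin N) ℂ) :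
    ∃ p', ∀ f, special wt (act p f) = act p (special wt f) + act p' f := by
  induction p using MvPolynomial.induction_on with
  | C a => exact ⟨0, fun f => by simp⟩
  | add p q hp hq =>
    obtain ⟨p', hp'⟩ := hp
    obtain ⟨q', hq'⟩ := hq
    refine ⟨p' + q', fun f => ?_⟩
    rw [act_add, map_add, hp', hq', act_add, act_add]
    abel
  | mul_X p i hp =>
    obtain ⟨p', hp'⟩ := hp
    refine ⟨p * (MvPolynomial.X i * MvPolynomial.X i) + p' * MvPolynomial.X i, fun f => ?_⟩
    rw [act_mul, hp', special_act_X, map_add, act_add, act_mul, act_mul, act_mul, act_mul, add_assoc]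

theorem special_mem_rational (wt : Fin N → ℕ) {D : MvPolynomial (Fin N) ℂ} {f : (Fin N → ℤ) → ℂ}
    (hf : f ∈ rational D) : special wt f ∈ rational D := by
  obtain ⟨hf, M, P, h⟩ := hf
  obtain ⟨d, hd⟩ := exists_special_act wt (D ^ M)
  obtain ⟨P', hP'⟩ := exists_special_act wt P
  refine ⟨special_mem_truncated wt hf, M + M, D ^ M *
    (P * (∑ i, MvPolynomial.C (2 * (wt i : ℂ)) * MvPolynomial.X i) + P') - d * P, ?_⟩
  have h1 : act (D ^ M) (special wt f) = special wt (act P one) - act d f := by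
    rw [← h, hd, add_sub_cancel_right]
  rw [pow_add, act_mul, h1, map_sub, act_comm _ d, h, hP', special_one, act_sub, act_mul, act_mul,
    act_add, act_mul]

theorem special_pow_mem_rational (wt : Fin N → ℕ) {D : MvPolynomial (Fin N) ℂ}
    {f : (Fin N → ℤ) → ℂ} (hf : f ∈ rational D) (j : ℕ) : (special wt ^ j) f ∈ rational D := by
  induction j with
  | zero => simpa using hf
  | succ j ih =>
    rw [pow_succ', Module.End.mul_apply]
    exact special_mem_rational wt ih

section Taylor

variable {D : MvPolynomial (Fin N) ℂ} {y : Fin N → ℂ}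

/-- The Taylor series, in the parameter of a special conformal transformation, of a rational
function at `y`. -/
def taylor (wt : Fin N → ℕ) (D : MvPolynomial (Fin N) ℂ) (y : Fin N → ℂ) (f : (Fin N → ℤ) → ℂ) :
    ℂ⟦X⟧ := PowerSeries.mk fun j => (j.factorial : ℂ)⁻¹ * VOA.ratValue ((special wt ^ j) f) D y

/-- `y / (1 - s y)` as a power series in `s`. -/
def specialPoint (y : ℂ) : ℂ⟦X⟧ :=
  PowerSeries.C y * (1 - PowerSeries.C y * PowerSeries.X)⁻¹

theorem one_sub_mul_specialPoint (y : ℂ) :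
    (1 - PowerSeries.C y * PowerSeries.X) * specialPoint y = PowerSeries.C y := by
  rw [specialPoint, mul_left_comm, PowerSeries.mul_inv_cancel _ (by simp), mul_one]

theorem constantCoeff_aeval (a : Fin N → ℂ⟦X⟧) (p : MvPolynomial (Fin N) ℂ) :
    PowerSeries.constantCoeff (MvPolynomial.aeval a p) =
      MvPolynomial.aeval (fun i => PowerSeries.constantCoeff (a i)) p := by
  induction p using MvPolynomial.induction_on with
  | C c =>
    rw [MvPolynomial.aeval_C, MvPolynomial.aeval_C]
    rfl
  | add p q hp hq => simp [hp, hq]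
  | mul_X p i hp => simp [hp]

theorem isUnit_aeval_of_constantCoeff {a : Fin N → ℂ⟦X⟧} {p : MvPolynomial (Fin N) ℂ}
    (h : IsUnit (MvPolynomial.aeval (fun i => PowerSeries.constantCoeff (a i)) p)) :
    IsUnit (MvPolynomial.aeval a p) := by
  rw [PowerSeries.isUnit_iff_constantCoeff, constantCoeff_aeval]
  exact h

theorem isUnit_aeval_specialPoint (hy : IsUnit (MvPolynomial.aeval y D)) :
    IsUnit (MvPolynomial.aeval (fun i => specialPoint (y i)) D) := by
  refine isUnit_aeval_of_constantCoeff ?_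
  simpa [specialPoint] using hy

theorem taylor_add (hD : D ∈ divisors N) (hy : IsUnit (MvPolynomial.aeval y D)) (wt : Fin N → ℕ)
    {f g : (Fin N → ℤ) → ℂ} (hf : f ∈ rational D) (hg : g ∈ rational D) :
    taylor wt D y (f + g) = taylor wt D y f + taylor wt D y g := by
  ext j
  simp only [taylor, PowerSeries.coeff_mk, map_add]
  rw [ratValue_add hD hy (special_pow_mem_rational wt hf j) (special_pow_mem_rational wt hg j),
    mul_add]

theorem taylor_smul (hD : D ∈ divisors N) (hy : IsUnit (MvPolynomial.aeval y D)) (wt : Fin N → ℕ)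
    (c : ℂ) {f : (Fin N → ℤ) → ℂ} (hf : f ∈ rational D) :
    taylor wt D y (c • f) = c • taylor wt D y f := by
  ext j
  simp only [taylor, PowerSeries.coeff_mk, map_smul]
  rw [ratValue_smul hD hy c (special_pow_mem_rational wt hf j), smul_eq_mul, smul_eq_mul,
    mul_left_comm]

theorem taylor_act_X (hD : D ∈ divisors N) (hy : IsUnit (MvPolynomial.aeval y D)) (wt : Fin N → ℕ)
    {f : (Fin N → ℤ) → ℂ} (hf : f ∈ rational D) (i : Fin N) :
    taylor wt D y (act (MvPolynomial.X i) f) = specialPoint (y i) * taylor wt D y f := by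
  have h : (1 - PowerSeries.C (y i) * PowerSeries.X) * taylor wt D y (act (MvPolynomial.X i) f) =
      PowerSeries.C (y i) * taylor wt D y f := by
    ext j
    rw [sub_mul, one_mul, map_sub, mul_assoc, PowerSeries.coeff_C_mul, PowerSeries.coeff_C_mul]
    have hX := act_mem_rational (MvPolynomial.X i) hf
    rcases j with _ | j
    · simp only [taylor, PowerSeries.coeff_mk, PowerSeries.coeff_zero_X_mul, pow_zero,
        Module.End.one_apply]
      rw [ratValue_act hD hy _ hf, MvPolynomial.aeval_X]
      ring
    · rw [PowerSeries.coeff_succ_X_mul]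
      simp only [taylor, PowerSeries.coeff_mk]
      rw [special_pow_act_X, ratValue_add hD hy (Submodule.smul_mem _ _
          (act_mem_rational _ (special_pow_mem_rational wt hX j)))
          (act_mem_rational _ (special_pow_mem_rational wt hf (j + 1))),
        ratValue_smul hD hy _ (act_mem_rational _ (special_pow_mem_rational wt hX j)),
        ratValue_act hD hy _ (special_pow_mem_rational wt hX j),
        ratValue_act hD hy _ (special_pow_mem_rational wt hf (j + 1)), MvPolynomial.aeval_X,
        Nat.factorial_succ]
      have h1 : ((j : ℂ) + 1) ≠ 0 := by exact_mod_cast Nat.succ_ne_zero j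
      have h2 : (j.factorial : ℂ) ≠ 0 := by exact_mod_cast j.factorial_ne_zero
      push_cast
      rw [smul_eq_mul]
      field_simp
      ring
  have hu : IsUnit (1 - PowerSeries.C (y i) * PowerSeries.X : ℂ⟦X⟧) := by
    rw [PowerSeries.isUnit_iff_constantCoeff]
    simp
  refine hu.mul_left_cancel ?_
  rw [h, ← mul_assoc, one_sub_mul_specialPoint]

theorem derivative_taylor (wt : Fin N → ℕ) (f : (Fin N → ℤ) → ℂ) :
    PowerSeries.derivative ℂ (taylor wt D y f) = taylor wt D y (special wt f) := by
  ext j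
  rw [PowerSeries.coeff_derivative]
  simp only [taylor, PowerSeries.coeff_mk]
  rw [pow_succ, Module.End.mul_apply, Nat.factorial_succ]
  have h1 : ((j : ℂ) + 1) ≠ 0 := by exact_mod_cast Nat.succ_ne_zero j
  push_cast
  field_simp

theorem derivative_prod (wt : Fin N → ℕ) (y : Fin N → ℂ) (s : Finset (Fin N)) :
    PowerSeries.derivative ℂ (∏ i ∈ s, (1 - PowerSeries.C (y i) * PowerSeries.X) ^ (2 * wt i)) =
      -(∑ i ∈ s, PowerSeries.C (2 * (wt i : ℂ)) * specialPoint (y i)) *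
        ∏ i ∈ s, (1 - PowerSeries.C (y i) * PowerSeries.X) ^ (2 * wt i) := by
  induction s using Finset.cons_induction with
  | empty => simp
  | cons i s hi ih =>
    have hd : PowerSeries.derivative ℂ (1 - PowerSeries.C (y i) * PowerSeries.X) =
        -PowerSeries.C (y i) := by
      rw [map_sub, Derivation.leibniz, PowerSeries.derivative_C, PowerSeries.derivative_X,
        Derivation.map_one_eq_zero]
      simp
    rw [Finset.prod_cons, Derivation.leibniz, ih, Finset.sum_cons, Derivation.leibniz_pow, hd]
    have hc := one_sub_mul_specialPoint (y i)
    generalize (1 - PowerSeries.C (y i) * PowerSeries.X : ℂ⟦X⟧) = u at hc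
    generalize ∏ i ∈ s, (1 - PowerSeries.C (y i) * PowerSeries.X : ℂ⟦X⟧) ^ (2 * wt i) = P
    rcases wt i with _ | w
    · simp [smul_eq_mul, mul_comm]
    · have : 2 * (w + 1) - 1 = 2 * w + 1 := by omega
      rw [this]
      simp only [smul_eq_mul, nsmul_eq_mul, map_mul, Nat.cast_mul, Nat.cast_add, map_add,
        map_natCast, map_one, map_ofNat, Nat.cast_one, Nat.cast_ofNat]
      linear_combination (P * (2 * ((w : ℂ⟦X⟧) + 1)) * u ^ (2 * w + 1)) * hc

/-- The Taylor series of `1` is the automorphy factor `∏ (1 - s y_i)^{-2wt_i}`. As `special 1 = ∑ 2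
wt_i x_i`, the product has derivative zero in `s`, and its constant term is `1`. -/
theorem taylor_one_mul (hD : D ∈ divisors N) (hy : IsUnit (MvPolynomial.aeval y D))
    (wt : Fin N → ℕ) : taylor wt D y one *
      ∏ i, (1 - PowerSeries.C (y i) * PowerSeries.X) ^ (2 * wt i) = 1 := by
  refine PowerSeries.derivative.ext ?_ ?_
  · rw [Derivation.leibniz, derivative_prod, derivative_taylor, special_one]
    have : taylor wt D y (act (∑ i, MvPolynomial.C (2 * (wt i : ℂ)) * MvPolynomial.X i) one) =
        (∑ i, PowerSeries.C (2 * (wt i : ℂ)) * specialPoint (y i)) * taylor wt D y one := by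
      rw [map_sum, LinearMap.sum_apply, Finset.sum_mul]
      have hs : ∀ s : Finset (Fin N), taylor wt D y (∑ i ∈ s,
          act (MvPolynomial.C (2 * (wt i : ℂ)) * MvPolynomial.X i) one) =
          ∑ i ∈ s, PowerSeries.C (2 * (wt i : ℂ)) * specialPoint (y i) * taylor wt D y one := by
        intro s
        induction s using Finset.cons_induction with
        | empty =>
          rw [Finset.sum_empty, Finset.sum_empty]
          have := taylor_smul hD hy wt 0 (one_mem_rational (D := D))
          simpa using this
        | cons i s hi ih =>
          rw [Finset.sum_cons, Finset.sum_cons, taylor_add hD hy wt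
            (act_mem_rational _ one_mem_rational)
            (Submodule.sum_mem _ fun i _ => act_mem_rational _ one_mem_rational), ih, act_mul,
            act_C, taylor_smul hD hy wt _ (act_mem_rational _ one_mem_rational),
            taylor_act_X hD hy wt one_mem_rational, PowerSeries.smul_eq_C_mul, mul_assoc]
      exact hs _
    rw [this]
    simp only [smul_eq_mul, Derivation.map_one_eq_zero]
    ring
  · simp [taylor, ratValue_one hD hy]

/-- Rational functions at the points `y / (1 - s y)`. -/
theorem taylor_mul_prod (hD : D ∈ divisors N) (hy : IsUnit (MvPolynomial.aeval y D))
    (wt : Fin N → ℕ) {f : (Fin N → ℤ) → ℂ} (hf : f ∈ rational D) :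
    taylor wt D y f * ∏ i, (1 - PowerSeries.C (y i) * PowerSeries.X) ^ (2 * wt i) =
      VOA.ratValue f D fun i => specialPoint (y i) := by
  have hf' := hf
  obtain ⟨h1, M, P, h⟩ := hf'
  have key := eq_ratValue_mul hD (isUnit_aeval_specialPoint hy) (rational D)
    (fun f hf i => act_mem_rational _ hf) (taylor wt D y)
    (fun f hf g hg => taylor_add hD hy wt hf hg) (fun c f hf => taylor_smul hD hy wt c hf)
    (fun f hf i => taylor_act_X hD hy wt hf i) one_mem_rational h1 hf h rfl
  rw [key, mul_assoc, taylor_one_mul hD hy, mul_one]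

end Taylor

/-! ### Translations -/

/-- The differential operator `∑ ∂_i`. -/
def translate (N : ℕ) (f : (Fin N → ℤ) → ℂ) (k : Fin N → ℤ) : ℂ :=
  ∑ i, (-(k i : ℂ)) * f (k - Pi.single i 1)

theorem translate_act_X (i : Fin N) (f : (Fin N → ℤ) → ℂ) :
    translate N (act (MvPolynomial.X i) f) = act (MvPolynomial.X i) (translate N f) + f := by
  funext k
  have e : f k = ∑ j, if j = i then f (k + Pi.single i 1 - Pi.single j 1) else 0 := by simp
  rw [Pi.add_apply, act_X, translate, translate, e, ← Finset.sum_add_distrib]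
  refine Finset.sum_congr rfl fun j _ => ?_
  rw [act_X, add_sub_right_comm k]
  by_cases h : j = i
  · subst h
    rw [if_pos rfl, Pi.add_apply, Pi.single_eq_same]
    push_cast
    ring
  · rw [if_neg h, Pi.add_apply, Pi.single_eq_of_ne h, add_zero, add_zero]

/-- The derivation `∑ ∂_i` of the polynomial ring. -/
def translateDerivation (N : ℕ) :
    Derivation ℂ (MvPolynomial (Fin N) ℂ) (MvPolynomial (Fin N) ℂ) :=
  MvPolynomial.mkDerivation ℂ fun _ => 1

theorem translate_act (p : MvPolynomial (Fin N) ℂ) (f : (Fin N → ℤ) → ℂ) :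
    translate N (act p f) = act p (translate N f) + act (translateDerivation N p) f := by
  induction p using MvPolynomial.induction_on generalizing f with
  | C a =>
    funext k
    simp [translate, translateDerivation, Finset.mul_sum, mul_left_comm]
  | add p q hp hq =>
    have hadd : ∀ f g, translate N (f + g) = translate N f + translate N g := fun f g => by
      funext k
      simp [translate, mul_add, Finset.sum_add_distrib]
    rw [act_add, hadd, hp, hq, map_add (translateDerivation N), act_add, act_add]
    abel
  | mul_X p i hp =>
    have e : translateDerivation N (p * MvPolynomial.X i) =
        p + translateDerivation N p * MvPolynomial.X i := by
      rw [Derivation.leibniz, translateDerivation, MvPolynomial.mkDerivation_X, smul_eq_mul, mul_one,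
        smul_eq_mul, mul_comm (MvPolynomial.X i)]
    rw [act_mul, hp, translate_act_X, map_add, e, act_add, act_mul p, act_mul _ (MvPolynomial.X i)]
    abel

theorem translate_one : translate N one = 0 := by
  funext k
  refine Finset.sum_eq_zero fun i _ => ?_
  by_cases h : k - Pi.single i 1 = fun _ => -1
  · have : k i = 0 := by
      have := congrFun h i
      rw [Pi.sub_apply, Pi.single_eq_same] at this
      omega
    simp [this]
  · simp [one, h]

theorem translateDerivation_diagonals : translateDerivation N (VOA.diagonals N) = 0 := by
  have hprod : ∀ {ι : Type} (s : Finset ι) (g : ι → MvPolynomial (Fin N) ℂ),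
      (∀ i ∈ s, translateDerivation N (g i) = 0) → translateDerivation N (∏ i ∈ s, g i) = 0 := by
    intro ι s g hg
    refine Finset.prod_induction g (fun p => translateDerivation N p = 0) (fun p q hp hq => ?_)
      (Derivation.map_one_eq_zero _) hg
    rw [Derivation.leibniz, hp, hq, smul_zero, smul_zero, add_zero]
  refine hprod _ _ fun i _ => hprod _ _ fun j _ => ?_
  rw [map_sub, translateDerivation, MvPolynomial.mkDerivation_X, MvPolynomial.mkDerivation_X,
    sub_self]

/-- In an auxiliary variable `t`, the polynomial `p(a + t)` has zero derivative. Positive integers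
are invertible in a `ℂ`-algebra, so it is constant. -/
theorem aeval_add_of_derivation_eq_zero {S : Type*} [CommRing S] [Algebra ℂ S]
    {p : MvPolynomial (Fin N) ℂ} (hp : translateDerivation N p = 0) (a : Fin N → S) (c : S) :
    MvPolynomial.aeval (fun i => a i + c) p = MvPolynomial.aeval a p := by
  have hder : ∀ q : MvPolynomial (Fin N) ℂ, Polynomial.derivative
      (MvPolynomial.aeval (fun i => Polynomial.C (a i) + Polynomial.X) q) =
      MvPolynomial.aeval (fun i => Polynomial.C (a i) + Polynomial.X) (translateDerivation N q) := by
    intro q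
    induction q using MvPolynomial.induction_on with
    | C z =>
      rw [MvPolynomial.aeval_C, MvPolynomial.derivation_C, map_zero]
      exact Polynomial.derivative_C
    | add p q hp hq => simp only [map_add, hp, hq]
    | mul_X p i hp =>
      rw [map_mul, Polynomial.derivative_mul, hp, Derivation.leibniz, MvPolynomial.aeval_X,
        translateDerivation, MvPolynomial.mkDerivation_X]
      simp
      ring
  have heval : ∀ (z : S) (q : MvPolynomial (Fin N) ℂ), Polynomial.eval z
      (MvPolynomial.aeval (fun i => Polynomial.C (a i) + Polynomial.X) q) =
      MvPolynomial.aeval (fun i => a i + z) q := by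
    intro z q
    induction q using MvPolynomial.induction_on with
    | C w =>
      rw [MvPolynomial.aeval_C, MvPolynomial.aeval_C]
      exact Polynomial.eval_C
    | add p q hp hq => simp only [map_add, Polynomial.eval_add, hp, hq]
    | mul_X p i hp => simp [hp]
  set Q := MvPolynomial.aeval (fun i => Polynomial.C (a i) + Polynomial.X) p with hQ
  have hQ0 : Polynomial.derivative Q = 0 := by rw [hQ, hder, hp, map_zero]
  have hC : Q = Polynomial.C (Q.coeff 0) := by
    ext j
    rcases j with _ | j
    · simp
    · have h1 := congrArg (fun R => Polynomial.coeff R j) hQ0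
      simp only [Polynomial.coeff_derivative, Polynomial.coeff_zero] at h1
      have hu : IsUnit ((j : S) + 1) := by
        have : ((j : S) + 1) = algebraMap ℂ S ((j : ℂ) + 1) := by simp
        rw [this]
        exact (IsUnit.mk0 _ (by exact_mod_cast Nat.succ_ne_zero j)).map _
      rw [Polynomial.coeff_C_succ]
      exact (hu.mul_left_eq_zero).1 h1
  have e1 := heval c p
  have e2 := heval 0 p
  simp only [add_zero] at e2
  rw [← e1, ← e2, ← hQ, hC, Polynomial.eval_C, Polynomial.eval_C]

/-- Translation invariant series extend to translation invariant rational functions. -/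
theorem ratValue_add_const {f : (Fin N → ℤ) → ℂ} (hf : f ∈ rational (VOA.diagonals N))
    (h0 : translate N f = 0) {S : Type*} [CommRing S] [Algebra ℂ S] (a : Fin N → S)
    (ha : IsUnit (MvPolynomial.aeval a (VOA.diagonals N))) (c : S) :
    VOA.ratValue f (VOA.diagonals N) (fun i => a i + c) =
      VOA.ratValue f (VOA.diagonals N) a := by
  obtain ⟨hf, M, P, h⟩ := hf
  have hd : translateDerivation N (VOA.diagonals N ^ M) = 0 := by
    rw [Derivation.leibniz_pow, translateDerivation_diagonals, smul_zero, smul_zero]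
  -- Differentiate `D^M f = P · 1`: the factors on the left and the series `1` are all invariant,
  -- hence so is `P`.
  have hP : translateDerivation N P = 0 := by
    refine act_one_injective ?_
    have h1 := translate_act P one
    rw [translate_one, map_zero, zero_add, ← h, translate_act, h0, hd, map_zero, map_zero] at h1
    rw [← h1, map_zero]
    simp
  have e1 := aeval_add_of_derivation_eq_zero translateDerivation_diagonals a c
  have ha' : IsUnit (MvPolynomial.aeval (fun i => a i + c) (VOA.diagonals N)) := by rwa [e1]
  have h2 := pow_mul_ratValue (diagonals_mem_divisors N) ha hf h
  have h3 := pow_mul_ratValue (diagonals_mem_divisors N) ha' hf h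
  rw [aeval_add_of_derivation_eq_zero hP, e1, ← h2] at h3
  exact (ha.pow M).mul_left_cancel h3

/-! ### Dilations -/

/-- The condition `degree + r = d` avoids a truncated subtraction: in use `p` is the numerator of a
function of degree `-r` whose denominator has degree `d`. -/
theorem aeval_smul_of_isHomogeneous {p : MvPolynomial (Fin N) ℂ} {S : Type*} [CommRing S]
    [Algebra ℂ S] (c : ℂ) (a : Fin N → S) {r d : ℕ} (h : ∀ m ∈ p.support, m.degree + r = d) :
    c ^ r • MvPolynomial.aeval (fun i => c • a i) p = c ^ d • MvPolynomial.aeval a p := by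
  rw [MvPolynomial.aeval_def, MvPolynomial.aeval_def, MvPolynomial.eval₂_eq', MvPolynomial.eval₂_eq',
    Finset.smul_sum, Finset.smul_sum]
  refine Finset.sum_congr rfl fun m hm => ?_
  simp only [smul_pow]
  rw [Finset.prod_smul, Finset.prod_pow_eq_pow_sum, mul_smul_comm, smul_smul, ← pow_add, ← h m hm,
    add_comm r]
  congr 2
  rw [Finsupp.degree_eq_sum]

theorem isHomogeneous_diagonals (N : ℕ) : ∃ d, (VOA.diagonals N).IsHomogeneous d :=
  ⟨_, MvPolynomial.IsHomogeneous.prod _ _ _ fun _ _ => MvPolynomial.IsHomogeneous.prod _ _ _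
    fun _ _ => (MvPolynomial.isHomogeneous_X _ _).sub (MvPolynomial.isHomogeneous_X _ _)⟩

theorem isHomogeneous_axes (N : ℕ) : ∃ d, (VOA.axes N).IsHomogeneous d :=
  ⟨_, MvPolynomial.IsHomogeneous.prod _ _ _ fun _ _ => MvPolynomial.isHomogeneous_X _ _⟩

theorem act_homogeneous {p : MvPolynomial (Fin N) ℂ} {d : ℕ} (hp : p.IsHomogeneous d)
    {f : (Fin N → ℤ) → ℂ} {r : ℤ} (hf : ∀ k, ∑ i, (k i + 1) ≠ r → f k = 0) (k : Fin N → ℤ)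
    (hk : ∑ i, (k i + 1) + d ≠ r) : act p f k = 0 := by
  rw [MvPolynomial.as_sum p, map_sum, LinearMap.sum_apply, Finset.sum_apply]
  refine Finset.sum_eq_zero fun m hm => ?_
  rw [act_monomial, hf, smul_zero]
  have h1 : m.degree = d := by
    by_contra hc
    exact (MvPolynomial.mem_support_iff.1 hm) (hp.coeff_eq_zero hc)
  intro hc
  apply hk
  rw [← hc, ← h1, Finsupp.degree_eq_sum, Nat.cast_sum, ← Finset.sum_add_distrib]
  exact Finset.sum_congr rfl fun i _ => by ring

/-- Homogeneous series extend to homogeneous rational functions. -/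
theorem ratValue_smul_point {D : MvPolynomial (Fin N) ℂ} (hD : D ∈ divisors N) {d : ℕ}
    (hd : D.IsHomogeneous d) {f : (Fin N → ℤ) → ℂ} (hf : f ∈ rational D) {r : ℕ}
    (hr : ∀ k, ∑ i, (k i + 1) ≠ (r : ℤ) → f k = 0) {S : Type*} [CommRing S] [Algebra ℂ S]
    {a : Fin N → S} (ha : IsUnit (MvPolynomial.aeval a D)) {c : ℂ} (hc : c ≠ 0) :
    c ^ r • VOA.ratValue f D (fun i => c • a i) = VOA.ratValue f D a := by
  obtain ⟨hf, M, P, h⟩ := hf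
  have hDM : ∀ {E : MvPolynomial (Fin N) ℂ} {e : ℕ}, E.IsHomogeneous e →
      MvPolynomial.aeval (fun i => c • a i) E = c ^ e • MvPolynomial.aeval a E := by
    intro E e hE
    have := aeval_smul_of_isHomogeneous (p := E) c a (r := 0) (d := e) fun m hm => by
      by_contra hc
      exact (MvPolynomial.mem_support_iff.1 hm) (hE.coeff_eq_zero (by simpa using hc))
    simpa using this
  have hP : c ^ r • MvPolynomial.aeval (fun i => c • a i) P =
      c ^ (d * M) • MvPolynomial.aeval a P := by
    refine aeval_smul_of_isHomogeneous c a fun m hm => ?_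
    rw [MvPolynomial.mem_support_iff, ← act_one_apply, ← h] at hm
    by_contra hne
    refine hm (act_homogeneous (hd.pow M) hr _ fun hc => hne ?_)
    have e : ∑ i, ((-1 - (m i : ℤ)) + 1) = -(m.degree : ℤ) := by
      rw [Finsupp.degree_eq_sum, Nat.cast_sum, ← Finset.sum_neg_distrib]
      exact Finset.sum_congr rfl fun i _ => by ring
    rw [e] at hc
    omega
  have hu : IsUnit (algebraMap ℂ S c) := (IsUnit.mk0 c hc).map _
  have ha' : IsUnit (MvPolynomial.aeval (fun i => c • a i) D) := by
    rw [hDM hd, Algebra.smul_def, map_pow]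
    exact (hu.pow d).mul ha
  have h1 := pow_mul_ratValue hD ha hf h
  have h2 := pow_mul_ratValue hD ha' hf h
  have h3 := congrArg (fun z => c ^ r • z) h2
  rw [hP, ← h1, ← map_pow, hDM (hd.pow M), smul_mul_assoc, smul_comm] at h3
  have hu' : IsUnit (algebraMap ℂ S (c ^ (d * M))) := by rw [map_pow]; exact hu.pow _
  rw [Algebra.smul_def, Algebra.smul_def (c ^ (d * M)), map_pow (MvPolynomial.aeval a)] at h3
  have h4 := hu'.mul_left_cancel h3
  rw [← mul_smul_comm] at h4
  exact (ha.pow M).mul_left_cancel h4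

end FormalSeries

namespace FormalSeries

/-! ### Alternating sums -/

theorem sum_range_sum_range {α : Type*} [AddCommMonoid α] {M a b : ℕ} (ha : M < a) (hb : M < b)
    {F : ℕ → ℕ → α} (hF : ∀ c i, M < c + i → F c i = 0) :
    ∑ c ∈ Finset.range a, ∑ i ∈ Finset.range b, F c i =
      ∑ d ∈ Finset.range (M + 1), ∑ p ∈ Finset.HasAntidiagonal.antidiagonal d, F p.1 p.2 := by
  rw [← Finset.sum_product', ← Finset.sum_filter_of_ne (p := fun p => p.1 + p.2 < M + 1)
      (fun p _ hp => by
        by_contra hc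
        exact hp (hF _ _ (by omega))),
    ← Finset.sum_fiberwise_of_maps_to (g := fun p : ℕ × ℕ => p.1 + p.2) (t := Finset.range (M + 1))
      (fun p hp => Finset.mem_range.2 (Finset.mem_filter.1 hp).2)]
  refine Finset.sum_congr rfl fun d hd => Finset.sum_congr ?_ fun _ _ => rfl
  ext p
  simp only [Finset.mem_filter, Finset.mem_product, Finset.mem_range, Finset.HasAntidiagonal.mem_antidiagonal] at hd ⊢
  omega

/-- The binomial expansion of `(-1 + 1)^d / d!`. -/
theorem sum_antidiagonal_alternating (d : ℕ) :
    ∑ p ∈ Finset.HasAntidiagonal.antidiagonal d, ((-1 : ℂ) ^ p.1 * (p.1.factorial : ℂ)⁻¹ * (p.2.factorial : ℂ)⁻¹) =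
      if d = 0 then 1 else 0 := by
  have h := (Commute.all (-1 : ℂ) 1).add_pow' d
  have h1 : ∑ p ∈ Finset.HasAntidiagonal.antidiagonal d,
      ((-1 : ℂ) ^ p.1 * (p.1.factorial : ℂ)⁻¹ * (p.2.factorial : ℂ)⁻¹) =
      (d.factorial : ℂ)⁻¹ * (-1 + 1) ^ d := by
    rw [h, Finset.mul_sum]
    refine Finset.sum_congr rfl fun p hp => ?_
    rw [← Finset.HasAntidiagonal.mem_antidiagonal.1 hp, one_pow, mul_one, nsmul_eq_mul,
      Nat.choose_symm_add, Nat.add_choose,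
      Nat.cast_div (Nat.factorial_mul_factorial_dvd_factorial_add _ _)]
    · have h1 : (p.1.factorial : ℂ) ≠ 0 := by exact_mod_cast p.1.factorial_ne_zero
      have h2 : (p.2.factorial : ℂ) ≠ 0 := by exact_mod_cast p.2.factorial_ne_zero
      have h3 : ((p.1 + p.2).factorial : ℂ) ≠ 0 := by exact_mod_cast (p.1 + p.2).factorial_ne_zero
      push_cast
      field_simp
    · exact_mod_cast mul_ne_zero p.1.factorial_ne_zero p.2.factorial_ne_zero
  rw [h1]
  by_cases hd : d = 0
  · subst hd; simp
  · simp [hd]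

/-- The coefficients of `e^{-t} e^t = 1`. It is used for the involutivity of the adjoint and again
for the cancellation of the powers of `L(-1)` in the handle. -/
theorem sum_alternating {α : Type*} [AddCommGroup α] [Module ℂ α] {M a b : ℕ} (ha : M < a)
    (hb : M < b) {H : ℕ → α} (hH : ∀ d, M < d → H d = 0) :
    ∑ c ∈ Finset.range a, ∑ i ∈ Finset.range b,
      ((-1 : ℂ) ^ c * (c.factorial : ℂ)⁻¹ * (i.factorial : ℂ)⁻¹) • H (c + i) = H 0 := by
  rw [sum_range_sum_range ha hb fun c i h => by rw [hH _ h, smul_zero]]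
  have : ∀ d ∈ Finset.range (M + 1), ∑ p ∈ Finset.HasAntidiagonal.antidiagonal d,
      ((-1 : ℂ) ^ p.1 * (p.1.factorial : ℂ)⁻¹ * (p.2.factorial : ℂ)⁻¹) • H (p.1 + p.2) =
      if d = 0 then H 0 else 0 := fun d _ => by
    rw [Finset.sum_congr rfl fun p hp => by rw [Finset.HasAntidiagonal.mem_antidiagonal.1 hp], ← Finset.sum_smul,
      sum_antidiagonal_alternating]
    by_cases hd : d = 0
    · simp [hd]
    · simp [hd]
  rw [Finset.sum_congr rfl this, Finset.sum_ite_eq' (Finset.range (M + 1)) 0, if_pos (by simp)]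

end FormalSeries

namespace VOA

open FormalSeries

variable {V : Type*} [AddCommGroup V] [Module ℂ V] {A : VOA V}

/-! ### Invariant bilinear forms -/

section LiZ

variable {B : LinearMap.BilinForm ℂ V}

theorem adjMode_conf_apply (n : ℤ) : A.adjMode 2 A.conf n = A.mode A.conf (2 - n) := by
  have h2 : (A.L 1 ^ 2) A.conf = 0 := by
    rw [pow_two, Module.End.mul_apply, L_one_conf, map_zero]
  rw [adjMode, Finset.sum_range_succ, Finset.sum_range_succ, Finset.sum_range_one, h2, pow_one,
    L_one_conf, mode_zero, mode_zero]
  norm_num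
  congr 1
  ring

theorem IsLiZ.L_left (hB : A.IsLiZ B) (m : ℤ) (x y : V) : B (A.L m x) y = B x (A.L (-m) y) := by
  rw [L, hB.1 2 _ conf_mem, adjMode_conf_apply, L]
  congr 3
  ring

theorem IsLiZ.L_one_pow_left (hB : A.IsLiZ B) (i : ℕ) (x y : V) :
    B ((A.L 1 ^ i) x) y = B x ((A.L (-1) ^ i) y) := by
  induction i generalizing y with
  | zero => simp
  | succ i ih => rw [pow_succ', Module.End.mul_apply, hB.L_left, ih, ← Module.End.mul_apply, pow_succ]

theorem IsLiZ.L_neg_one_pow_left (hB : A.IsLiZ B) (i : ℕ) (x y : V) :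
    B ((A.L (-1) ^ i) x) y = B x ((A.L 1 ^ i) y) := by
  induction i generalizing y with
  | zero => simp
  | succ i ih =>
    rw [pow_succ', Module.End.mul_apply, hB.L_left, ih, ← Module.End.mul_apply, pow_succ, neg_neg]

theorem IsLiZ.vac_L_neg_one (hB : A.IsLiZ B) (x : V) : B A.vac (A.L (-1) x) = 0 := by
  rw [← hB.L_left, L_one_vac, map_zero, LinearMap.zero_apply]

theorem IsLiZ.vac_mem_restrictedDual (hB : A.IsLiZ B) : B A.vac ∈ A.restrictedDual :=
  ⟨1, fun n hn v hv => functional_eq_zero (A := A) (fun w => by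
    rw [← neg_zero (G := ℤ), ← hB.L_left, L_zero_vac, map_zero, LinearMap.zero_apply])
    (by omega) hv⟩

theorem IsLiZ.eq_zero_of_ne (hB : A.IsLiZ B) {k l : ℕ} (hkl : k ≠ l) {x y : V}
    (hx : x ∈ A.wtSpace k) (hy : y ∈ A.wtSpace l) : B x y = 0 := by
  have h := hB.L_left 0 x y
  rw [neg_zero, mem_wtSpace_iff.1 hx, mem_wtSpace_iff.1 hy, map_smul, map_smul,
    LinearMap.smul_apply, smul_eq_mul, smul_eq_mul, ← sub_eq_zero, ← sub_mul] at h
  exact (mul_eq_zero.1 h).resolve_left (sub_ne_zero.2 (by exact_mod_cast hkl))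

theorem IsLiZ.apply_proj (hB : A.IsLiZ B) {k : ℕ} {x : V} (hx : x ∈ A.wtSpace k) (y : V) :
    B x (A.proj k y) = B x y := by
  refine induction_wt (A := A) (p := fun y => B x (A.proj k y) = B x y) ?_ ?_ y
  · intro l y hy
    by_cases h : k = l
    · subst h
      rw [proj_of_mem hy]
    · rw [proj_of_mem_ne h hy, hB.eq_zero_of_ne h hx hy, Submodule.coe_zero, map_zero]
  · intro y y' h h'
    rw [map_add, Submodule.coe_add, map_add, map_add, h, h']

/-- Traces in terms of dual bases. -/
theorem IsLiZ.sum_dual (hB : A.IsLiZ B) {k : ℕ} {ι : Type*} [Fintype ι] [DecidableEq ι]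
    (b b' : Module.Basis ι ℂ (A.wtSpace k))
    (hb : ∀ i j, B (b i : V) (b' j : V) = if i = j then 1 else 0) (T : Module.End ℂ V) :
    ∑ i, B (b i) (T (b' i)) = A.tr k T := by
  rw [tr_eq_sum b']
  refine Finset.sum_congr rfl fun i _ => ?_
  rw [← hB.apply_proj (b i).2]
  generalize A.proj k (T (b' i)) = x
  conv_lhs => rw [← b'.sum_repr x, Submodule.coe_sum, map_sum]
  simp [hb]

/-- The functionals `⟨𝟙, u(n) ·⟩` in terms of `L(1)`. -/
theorem IsLiZ.vac_mode (hB : A.IsLiZ B) {N K : ℕ} (hNK : N ≤ K) {u : V} (hu : u ∈ A.wtSpace N)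
    (μ : ℤ) (x : V) : B A.vac (A.mode u (2 * N + μ - 1) x) =
      (-1) ^ N * ∑ i ∈ Finset.range (K + 1), (i.factorial : ℂ)⁻¹ *
        if 0 ≤ μ + i then ((μ + i).toNat.factorial : ℂ)⁻¹ *
          B ((A.L 1 ^ i) u) ((A.L 1 ^ (μ + i).toNat) x) else 0 := by
  -- Taking adjoints twice is the identity. Moving the modes of `L(1)^i u` across the form gives a
  -- second sum, over the `j` of `adjMode`; its terms depend on `i + j` only, through `H`, up to the
  -- alternating coefficients, so `H 0` alone survives.
  set H : ℕ → ℂ := fun d => B A.vac (A.mode ((A.L 1 ^ d) u) (2 * N + μ - 1 - d) x) with hH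
  have hH0 : ∀ d, N < d → H d = 0 := fun d hd => by
    simp only [hH]
    rw [L_one_pow_eq_zero hd hu, mode_zero, LinearMap.zero_apply, map_zero]
  have e : H 0 = B A.vac (A.mode u (2 * N + μ - 1) x) := by simp [hH]
  rw [← e, ← sum_alternating (Nat.lt_succ_of_le hNK) (Nat.lt_succ_of_le hNK) hH0, Finset.mul_sum]
  refine Finset.sum_congr rfl fun i _ => ?_
  by_cases hi : N < i
  · rw [L_one_pow_eq_zero hi hu, map_zero, LinearMap.zero_apply, mul_zero, ite_self, mul_zero,
      mul_zero]
    refine Finset.sum_eq_zero fun j _ => ?_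
    rw [hH0 _ (by omega), smul_zero]
  obtain ⟨N', rfl⟩ : ∃ N', N = N' + i := ⟨N - i, by omega⟩
  have hL : (if 0 ≤ μ + i then ((μ + i).toNat.factorial : ℂ)⁻¹ *
      B ((A.L 1 ^ i) u) ((A.L 1 ^ (μ + i).toNat) x) else 0) =
      B (A.mode ((A.L 1 ^ i) u) (-(μ + i) - 1) A.vac) x := by
    split_ifs with h
    · obtain ⟨m, hm⟩ : ∃ m : ℕ, μ + i = m := ⟨(μ + i).toNat, by omega⟩
      rw [hm, mode_vac_succ, map_smul, LinearMap.smul_apply, hB.L_neg_one_pow_left, Int.toNat_natCast,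
        smul_eq_mul]
    · rw [mode_vac_nonneg _ (by omega), map_zero, LinearMap.zero_apply]
  rw [hL, hB.1 N' _ (L_one_pow_mem hu), adjMode, LinearMap.smul_apply, map_smul, LinearMap.sum_apply,
    map_sum, ← Finset.sum_range_add_sum_Ico _ (by omega : N' + 1 ≤ K + 1),
    Finset.sum_eq_zero (s := Finset.Ico _ _) fun j hj => ?_, add_zero, smul_eq_mul, Finset.mul_sum,
    Finset.mul_sum, Finset.mul_sum]
  · refine Finset.sum_congr rfl fun j _ => ?_
    simp only [hH]
    rw [LinearMap.smul_apply, map_smul, ← Module.End.mul_apply, ← pow_add, add_comm j i]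
    have : (2 * (N' : ℤ) - (-(μ + i) - 1) - 2 - j) =
        2 * ((N' + i : ℕ) : ℤ) + μ - 1 - ((i + j : ℕ) : ℤ) := by
      push_cast
      ring
    rw [this, smul_eq_mul, smul_eq_mul, pow_add (-1 : ℂ)]
    have h1 : ((-1 : ℂ) ^ N') * (-1) ^ N' = 1 := by rw [← mul_pow]; simp
    linear_combination (-(-1 : ℂ) ^ i * (i.factorial : ℂ)⁻¹ * (j.factorial : ℂ)⁻¹ *
      B A.vac (A.mode ((A.L 1 ^ (i + j)) u) (2 * ((N' + i : ℕ) : ℤ) + μ - 1 - ((i + j : ℕ) : ℤ)) x)) * h1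
  · rw [hH0 _ (by have := (Finset.mem_Ico.1 hj).1; omega), smul_zero]

end LiZ

/-! ### Traces and translations -/

theorem tr_mul_L_neg_one_pow (k c : ℕ) (T : Module.End ℂ V) :
    A.tr k (T * A.L (-1) ^ c) = A.tr (k + c) (A.L (-1) ^ c * T) := by
  induction c generalizing k T with
  | zero => simp
  | succ c ih =>
    rw [pow_succ, ← mul_assoc, tr_mul_L_neg_one, ← mul_assoc, ih, mul_assoc, add_right_comm, add_assoc]

/-- Weights are nonnegative, so the image of `L(-1)^d` has no component of weight below `d`. -/
theorem tr_L_neg_one_pow_mul {M d : ℕ} (h : M < d) (T : Module.End ℂ V) :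
    A.tr M (A.L (-1) ^ d * T) = 0 := by
  obtain ⟨d, rfl⟩ : ∃ e, d = e + 1 := ⟨d - 1, by omega⟩
  induction M generalizing d T with
  | zero => rw [pow_succ', mul_assoc, tr_zero_L_neg_one_mul]
  | succ M ih =>
    obtain ⟨d, rfl⟩ : ∃ e, d = e + 1 := ⟨d - 1, by omega⟩
    rw [pow_succ', mul_assoc, ← tr_mul_L_neg_one, mul_assoc, ih _ d (by omega)]

/-! ### Commutators with products of vertex operators -/

/-- The Leibniz rule for a derivation that acts on each vertex operator by shifting its modes. -/
theorem lie_prodModes {X : Module.End ℂ V} {d : ℤ} {n : ℕ} {v : Fin n → V} {c : Fin n → ℤ → ℂ}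
    (h : ∀ i k, ⁅X, A.mode (v i) k⁆ = c i k • A.mode (v i) (k + d)) (k : Fin n → ℤ) :
    ⁅X, A.prodModes v k⁆ = ∑ i, c i (k i) • A.prodModes v (k + Pi.single i d) := by
  induction n with
  | zero => simp [prodModes_zero, Ring.lie_def]
  | succ n ih =>
    have e : ⁅X, A.mode (v 0) (k 0) * A.prodModes (v ∘ Fin.succ) (k ∘ Fin.succ)⁆ =
        ⁅X, A.mode (v 0) (k 0)⁆ * A.prodModes (v ∘ Fin.succ) (k ∘ Fin.succ) +
        A.mode (v 0) (k 0) * ⁅X, A.prodModes (v ∘ Fin.succ) (k ∘ Fin.succ)⁆ := by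
      simp only [Ring.lie_def]
      noncomm_ring
    rw [prodModes_succ, e, h, ih (v := v ∘ Fin.succ) (c := c ∘ Fin.succ) (fun i => h i.succ), Fin.sum_univ_succ,
      Finset.mul_sum]
    congr 1
    · rw [prodModes_succ, smul_mul_assoc]
      have h0 : (k + Pi.single 0 d) ∘ Fin.succ = k ∘ Fin.succ := funext fun i => by simp
      rw [h0, Pi.add_apply, Pi.single_eq_same]
    · refine Finset.sum_congr rfl fun i _ => ?_
      rw [prodModes_succ, mul_smul_comm]
      congr 3
      · simp
      · funext j
        simp [Pi.single_apply]

/-- Quasiprimarity enters here: without the term of `L(1) v`, the bracket with `L(1)` is a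
first-order differential operator on the same product, the one called `special`. -/
theorem lie_L_one_prodModes {n : ℕ} {wt : Fin n → ℕ} {v : Fin n → V}
    (hv : ∀ i, A.IsQuasiprimary (wt i) (v i)) (k : Fin n → ℤ) :
    ⁅A.L 1, A.prodModes v k⁆ =
      ∑ i, (2 * (wt i : ℂ) - k i - 2) • A.prodModes v (k + Pi.single i 1) :=
  lie_prodModes (c := fun i k => 2 * (wt i : ℂ) - k - 2) (fun i k => by
    rw [lie_L_one_mode_of_mem (hv i).1, (hv i).2, mode_zero, zero_add]) k

theorem apply_ad_pow_prodModes {n : ℕ} {wt : Fin n → ℕ} {v : Fin n → V}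
    (hv : ∀ i, A.IsQuasiprimary (wt i) (v i)) (φ : Module.End ℂ V →ₗ[ℂ] ℂ) (P : ℕ) :
    (fun k => φ ((bracketLeft (A.L 1) ^ P) (A.prodModes v k))) =
      (special wt ^ P) fun k => φ (A.prodModes v k) := by
  induction P with
  | zero => simp
  | succ P ih =>
    rw [pow_succ' (special wt), Module.End.mul_apply, ← ih]
    funext k
    rw [pow_succ, Module.End.mul_apply, bracketLeft_apply, lie_L_one_prodModes hv, map_sum, map_sum,
      special_apply]
    simp only [map_smul, smul_eq_mul]

theorem translate_prodModes_vac {n : ℕ} (v : Fin n → V) {ℓ : Module.Dual ℂ V}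
    (hℓ : ∀ x, ℓ (A.L (-1) x) = 0) : translate n (fun k => ℓ (A.prodModes v k A.vac)) = 0 := by
  funext k
  have h := lie_prodModes (A := A) (v := v) (c := fun _ k => -(k : ℂ)) (d := -1)
    (fun i k => lie_mode_L_neg_one (v i) k) k
  have h1 := congrArg (fun T : Module.End ℂ V => ℓ (T A.vac)) h
  simp only [Ring.lie_def, LinearMap.sub_apply, Module.End.mul_apply, L_neg_one_vac, map_zero,
    sub_zero, hℓ, LinearMap.sum_apply, map_sum, LinearMap.smul_apply, map_smul, smul_eq_mul] at h1
  refine (Eq.trans ?_ h1.symm).trans rfl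
  refine Finset.sum_congr rfl fun i _ => ?_
  rw [Pi.single_neg, ← sub_eq_add_neg]

end VOA

namespace FormalSeries

open VOA

variable {n : ℕ}

/-! ### Expansions of rational functions around a handle -/

/-- The coefficient of `w^{-s-1} w'^{-t-1}` in a series in `x_1, …, x_n, w, w'`. -/
def slice (h : (Fin (n + 2) → ℤ) → ℂ) (s t : ℤ) (κ : Fin n → ℤ) : ℂ := h (Fin.append κ ![s, t])

theorem slice_act_castAdd (i : Fin n) (h : (Fin (n + 2) → ℤ) → ℂ) (s t : ℤ) :
    slice (act (MvPolynomial.X (Fin.castAdd 2 i)) h) s t = act (MvPolynomial.X i) (slice h s t) := by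
  funext κ
  rw [slice, act_X, act_X, slice]
  congr 1
  funext j
  refine Fin.addCases (fun j => ?_) (fun j => ?_) j
  · simp [Pi.single_apply]
  · have : Fin.natAdd n j ≠ Fin.castAdd 2 i := fun h => by
      have := congrArg Fin.val h
      simp at this
      omega
    simp [Pi.single_eq_of_ne this]

theorem slice_act_left (h : (Fin (n + 2) → ℤ) → ℂ) (s t : ℤ) :
    slice (act (MvPolynomial.X (Fin.natAdd n 0)) h) s t = slice h (s + 1) t := by
  funext κ
  rw [slice, act_X, slice]
  congr 1
  funext j
  refine Fin.addCases (fun j => ?_) (fun j => ?_) j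
  · have : Fin.castAdd 2 j ≠ Fin.natAdd n 0 := fun h => by
      have := congrArg Fin.val h
      simp at this
      omega
    rw [Pi.add_apply, Pi.single_eq_of_ne this]
    simp
  · fin_cases j <;> simp

theorem slice_act_right (h : (Fin (n + 2) → ℤ) → ℂ) (s t : ℤ) :
    slice (act (MvPolynomial.X (Fin.natAdd n 1)) h) s t = slice h s (t + 1) := by
  funext κ
  rw [slice, act_X, slice]
  congr 1
  funext j
  refine Fin.addCases (fun j => ?_) (fun j => ?_) j
  · have : Fin.castAdd 2 j ≠ Fin.natAdd n 1 := fun h => by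
      have := congrArg Fin.val h
      simp at this
      omega
    rw [Pi.add_apply, Pi.single_eq_of_ne this]
    simp
  · fin_cases j <;> simp

/-- Series that are expansions in `|w| > |x_i| > |w'|`. -/
def sewable (D : MvPolynomial (Fin n) ℂ) : Submodule ℂ ((Fin (n + 2) → ℤ) → ℂ) where
  -- The bound on `s` bounds the powers of `w` from above; vanishing for `t ≥ 0` excludes negative
  -- powers of `w'`, whose vertex operator acts on the vacuum.
  carrier := {h | (∀ s t, slice h s t ∈ rational D) ∧ (∃ K : ℤ, ∀ s t, s < K → slice h s t = 0) ∧
    ∀ s t, 0 ≤ t → slice h s t = 0}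
  zero_mem' := ⟨fun _ _ => Submodule.zero_mem _, ⟨0, fun _ _ _ => rfl⟩, fun _ _ _ => rfl⟩
  add_mem' := by
    rintro f g ⟨hf, ⟨K, hK⟩, hf'⟩ ⟨hg, ⟨K', hK'⟩, hg'⟩
    have e : ∀ s t, slice (f + g) s t = slice f s t + slice g s t := fun _ _ => rfl
    refine ⟨fun s t => ?_, ⟨min K K', fun s t hs => ?_⟩, fun s t ht => ?_⟩
    · rw [e]
      exact Submodule.add_mem _ (hf s t) (hg s t)
    · rw [e, hK s t (by omega), hK' s t (by omega), add_zero]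
    · rw [e, hf' s t ht, hg' s t ht, add_zero]
  smul_mem' := by
    rintro c f ⟨hf, ⟨K, hK⟩, hf'⟩
    have e : ∀ s t, slice (c • f) s t = c • slice f s t := fun _ _ => rfl
    refine ⟨fun s t => ?_, ⟨K, fun s t hs => ?_⟩, fun s t ht => ?_⟩
    · rw [e]
      exact Submodule.smul_mem _ _ (hf s t)
    · rw [e, hK s t hs, smul_zero]
    · rw [e, hf' s t ht, smul_zero]

theorem act_X_mem_sewable {D : MvPolynomial (Fin n) ℂ} {h : (Fin (n + 2) → ℤ) → ℂ}
    (hh : h ∈ sewable D) (i : Fin (n + 2)) : act (MvPolynomial.X i) h ∈ sewable D := by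
  obtain ⟨h1, ⟨K, hK⟩, h2⟩ := hh
  refine Fin.addCases (fun i => ?_) (fun i => ?_) i
  · refine ⟨fun s t => ?_, ⟨K, fun s t hs => ?_⟩, fun s t ht => ?_⟩
    · rw [slice_act_castAdd]
      exact act_mem_rational _ (h1 s t)
    · rw [slice_act_castAdd, hK s t hs, map_zero]
    · rw [slice_act_castAdd, h2 s t ht, map_zero]
  · have : i = 0 ∨ i = 1 := by omega
    rcases this with rfl | rfl
    · refine ⟨fun s t => ?_, ⟨K - 1, fun s t hs => ?_⟩, fun s t ht => ?_⟩
      · rw [slice_act_left]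
        exact h1 _ _
      · rw [slice_act_left, hK _ _ (by omega)]
      · rw [slice_act_left, h2 _ _ ht]
    · refine ⟨fun s t => ?_, ⟨K, fun s t hs => ?_⟩, fun s t ht => ?_⟩
      · rw [slice_act_right]
        exact h1 _ _
      · rw [slice_act_right, hK _ _ hs]
      · rw [slice_act_right, h2 _ _ (by omega)]

theorem slice_one (s t : ℤ) : slice (n := n) one s t = if s = -1 ∧ t = -1 then one else 0 := by
  funext κ
  have : (Fin.append κ ![s, t] = fun _ => -1) ↔ (κ = fun _ => -1) ∧ s = -1 ∧ t = -1 := by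
    constructor
    · intro h
      refine ⟨funext fun i => ?_, ?_, ?_⟩
      · simpa using congrFun h (Fin.castAdd 2 i)
      · simpa using congrFun h (Fin.natAdd n 0)
      · simpa using congrFun h (Fin.natAdd n 1)
    · rintro ⟨rfl, rfl, rfl⟩
      funext j
      refine Fin.addCases (fun j => ?_) (fun j => ?_) j
      · simp
      · fin_cases j <;> simp
  rw [slice, one]
  simp only [this]
  by_cases h : s = -1 ∧ t = -1
  · simp [h, one]
  · simp [h]

theorem one_mem_sewable (D : MvPolynomial (Fin n) ℂ) : one ∈ sewable D := by
  refine ⟨fun s t => ?_, ⟨-1, fun s t hs => ?_⟩, fun s t ht => ?_⟩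
  · rw [slice_one]
    split_ifs
    · exact one_mem_rational
    · exact Submodule.zero_mem _
  · rw [slice_one, if_neg (by omega)]
  · rw [slice_one, if_neg (by omega)]

/-- An extension to a linear map on all series can be exchanged with sums without checking that each
summand is rational. -/
theorem exists_extend_ratValue {D : MvPolynomial (Fin n) ℂ} (hD : D ∈ divisors n) {y : Fin n → ℂ}
    (hy : IsUnit (MvPolynomial.aeval y D)) : ∃ ev : ((Fin n → ℤ) → ℂ) →ₗ[ℂ] ℂ,
      ∀ f ∈ rational D, ev f = ratValue f D y := by
  obtain ⟨ev, hev⟩ := LinearMap.exists_extend (value hD hy)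
  exact ⟨ev, fun f hf => congrArg (fun φ : rational D →ₗ[ℂ] ℂ => φ ⟨f, hf⟩) hev⟩

section Sew

variable {Q : Type*} [CommRing Q] [Algebra ℂ Q] (q : Q) (m : ℕ) (ev : ((Fin n → ℤ) → ℂ) →ₗ[ℂ] ℂ)

/-- The coefficient of `σ^p` of the series `h` at `w = σ⁻¹`, `w' = -q σ⁻¹`. -/
def sewCoeff (h : (Fin (n + 2) → ℤ) → ℂ) (p : ℤ) : Q :=
  -- The monomial `w^{-s-1} w'^{-t-1}` equals `(-q)^{-t-1} σ^{s+t+2}`. Here `t = -c-1`, so `s =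
  -- p+c-1`, and `c ≤ m` suffices once `q^{m+1} = 0`.
  ∑ c ∈ Finset.range (m + 1), (-q) ^ c * algebraMap ℂ Q (ev (slice h (p + c - 1) (-(c : ℤ) - 1)))

open Classical in
/-- The series `h` at `w = σ⁻¹`, `w' = -q σ⁻¹`, where `q ^ (m + 1) = 0`. -/
def sew (h : (Fin (n + 2) → ℤ) → ℂ) : LaurentSeries Q :=
  if H : BddBelow (Function.support (sewCoeff q m ev h)) then HahnSeries.ofSuppBddBelow _ H else 0

theorem coeff_sew {D : MvPolynomial (Fin n) ℂ} {h : (Fin (n + 2) → ℤ) → ℂ} (hh : h ∈ sewable D)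
    (p : ℤ) : (sew q m ev h).coeff p = sewCoeff q m ev h p := by
  obtain ⟨-, ⟨K, hK⟩, -⟩ := hh
  have H : BddBelow (Function.support (sewCoeff q m ev h)) := by
    refine ⟨K - m, fun p hp => ?_⟩
    by_contra hc
    refine hp (Finset.sum_eq_zero fun c hc' => ?_)
    rw [hK _ _ (by have := Finset.mem_range.1 hc'; omega), map_zero, map_zero, mul_zero]
  rw [sew, dif_pos H]
  rfl

/-- The points `y_1, …, y_n, σ⁻¹, -q σ⁻¹`. -/
def sewPoint (y : Fin n → ℂ) : Fin (n + 2) → LaurentSeries Q :=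
  Fin.append (fun i => algebraMap ℂ _ (y i)) ![HahnSeries.single (-1) 1, HahnSeries.single (-1) (-q)]

theorem coeff_algebraMap_mul (c : ℂ) (x : LaurentSeries Q) (p : ℤ) :
    (algebraMap ℂ (LaurentSeries Q) c * x).coeff p = algebraMap ℂ Q c * x.coeff p := by
  rw [HahnSeries.algebraMap_apply', PowerSeries.algebraMap_apply, HahnSeries.ofPowerSeries_C,
    HahnSeries.C_mul_eq_smul, HahnSeries.coeff_smul, smul_eq_mul]

variable {m q ev}

/-- `f` and `g` expand the same rational function in different regions. Substitution into `g` is a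
summation method to which `eq_ratValue_mul` applies, although it would not make sense on `f`
directly. -/
theorem sew_eq_ratValue (hq : q ^ (m + 1) = 0) {D : MvPolynomial (Fin n) ℂ} (hD : D ∈ divisors n)
    {y : Fin n → ℂ} (hy : IsUnit (MvPolynomial.aeval y D))
    (hev : ∀ f ∈ rational D, ev f = ratValue f D y)
    (hu : IsUnit (MvPolynomial.aeval (sewPoint q y) (diagonals (n + 2))))
    {f g : (Fin (n + 2) → ℤ) → ℂ} (hf : f ∈ rational (diagonals (n + 2))) (hg : g ∈ sewable D)
    {M : ℕ} (hfg : act (diagonals (n + 2) ^ M) g = act (diagonals (n + 2) ^ M) f) :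
    sew q m ev g = ratValue f (diagonals (n + 2)) (sewPoint q y) := by
  have key : sew q m ev g =
      ratValue f (diagonals (n + 2)) (sewPoint q y) * sew q m ev one := by
    obtain ⟨hft, M', P, hP⟩ := hf
    refine eq_ratValue_mul (diagonals_mem_divisors _) hu (sewable D)
      (fun h hh i => act_X_mem_sewable hh i) (sew q m ev) (fun h hh h' hh' => ?_)
      (fun c h hh => ?_) (fun h hh i => ?_) (one_mem_sewable D) hft (M := M + M')
      (P := diagonals (n + 2) ^ M * P) hg ?_ ?_
    · ext p
      rw [HahnSeries.coeff_add, coeff_sew q m ev hh, coeff_sew q m ev hh',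
        coeff_sew q m ev (Submodule.add_mem _ hh hh'), sewCoeff, sewCoeff, sewCoeff,
        ← Finset.sum_add_distrib]
      refine Finset.sum_congr rfl fun c _ => ?_
      rw [← mul_add, ← map_add, ← map_add]
      rfl
    · ext p
      rw [Algebra.smul_def c (sew q m ev h), coeff_algebraMap_mul, coeff_sew q m ev hh,
        coeff_sew q m ev (Submodule.smul_mem _ _ hh), sewCoeff, sewCoeff, Finset.mul_sum]
      refine Finset.sum_congr rfl fun d _ => ?_
      rw [mul_left_comm, ← map_mul]
      exact congrArg (fun z => (-q) ^ d * algebraMap ℂ Q z) (map_smul ev c _)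
    · have hX := act_X_mem_sewable hh i
      ext p
      rw [coeff_sew q m ev hX]
      revert hX
      refine Fin.addCases (fun i => ?_) (fun i => ?_) i
      · intro hX
        rw [sewPoint, Fin.append_left, coeff_algebraMap_mul, coeff_sew q m ev hh, sewCoeff, sewCoeff,
          Finset.mul_sum]
        refine Finset.sum_congr rfl fun c _ => ?_
        rw [slice_act_castAdd, hev _ (act_mem_rational _ (hh.1 _ _)),
          ratValue_act hD hy _ (hh.1 _ _), MvPolynomial.aeval_X, hev _ (hh.1 _ _), map_mul]
        ring
      · have hi : i = 0 ∨ i = 1 := by omega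
        intro hX
        rw [sewPoint, Fin.append_right]
        rcases hi with rfl | rfl
        · rw [Matrix.cons_val_zero, HahnSeries.coeff_single_mul, one_mul, coeff_sew q m ev hh]
          refine Finset.sum_congr rfl fun c _ => ?_
          rw [slice_act_left]
          congr 4
          ring
        -- Multiplication by `w' = -q σ⁻¹` shifts `c` by one: the new term `c = 0` vanishes because
        -- its index is `t = 0`, and the term lost at the top carries `q^{m+1} = 0`.
        · rw [Matrix.cons_val_one, Matrix.cons_val_zero, HahnSeries.coeff_single_mul,
            coeff_sew q m ev hh, sewCoeff, sewCoeff, Finset.sum_range_succ', Finset.sum_range_succ,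
            mul_add, Finset.mul_sum, ← mul_assoc, ← pow_succ', neg_pow q (m + 1), hq, mul_zero, zero_mul,
            slice_act_right, hh.2.2 _ _ (by simp), map_zero, map_zero, mul_zero]
          congr 1
          refine Finset.sum_congr rfl fun c _ => ?_
          have e1 : p + ((c + 1 : ℕ) : ℤ) - 1 = p - -1 + c - 1 := by
            push_cast
            ring
          have e2 : -((c + 1 : ℕ) : ℤ) - 1 + 1 = -(c : ℤ) - 1 := by
            push_cast
            ring
          rw [slice_act_right, pow_succ', mul_assoc, e1, e2]
    · rw [pow_add, act_mul, hP, act_mul]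
    · rw [add_comm M, pow_add, act_mul, hfg, act_mul]
  have hone : sew q m ev one = 1 := by
    ext p
    rw [coeff_sew q m ev (one_mem_sewable D), sewCoeff, Finset.sum_range_succ', slice_one,
      HahnSeries.coeff_one, Finset.sum_eq_zero fun c _ => ?_, zero_add, pow_zero, one_mul]
    · by_cases hp : p = 0
      · subst hp
        rw [if_pos (by simp), if_pos rfl, hev _ one_mem_rational, ratValue_one hD hy, map_one]
      · rw [if_neg (by push_cast; omega), if_neg hp, map_zero, map_zero]
    · rw [slice_one, if_neg (by push_cast; omega), map_zero, map_zero, mul_zero]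
  rw [key, hone, mul_one]

end Sew

end FormalSeries

/-! ### Moving one handle insertion to the left end -/

namespace VOA

open FormalSeries

variable {V : Type*} [AddCommGroup V] [Module ℂ V] {A : VOA V}

theorem prodModes_append {n : ℕ} (v : Fin n → V) (x x' : V) (k : Fin (n + 2) → ℤ) :
    A.prodModes (Fin.append v ![x, x']) k = A.prodModes v (fun i => k (Fin.castAdd 2 i)) *
      (A.mode x (k (Fin.natAdd n 0)) * A.mode x' (k (Fin.natAdd n 1))) := by
  rw [prodModes, List.ofFn_add, List.prod_append]
  simp [prodModes, List.ofFn_succ, Fin.append_right]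
  rfl

theorem prod_sub_dvd_diagonals (n : ℕ) :
    (∏ j : Fin n, (MvPolynomial.X (Fin.natAdd n 0) - MvPolynomial.X (Fin.castAdd 2 j))) ∣
      diagonals (n + 2) := by
  rw [diagonals, Fin.prod_univ_add]
  refine Dvd.dvd.mul_right (Finset.prod_dvd_prod_of_dvd _ _ fun j _ => ?_) _
  rw [← neg_sub, neg_dvd]
  refine Finset.dvd_prod_of_mem (fun i => MvPolynomial.X (Fin.castAdd 2 j) - MvPolynomial.X i)
    (Finset.mem_Ioi.2 ?_)
  rw [Fin.lt_def]
  simp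

/-- The position of a vertex operator in a correlation function does not matter for the rational
function it defines. -/
theorem exists_act_insertion {n : ℕ} (v : Fin n → V) (x x' : V) (ℓ : Module.Dual ℂ V) : ∃ M : ℕ,
    act (diagonals (n + 2) ^ M) (fun k : Fin (n + 2) → ℤ =>
      ℓ (A.mode x (k (Fin.natAdd n 0)) (A.prodModes v (fun i => k (Fin.castAdd 2 i))
        (A.mode x' (k (Fin.natAdd n 1)) A.vac)))) =
    act (diagonals (n + 2) ^ M)
      (fun k => ℓ (A.prodModes (Fin.append v ![x, x']) k A.vac)) := by
  obtain ⟨M, hM⟩ := exists_act_commutator (A := A) x v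
  refine ⟨M, ?_⟩
  have hne : ∀ i : Fin n, Fin.castAdd 2 i ≠ Fin.natAdd n 0 := fun i h => by
    have := congrArg Fin.val h
    simp at this
    omega
  have hne' : ∀ i : Fin n, Fin.natAdd n 1 ≠ Fin.castAdd 2 i := fun i h => by
    have := congrArg Fin.val h
    simp at this
    omega
  set ι : Fin (n + 1) → Fin (n + 2) := Fin.cons (Fin.natAdd n 0) (Fin.castAdd 2) with hι
  have hinj : Function.Injective ι := by
    refine Fin.cons_injective_iff.2 ⟨?_, Fin.castAdd_injective n 2⟩
    rintro ⟨i, hi⟩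
    exact hne i hi
  have e := act_rename ι hinj (fun k => ℓ ∘ₗ LinearMap.applyₗ (R := ℂ)
      (A.mode x' (k (Fin.natAdd n 1)) A.vac)) (fun k i => ?_)
    ((∏ j : Fin n, (MvPolynomial.X 0 - MvPolynomial.X j.succ)) ^ M)
    (fun k : Fin (n + 1) → ℤ => ⁅A.mode x (k 0), A.prodModes v (k ∘ Fin.succ)⁆)
  · have hp : MvPolynomial.rename ι
        ((∏ j : Fin n, (MvPolynomial.X 0 - MvPolynomial.X j.succ)) ^ M) =
        (∏ j : Fin n, (MvPolynomial.X (Fin.natAdd n 0) - MvPolynomial.X (Fin.castAdd 2 j)) :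
          MvPolynomial _ ℂ) ^ M := by
      simp only [map_pow, map_prod, map_sub, MvPolynomial.rename_X, hι, Fin.cons_zero, Fin.cons_succ]
    rw [hM, hp] at e
    simp only [Pi.zero_apply, map_zero] at e
    rw [← Pi.zero_def] at e
    rw [← sub_eq_zero, ← map_sub]
    refine (congrArg _ ?_).trans (act_eq_zero_of_dvd (pow_dvd_pow_of_dvd (prod_sub_dvd_diagonals n) M) e)
    funext k
    rw [Pi.sub_apply, prodModes_append, ← map_sub]
    rfl
  · congr 3
    rw [Pi.add_apply, Pi.single_eq_of_ne, add_zero]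
    refine Fin.cases ?_ (fun i => ?_) i
    · intro h
      have := congrArg Fin.val h
      simp [hι] at this
    · exact hne' i

end VOA

namespace VOA

open FormalSeries

variable {V : Type*} [AddCommGroup V] [Module ℂ V] {A : VOA V}

/-! ### Sewing -/

variable (A) in
/-- The series of `⟨𝟙, Y(x,w) Y(v_1,x_1) ⋯ Y(v_n,x_n) Y(x',w') 𝟙⟩`. -/
def insertion (B : LinearMap.BilinForm ℂ V) {n : ℕ} (v : Fin n → V) (x x' : V)
    (k : Fin (n + 2) → ℤ) : ℂ :=
  B A.vac (A.mode x (k (Fin.natAdd n 0)) (A.prodModes v (fun i => k (Fin.castAdd 2 i))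
    (A.mode x' (k (Fin.natAdd n 1)) A.vac)))

theorem slice_insertion (B : LinearMap.BilinForm ℂ V) {n : ℕ} (v : Fin n → V) (x x' : V) (s t : ℤ)
    (κ : Fin n → ℤ) : slice (A.insertion B v x x') s t κ =
      B A.vac (A.mode x s (A.prodModes v κ (A.mode x' t A.vac))) := by
  simp [slice, insertion, Fin.append_right]

section

variable {B : LinearMap.BilinForm ℂ V} {n : ℕ} {wt : Fin n → ℕ} {v : Fin n → V}

theorem IsLiZ.insertion_mem_sewable (hB : A.IsLiZ B) (hv : ∀ i, v i ∈ A.wtSpace (wt i)) {N : ℕ}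
    {x : V} (hx : x ∈ A.wtSpace N) (x' : V) :
    A.insertion B v x x' ∈ sewable (axes n * diagonals n) := by
  refine ⟨fun s t => ?_, ⟨(N : ℤ) - 1, fun s t hs => funext fun κ => ?_⟩,
    fun s t ht => funext fun κ => ?_⟩
  · rw [funext (slice_insertion (A := A) B v x x' s t)]
    exact prodModes_mem_rational hv (comp_mode_mem hx s hB.vac_mem_restrictedDual) _
  -- With `μ = s - 2N + 1` and `s < N - 1`, every `μ + i` with `i ≤ N` is negative.
  · rw [slice_insertion, show s = 2 * N + (s - 2 * N + 1) - 1 by ring, hB.vac_mode le_rfl hx,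
      Finset.sum_eq_zero, mul_zero, Pi.zero_apply]
    intro i hi
    rw [if_neg, mul_zero]
    have := Finset.mem_range.1 hi
    omega
  · rw [slice_insertion, mode_vac_nonneg _ ht, map_zero, map_zero, map_zero, Pi.zero_apply]

theorem IsLiZ.genusZeroSeries_mem_rational (hB : A.IsLiZ B) (hv : ∀ i, v i ∈ A.wtSpace (wt i))
    {k l : ℕ} {x x' : V} (hx : x ∈ A.wtSpace k) (hx' : x' ∈ A.wtSpace l) :
    A.genusZeroSeries B (Fin.append v ![x, x']) ∈ rational (diagonals (n + 2)) := by
  refine prodModes_vac_mem_rational (wt := Fin.append wt ![k, l]) (fun j => ?_)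
    hB.vac_mem_restrictedDual
  refine Fin.addCases (fun j => ?_) (fun j => ?_) j
  · simpa using hv j
  · fin_cases j
    · simpa [Fin.append_right] using hx
    · simpa [Fin.append_right] using hx'

variable (A) in
/-- The contribution of `L(-1)^d L(1)^{p+d}` to the coefficient of `σ^p`. -/
def handleSeries (v : Fin n → V) (p : ℤ) (M d : ℕ) : (Fin n → ℤ) → ℂ :=
  if 0 ≤ p + d then (((p + d).toNat.factorial : ℂ)⁻¹) •
    fun κ => A.tr M (A.L (-1) ^ d * (A.L 1 ^ (p + d).toNat * A.prodModes v κ)) else 0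

theorem handleSeries_eq_zero (p : ℤ) {M d : ℕ} (h : M < d) : A.handleSeries v p M d = 0 := by
  rw [handleSeries]
  split_ifs
  · funext κ
    simp [tr_L_neg_one_pow_mul h]
  · rfl

/-- The index is `IsLiZ.vac_mode` with `μ = p + c`, the `2k` coming from `ρ^k`. The second insertion
produces `L(-1)^c / c!`, the dual bases a trace over `V_k`; cyclicity moves `L(-1)^c` to the left,
raising the weight to `k + c` and joining the adjoint `L(-1)^j` of `L(1)^j`. -/
theorem IsLiZ.sum_slice_insertion (hB : A.IsLiZ B) {ι : Type*} [Fintype ι] [DecidableEq ι] {k : ℕ}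
    (b b' : Module.Basis ι ℂ (A.wtSpace k))
    (hb : ∀ i j, B (b i : V) (b' j : V) = if i = j then 1 else 0) {m : ℕ} (hkm : k ≤ m) (p : ℤ)
    (c : ℕ) : ∑ i, slice (A.insertion B v (b i) (b' i)) (2 * k + (p + c) - 1) (-(c : ℤ) - 1) =
      (-1 : ℂ) ^ k • ∑ j ∈ Finset.range (m + 1), ((c.factorial : ℂ)⁻¹ * (j.factorial : ℂ)⁻¹) •
        A.handleSeries v p (k + c) (c + j) := by
  funext κ
  simp only [Finset.sum_apply, Pi.smul_apply, slice_insertion, mode_vac_succ]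
  rw [Finset.sum_congr rfl fun i _ => hB.vac_mode hkm (b i).2 (p + c) _, ← Finset.mul_sum,
    Finset.sum_comm, smul_eq_mul]
  congr 1
  refine Finset.sum_congr rfl fun j _ => ?_
  rw [handleSeries, ← Finset.mul_sum]
  have e : p + c + j = p + (c + j : ℕ) := by push_cast; ring
  rw [e]
  by_cases h : 0 ≤ p + (c + j : ℕ)
  · simp only [if_pos h]
    have h1 := hB.sum_dual b b' hb (A.L (-1) ^ j *
      (A.L 1 ^ (p + (c + j : ℕ)).toNat * A.prodModes v κ) * A.L (-1) ^ c)
    rw [tr_mul_L_neg_one_pow, ← mul_assoc (A.L (-1) ^ c), ← pow_add] at h1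
    rw [Pi.smul_apply, ← h1]
    simp only [map_smul, smul_eq_mul, hB.L_one_pow_left, Module.End.mul_apply, Finset.mul_sum]
    refine Finset.sum_congr rfl fun i _ => ?_
    ring
  · simp only [if_neg h]
    simp

section Functional

variable {Q : Type*} [CommRing Q] [Algebra ℂ Q] {q : Q} {m : ℕ} {ev : ((Fin n → ℤ) → ℂ) →ₗ[ℂ] ℂ}

/-- Group the terms by the weight `M = k + c`. The signs `(-1)^k` of `ρ^k` and of the form cancel,
while `w' = -q σ⁻¹` leaves `(-1)^c / (c! j!)` in front of a quantity depending only on `M` and `c +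
j`. By `sum_alternating` only `c = j = 0` survives. -/
theorem IsLiZ.coeff_sum_genusZero (hB : A.IsLiZ B) {ι : ℕ → Type*} [∀ k, Fintype (ι k)]
    [∀ k, DecidableEq (ι k)] (b b' : ∀ k, Module.Basis (ι k) ℂ (A.wtSpace k))
    (hb : ∀ k i j, B (b k i : V) (b' k j : V) = if i = j then 1 else 0)
    (hv : ∀ i, v i ∈ A.wtSpace (wt i)) (hq : q ^ (m + 1) = 0) {y : Fin n → ℂ}
    (hy : IsUnit (MvPolynomial.aeval y (axes n * diagonals n)))
    (hev : ∀ f ∈ rational (axes n * diagonals n), ev f = ratValue f (axes n * diagonals n) y)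
    (hu : IsUnit (MvPolynomial.aeval (sewPoint q y) (diagonals (n + 2)))) (p : ℤ) :
    (∑ k ∈ Finset.range (m + 1), (HahnSeries.single (-2) (-q) : LaurentSeries Q) ^ k *
      ∑ i, A.genusZero B (Fin.append v ![(b k i : V), (b' k i : V)]) (sewPoint q y)).coeff p =
    ∑ M ∈ Finset.range (m + 1), q ^ M * algebraMap ℂ Q (ev (A.handleSeries v p M 0)) := by
  have hD := (divisors n).mul_mem (axes_mem_divisors n) (diagonals_mem_divisors n)
  have h0 : ∀ k i, A.genusZero B (Fin.append v ![(b k i : V), (b' k i : V)]) (sewPoint q y) =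
      sew q m ev (A.insertion B v (b k i) (b' k i)) := fun k i => by
    obtain ⟨M, hM⟩ := exists_act_insertion (A := A) v (b k i : V) (b' k i) (B A.vac)
    refine (sew_eq_ratValue hq hD hy hev hu ?_ (hB.insertion_mem_sewable hv (b k i).2 _) hM).symm
    exact hB.genusZeroSeries_mem_rational hv (b k i).2 (b' k i).2
  have h1 : ∀ k ∈ Finset.range (m + 1), ((HahnSeries.single (-2) (-q) : LaurentSeries Q) ^ k *
      ∑ i, A.genusZero B (Fin.append v ![(b k i : V), (b' k i : V)]) (sewPoint q y)).coeff p =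
      ∑ c ∈ Finset.range (m + 1), q ^ (c + k) * algebraMap ℂ Q (ev (∑ j ∈ Finset.range (m + 1),
        ((-1 : ℂ) ^ c * (c.factorial : ℂ)⁻¹ * (j.factorial : ℂ)⁻¹) •
          A.handleSeries v p (c + k) (c + j))) := fun k hk => by
    rw [HahnSeries.single_pow, HahnSeries.coeff_single_mul, HahnSeries.coeff_sum,
      Finset.sum_congr rfl fun i _ => by rw [h0, coeff_sew q m ev
        (hB.insertion_mem_sewable hv (b k i).2 _), sewCoeff], Finset.sum_comm, Finset.mul_sum]
    refine Finset.sum_congr rfl fun c _ => ?_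
    have e : p - k • (-2 : ℤ) + c - 1 = 2 * k + (p + c) - 1 := by
      rw [nsmul_eq_mul]
      ring
    rw [← Finset.mul_sum, ← map_sum, ← map_sum, e, hB.sum_slice_insertion (b k) (b' k) (hb k)
      (Nat.lt_succ_iff.1 (Finset.mem_range.1 hk)), map_smul, smul_eq_mul, map_mul, map_pow, map_neg,
      map_one, add_comm k c]
    simp only [mul_assoc, mul_smul ((-1 : ℂ) ^ c), ← Finset.smul_sum]
    rw [map_smul, smul_eq_mul, map_mul, map_pow, map_neg, map_one, pow_add, neg_pow q k, neg_pow q c]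
    have h2 : ((-1 : Q) ^ k) * (-1) ^ k = 1 := by rw [← mul_pow]; simp
    linear_combination (q ^ k * (-1) ^ c * q ^ c * algebraMap ℂ Q (ev (∑ j ∈ Finset.range (m + 1),
      ((c.factorial : ℂ)⁻¹ * (j.factorial : ℂ)⁻¹) • A.handleSeries v p (c + k) (c + j)))) * h2
  rw [HahnSeries.coeff_sum, Finset.sum_congr rfl h1, Finset.sum_comm,
    sum_range_sum_range (M := m) (Nat.lt_succ_self m) (Nat.lt_succ_self m) fun c k h => by
      rw [pow_eq_zero_of_le h hq, zero_mul]]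
  refine Finset.sum_congr rfl fun M hM => ?_
  have hM := Finset.mem_range.1 hM
  rw [Finset.sum_congr rfl fun x hx => by rw [Finset.HasAntidiagonal.mem_antidiagonal.1 hx],
    ← Finset.mul_sum, ← map_sum, ← map_sum,
    Finset.Nat.sum_antidiagonal_eq_sum_range_succ_mk]
  congr 3
  exact sum_alternating (Nat.lt_succ_self M) hM fun d hd => handleSeries_eq_zero p hd

variable (A q m ev) in
/-- The truncated graded trace, composed with a functional on series. -/
def gradedTrace : ((Fin n → ℤ) → Module.End ℂ V) → Q := fun X =>
  ∑ M ∈ Finset.range (m + 1), q ^ M * algebraMap ℂ Q (ev fun κ => A.tr M (X κ))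

/-- Cyclicity, with `L(1)` lowering the weight by one. The bottom term vanishes since `L(1)` kills
`V_0`, the top one since `q^{m+1} = 0`. -/
theorem gradedTrace_mul_L_one (hq : q ^ (m + 1) = 0) (X : (Fin n → ℤ) → Module.End ℂ V) :
    A.gradedTrace q m ev (fun κ => X κ * A.L 1) = q * A.gradedTrace q m ev fun κ => A.L 1 * X κ := by
  rw [gradedTrace, gradedTrace, Finset.sum_range_succ', Finset.sum_range_succ, mul_add, ← mul_assoc q,
    ← pow_succ', hq, zero_mul, add_zero, Finset.mul_sum]
  simp only [tr_zero_mul_L_one, tr_mul_L_one]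
  rw [← Pi.zero_def, map_zero, map_zero, mul_zero, add_zero]
  refine Finset.sum_congr rfl fun M _ => ?_
  rw [pow_succ', mul_assoc]

/-- By `gradedTrace_mul_L_one` the graded trace of `[L(1), X]` is `1 - q` times that of `L(1) X`;
this is iterated. -/
theorem gradedTrace_L_one_pow_mul (hq : q ^ (m + 1) = 0) (P : ℕ)
    (X : (Fin n → ℤ) → Module.End ℂ V) :
    (1 - q) ^ P * A.gradedTrace q m ev (fun κ => A.L 1 ^ P * X κ) =
      A.gradedTrace q m ev fun κ => (bracketLeft (A.L 1) ^ P) (X κ) := by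
  induction P generalizing X with
  | zero => simp
  | succ P ih =>
    have h := gradedTrace_mul_L_one (A := A) (ev := ev) hq fun κ => A.L 1 ^ P * X κ
    have e : (fun κ => A.L 1 ^ P * bracketLeft (A.L 1) (X κ)) = fun κ =>
        A.L 1 ^ (P + 1) * X κ - A.L 1 ^ P * X κ * A.L 1 := by
      funext κ
      rw [bracketLeft_apply, Ring.lie_def, pow_succ]
      noncomm_ring
    have hsub : A.gradedTrace q m ev (fun κ => A.L 1 ^ (P + 1) * X κ - A.L 1 ^ P * X κ * A.L 1) =
        A.gradedTrace q m ev (fun κ => A.L 1 ^ (P + 1) * X κ) -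
        A.gradedTrace q m ev (fun κ => A.L 1 ^ P * X κ * A.L 1) := by
      rw [gradedTrace, gradedTrace, gradedTrace, ← Finset.sum_sub_distrib]
      refine Finset.sum_congr rfl fun M _ => ?_
      rw [← mul_sub, ← map_sub, ← map_sub]
      exact congrArg (fun f => q ^ M * algebraMap ℂ Q (ev f)) (funext fun κ => map_sub _ _ _)
    have h1 := ih fun κ => bracketLeft (A.L 1) (X κ)
    simp only [pow_succ (bracketLeft (A.L 1)), Module.End.mul_apply]
    rw [← h1, e, hsub, h, pow_succ (1 - q)]
    simp only [← mul_assoc, ← pow_succ']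
    ring

end Functional

end

end VOA

/-! ### Specialising the formal variable `σ` -/

namespace FormalSeries

open VOA

universe u

variable {Q : Type u} [CommRing Q] [Algebra ℂ Q]

/-- The substitution `s = r σ` from power series in `s` to Laurent series in `σ`. -/
def scaleHom (r : Q) : ℂ⟦X⟧ →ₐ[ℂ] LaurentSeries Q where
  toRingHom := (HahnSeries.ofPowerSeries ℤ Q).comp
    ((PowerSeries.rescale r).comp (PowerSeries.map (algebraMap ℂ Q)))
  commutes' c := by
    rw [HahnSeries.algebraMap_apply', PowerSeries.algebraMap_apply, PowerSeries.algebraMap_apply]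
    change HahnSeries.ofPowerSeries ℤ Q (PowerSeries.rescale r (PowerSeries.map (algebraMap ℂ Q)
      (PowerSeries.C (algebraMap ℂ ℂ c)))) = _
    congr 1
    ext j
    rw [PowerSeries.coeff_rescale, PowerSeries.coeff_map, PowerSeries.coeff_C, PowerSeries.coeff_C]
    by_cases hj : j = 0
    · subst hj; simp
    · simp [hj]

theorem coeff_scaleHom (r : Q) (f : ℂ⟦X⟧) (p : ℤ) : (scaleHom r f).coeff p =
    if p < 0 then 0 else r ^ p.natAbs * algebraMap ℂ Q (PowerSeries.coeff p.natAbs f) := by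
  have := PowerSeries.coeff_coe (PowerSeries.rescale r (PowerSeries.map (algebraMap ℂ Q) f)) p
  rw [PowerSeries.coeff_rescale, PowerSeries.coeff_map] at this
  exact this

theorem scaleHom_C (r : Q) (c : ℂ) : scaleHom r (PowerSeries.C c) = algebraMap ℂ _ c :=
  (scaleHom r).commutes c

theorem scaleHom_X (r : Q) : scaleHom r PowerSeries.X = HahnSeries.single 1 r := by
  change HahnSeries.ofPowerSeries ℤ Q (PowerSeries.rescale r (PowerSeries.map (algebraMap ℂ Q)
      PowerSeries.X)) = _
  rw [PowerSeries.map_X, PowerSeries.rescale_X, map_mul, HahnSeries.ofPowerSeries_C,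
    HahnSeries.ofPowerSeries_X, HahnSeries.C_mul_eq_smul]
  ext j
  simp [HahnSeries.coeff_single]

/-- Identities between rational functions in `σ` over `Q` can be specialised from Laurent series
to `σ = σ₀`. -/
theorem exists_transfer (q σ₀ : Q) : ∃ (T : Type u) (_ : CommRing T) (_ : Algebra ℂ T)
    (α : T →ₐ[ℂ] LaurentSeries Q) (β : T →ₐ[ℂ] Q) (σ q' : T), Function.Injective α ∧
      α σ = HahnSeries.single 1 1 ∧ α q' = HahnSeries.C q ∧ β σ = σ₀ ∧ β q' = q ∧
      ∀ z, IsUnit (α z) → IsUnit (β z) → IsUnit z := by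
  let φ : Polynomial Q →ₐ[ℂ] LaurentSeries Q :=
    { toRingHom := (HahnSeries.ofPowerSeries ℤ Q).comp Polynomial.coeToPowerSeries.ringHom
      commutes' := fun c => by
        rw [HahnSeries.algebraMap_apply', PowerSeries.algebraMap_apply, Polynomial.algebraMap_apply]
        simp }
  have hφ : Function.Injective φ :=
    HahnSeries.ofPowerSeries_injective.comp (Polynomial.coe_injective Q)
  have hφX : φ Polynomial.X = HahnSeries.single 1 1 := by
    change HahnSeries.ofPowerSeries ℤ Q (Polynomial.X : Polynomial Q) = _
    rw [Polynomial.coe_X, HahnSeries.ofPowerSeries_X]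
  have hφC : φ (Polynomial.C q) = HahnSeries.C q := by
    change HahnSeries.ofPowerSeries ℤ Q (Polynomial.C q : Polynomial Q) = _
    rw [Polynomial.coe_C, HahnSeries.ofPowerSeries_C]
  let ψ : Polynomial Q →ₐ[ℂ] Q := (Polynomial.aeval σ₀).restrictScalars ℂ
  -- Only polynomials that become units under both maps are inverted. So both maps extend to the
  -- localisation, and injectivity of `φ` passes to `α`.
  let S : Submonoid (Polynomial Q) :=
    (IsUnit.submonoid (LaurentSeries Q)).comap φ ⊓ (IsUnit.submonoid Q).comap ψ
  let α : Localization S →ₐ[ℂ] LaurentSeries Q :=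
    IsLocalization.liftAlgHom (M := S) (f := φ) fun y => y.2.1
  let β : Localization S →ₐ[ℂ] Q := IsLocalization.liftAlgHom (M := S) (f := ψ) fun y => y.2.2
  have hα : ∀ p, α (algebraMap _ _ p) = φ p := fun p => IsLocalization.lift_eq _ p
  have hβ : ∀ p, β (algebraMap _ _ p) = ψ p := fun p => IsLocalization.lift_eq _ p
  refine ⟨Localization S, inferInstance, inferInstance, α, β,
    algebraMap (Polynomial Q) (Localization S) Polynomial.X,
    algebraMap (Polynomial Q) (Localization S) (Polynomial.C q), ?_, by rw [hα, hφX], by rw [hα, hφC], ?_, ?_, ?_⟩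
  · rw [injective_iff_map_eq_zero]
    intro z hz
    obtain ⟨p, s, rfl⟩ := IsLocalization.exists_mk'_eq S z
    have h1 : α (IsLocalization.mk' (Localization S) p s * algebraMap _ _ (s : Polynomial Q)) = 0 := by
      rw [map_mul, hz, zero_mul]
    rw [IsLocalization.mk'_spec, hα, map_eq_zero_iff φ hφ] at h1
    rw [h1, IsLocalization.mk'_zero]
  · rw [hβ]
    exact Polynomial.aeval_X σ₀
  · rw [hβ]
    exact Polynomial.aeval_C σ₀ q
  · intro z h1 h2
    obtain ⟨p, s, rfl⟩ := IsLocalization.exists_mk'_eq S z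
    have e := IsLocalization.mk'_spec (Localization S) p s
    have hs : IsUnit (algebraMap (Polynomial Q) (Localization S) s) := IsLocalization.map_units _ s
    have hp : IsUnit (algebraMap (Polynomial Q) (Localization S) p) := by
      refine IsLocalization.map_units _ (⟨p, ?_, ?_⟩ : S)
      · change IsUnit (φ p)
        rw [← hα, ← e, map_mul]
        exact h1.mul (hs.map α)
      · change IsUnit (ψ p)
        rw [← hβ, ← e, map_mul]
        exact h2.mul (hs.map β)
    rw [← e] at hp
    exact isUnit_of_mul_isUnit_left hp

theorem isUnit_aeval_diagonals {N : ℕ} {a : Fin N → Q} (h : ∀ i j, i < j → IsUnit (a i - a j)) :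
    IsUnit (MvPolynomial.aeval a (diagonals N)) := by
  simp only [diagonals, map_prod, map_sub, MvPolynomial.aeval_X]
  exact IsUnit.prod_univ_iff.2 fun i => IsUnit.prod_iff.2 fun j hj => h i j (Finset.mem_Ioi.1 hj)

theorem isUnit_aeval_axes {N : ℕ} {a : Fin N → Q} (h : ∀ i, IsUnit (a i)) :
    IsUnit (MvPolynomial.aeval a (axes N)) := by
  simp only [axes, map_prod, MvPolynomial.aeval_X]
  exact IsUnit.prod_univ_iff.2 h

end FormalSeries

/-! ### The sewing formula for nilpotent `q` -/

namespace VOA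

open FormalSeries

variable {V : Type*} [AddCommGroup V] [Module ℂ V] {A : VOA V}
variable {B : LinearMap.BilinForm ℂ V} {n : ℕ} {wt : Fin n → ℕ} {v : Fin n → V}
variable {Q : Type*} [CommRing Q] [Algebra ℂ Q] {q : Q} {m : ℕ}

/-- The sewing formula over Laurent series in `σ = w⁻¹`. -/
theorem IsLiZ.sum_genusZero_sewPoint (hB : A.IsLiZ B) {ι : ℕ → Type*} [∀ k, Fintype (ι k)]
    [∀ k, DecidableEq (ι k)] (b b' : ∀ k, Module.Basis (ι k) ℂ (A.wtSpace k))
    (hb : ∀ k i j, B (b k i : V) (b' k j : V) = if i = j then 1 else 0)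
    (hv : ∀ i, A.IsQuasiprimary (wt i) (v i)) (hq : q ^ (m + 1) = 0) {r : Q} (hr : r * (1 - q) = 1)
    {y : Fin n → ℂ} (hy : IsUnit (MvPolynomial.aeval y (axes n * diagonals n)))
    (hu : IsUnit (MvPolynomial.aeval (sewPoint q y) (diagonals (n + 2)))) :
    (∑ k ∈ Finset.range (m + 1), (HahnSeries.single (-2) (-q) : LaurentSeries Q) ^ k *
      ∑ i, A.genusZero B (Fin.append v ![(b k i : V), (b' k i : V)]) (sewPoint q y)) *
      scaleHom r (∏ i, (1 - PowerSeries.C (y i) * PowerSeries.X) ^ (2 * wt i)) =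
    ∑ M ∈ Finset.range (m + 1), HahnSeries.C q ^ M *
      ratValue (fun κ => A.tr M (A.prodModes v κ)) (axes n * diagonals n)
        fun i => scaleHom r (specialPoint (y i)) := by
  have hD := (divisors n).mul_mem (axes_mem_divisors n) (diagonals_mem_divisors n)
  obtain ⟨ev, hev⟩ := exists_extend_ratValue hD hy
  have ht := fun M => tr_prodModes_mem_rational (A := A) (fun i => (hv i).1) M
  have key : ∑ k ∈ Finset.range (m + 1), (HahnSeries.single (-2) (-q) : LaurentSeries Q) ^ k *
      ∑ i, A.genusZero B (Fin.append v ![(b k i : V), (b' k i : V)]) (sewPoint q y) =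
      ∑ M ∈ Finset.range (m + 1), HahnSeries.C q ^ M *
        scaleHom r (taylor wt (axes n * diagonals n) y fun κ => A.tr M (A.prodModes v κ)) := by
    ext p
    rw [hB.coeff_sum_genusZero b b' hb (fun i => (hv i).1) hq hy hev hu, HahnSeries.coeff_sum]
    simp only [← map_pow, HahnSeries.C_mul_eq_smul, HahnSeries.coeff_smul, smul_eq_mul,
      coeff_scaleHom, handleSeries, Nat.cast_zero, add_zero, pow_zero, one_mul]
    by_cases hp : p < 0
    · simp [hp, not_le.2 hp]
    obtain ⟨P, rfl⟩ : ∃ P : ℕ, p = P := ⟨p.toNat, by omega⟩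
    simp only [if_neg hp, if_pos (not_lt.1 hp), Int.toNat_natCast, Int.natAbs_natCast, taylor,
      PowerSeries.coeff_mk, map_smul, smul_eq_mul, map_mul]
    have h1 := gradedTrace_L_one_pow_mul (A := A) (ev := ev) hq P fun κ => A.prodModes v κ
    -- Replacing `L(1)` by `ad L(1)` costs `(1-q)^{-P} = r^P`, which is absorbed in the Taylor
    -- parameter `s = r σ`.
    have h2 : A.gradedTrace q m ev (fun κ => A.L 1 ^ P * A.prodModes v κ) =
        r ^ P * A.gradedTrace q m ev (fun κ => (bracketLeft (A.L 1) ^ P) (A.prodModes v κ)) := by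
      rw [← h1, ← mul_assoc, ← mul_pow, hr, one_pow, one_mul]
    simp only [gradedTrace, apply_ad_pow_prodModes hv,
      hev _ (special_pow_mem_rational wt (ht _) P)] at h2
    simp only [mul_left_comm _ (algebraMap ℂ Q (P.factorial : ℂ)⁻¹), ← Finset.mul_sum]
    rw [h2, Finset.mul_sum, Finset.mul_sum, Finset.mul_sum]
    refine Finset.sum_congr rfl fun M _ => ?_
    ring
  rw [key, Finset.sum_mul]
  refine Finset.sum_congr rfl fun M _ => ?_
  rw [mul_assoc, ← map_mul, taylor_mul_prod hD hy wt (ht M),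
    map_ratValue hD (isUnit_aeval_specialPoint hy) _ (ht M)]

end VOA

namespace VOA

open FormalSeries

universe u

variable {V : Type*} [AddCommGroup V] [Module ℂ V] {A : VOA V}
variable {B : LinearMap.BilinForm ℂ V} {n : ℕ} {wt : Fin n → ℕ} {v : Fin n → V}
variable {Q : Type u} [CommRing Q] [Algebra ℂ Q] {q : Q} {m : ℕ}

theorem isUnit_algebraMap (S : Type*) [CommRing S] [Algebra ℂ S] {c : ℂ} (hc : c ≠ 0) :
    IsUnit (algebraMap ℂ S c) := (IsUnit.mk0 c hc).map _

theorem isUnit_add_of_isNilpotent {S : Type*} [CommRing S] {u r : S} (hu : IsUnit u)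
    (hr : IsNilpotent r) : IsUnit (u + r) :=
  hr.isUnit_add_left_of_commute hu (Commute.all _ _)

theorem isUnit_aeval_append {S : Type*} [CommRing S] [Algebra ℂ S] {y : Fin n → ℂ}
    (hy : Function.Injective y) {w w' : S} (h : ∀ i, IsUnit (algebraMap ℂ S (y i) - w))
    (h' : ∀ i, IsUnit (algebraMap ℂ S (y i) - w')) (hw : IsUnit (w - w')) :
    IsUnit (MvPolynomial.aeval (Fin.append (fun i => algebraMap ℂ S (y i)) ![w, w'])
      (diagonals (n + 2))) := by
  refine isUnit_aeval_diagonals fun i j => ?_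
  refine Fin.addCases (fun i => ?_) (fun i => ?_) i <;>
    refine Fin.addCases (fun j => ?_) (fun j => ?_) j <;> intro hij
  · rw [Fin.append_left, Fin.append_left, ← map_sub]
    refine isUnit_algebraMap S (sub_ne_zero.2 fun e => ?_)
    rw [hy e] at hij
    exact lt_irrefl _ hij
  · rw [Fin.append_left, Fin.append_right]
    fin_cases j
    · exact h i
    · exact h' i
  · rw [Fin.lt_def] at hij
    simp at hij
    omega
  · rw [Fin.append_right, Fin.append_right]
    have hij' : i < j := by
      rw [Fin.lt_def] at hij ⊢
      simpa using hij
    fin_cases i <;> fin_cases j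
    · exact absurd hij' (lt_irrefl _)
    · exact hw
    · exact absurd hij' (by simp)
    · exact absurd hij' (lt_irrefl _)

/-- The sewing formula modulo `q ^ (m + 1)`, with the handle attached at `0` and `a`. -/
theorem IsLiZ.sum_genusZero_mul_prod (hB : A.IsLiZ B) {ι : ℕ → Type*} [∀ k, Fintype (ι k)]
    [∀ k, DecidableEq (ι k)] (b b' : ∀ k, Module.Basis (ι k) ℂ (A.wtSpace k))
    (hb : ∀ k i j, B (b k i : V) (b' k j : V) = if i = j then 1 else 0)
    (hv : ∀ i, A.IsQuasiprimary (wt i) (v i)) (hq : q ^ (m + 1) = 0) {y : Fin n → ℂ}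
    (hy : Function.Injective y) (hy0 : ∀ i, y i ≠ 0) {a : ℂ} (ha : a ≠ 0) (hya : ∀ i, y i ≠ a)
    {w : Q} (hw : (1 - q) * w = algebraMap ℂ Q a) :
    (∑ k ∈ Finset.range (m + 1), (-(q * w ^ 2)) ^ k *
      ∑ i, A.genusZero B (Fin.append v ![(b k i : V), (b' k i : V)])
        (Fin.append (fun i => algebraMap ℂ Q (y i)) ![w, -(q * w)])) *
      ∏ i, (1 - algebraMap ℂ Q (y i / a)) ^ (2 * wt i) =
    ∑ M ∈ Finset.range (m + 1), q ^ M *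
      ratValue (fun κ => A.tr M (A.prodModes v κ)) (axes n * diagonals n)
        fun i => algebraMap ℂ Q (y i / (1 - y i / a)) := by
  have hqn : IsNilpotent q := ⟨m + 1, hq⟩
  have hqC : IsNilpotent (HahnSeries.C q : LaurentSeries Q) := hqn.map _
  have hq1 : IsUnit (1 - q) := hqn.isUnit_one_sub
  have hya1 : ∀ i, 1 - y i / a ≠ 0 := fun i h => hya i (by
    rw [sub_eq_zero, eq_div_iff ha, one_mul] at h
    exact h.symm)
  have hdiv : ∀ c : ℂ, algebraMap ℂ Q (c / a) = algebraMap ℂ Q c * algebraMap ℂ Q a⁻¹ := fun c => by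
    rw [← map_mul, div_eq_mul_inv]
  have haa : algebraMap ℂ Q a * algebraMap ℂ Q a⁻¹ = 1 := by
    rw [← map_mul, mul_inv_cancel₀ ha, map_one]
  obtain ⟨r, hr⟩ := hq1.exists_right_inv
  have hr' : r * (1 - q) = 1 := by rw [mul_comm, hr]
  -- The value of `σ = 1/w` at `w = a/(1-q)`.
  set σ₀ := (1 - q) * algebraMap ℂ Q a⁻¹ with hσ₀
  have hσ₀u : IsUnit σ₀ := hq1.mul (isUnit_algebraMap Q (inv_ne_zero ha))
  have hσw : σ₀ * w = 1 := by
    rw [hσ₀]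
    linear_combination (algebraMap ℂ Q a⁻¹) * hw + haa
  -- The formula is to be stated in `T`, proved after the injective map `α` to Laurent series, and
  -- then read off under `β`. Each denominator must therefore be a unit under both maps; nilpotence
  -- of `q` reduces this to nonzero constants.
  obtain ⟨T, _, _, α, β, σ, q', hα, hασ, hαq, hβσ, hβq, hunit⟩ := exists_transfer q σ₀
  have hsingle : (HahnSeries.single (1 : ℤ) (1 : Q) : LaurentSeries Q) * HahnSeries.single (-1) 1 = 1 := by
    rw [HahnSeries.single_mul_single]
    simp
  have hX : IsUnit (HahnSeries.single 1 1 : LaurentSeries Q) := IsUnit.of_mul_eq_one _ hsingle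
  have hgeo : ∀ c : ℂ, IsUnit (1 - HahnSeries.single 1 1 * algebraMap ℂ (LaurentSeries Q) c) := by
    intro c
    have h1 : IsUnit (1 - PowerSeries.C c * PowerSeries.X : ℂ⟦X⟧) := by
      rw [PowerSeries.isUnit_iff_constantCoeff]
      simp
    have h2 := h1.map (scaleHom (1 : Q))
    rwa [map_sub, map_mul, map_one, scaleHom_C, scaleHom_X, mul_comm] at h2
  have hσ : IsUnit σ := hunit _ (by rwa [hασ]) (by rwa [hβσ])
  have hq'1 : IsUnit (1 - q') := hunit _
    (by rw [map_sub, map_one, hαq]; exact hqC.isUnit_one_sub)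
    (by rw [map_sub, map_one, hβq]; exact hq1)
  have hq'2 : IsUnit (1 + q') := hunit _
    (by rw [map_add, map_one, hαq]; exact hqC.isUnit_one_add)
    (by rw [map_add, map_one, hβq]; exact hqn.isUnit_one_add)
  have hU1 : ∀ i, IsUnit (σ * algebraMap ℂ T (y i) - 1) := fun i => by
    refine hunit _ ?_ ?_
    · rw [map_sub, map_mul, map_one, hασ, AlgHom.commutes, ← neg_sub, IsUnit.neg_iff]
      exact hgeo _
    · rw [map_sub, map_mul, map_one, hβσ, AlgHom.commutes]
      have e : σ₀ * algebraMap ℂ Q (y i) - 1 =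
          algebraMap ℂ Q (-(1 - y i / a)) + -(algebraMap ℂ Q (y i / a) * q) := by
        rw [map_neg, map_sub, map_one, hdiv, hσ₀]
        ring
      rw [e]
      exact isUnit_add_of_isNilpotent (isUnit_algebraMap Q (neg_ne_zero.2 (hya1 i)))
        ((Commute.all _ _).isNilpotent_mul_left hqn).neg
  have hU2 : ∀ i, IsUnit (σ * algebraMap ℂ T (y i) + q') := fun i => by
    refine hunit _ ?_ ?_
    · rw [map_add, map_mul, hασ, hαq, AlgHom.commutes]
      exact isUnit_add_of_isNilpotent (hX.mul (isUnit_algebraMap _ (hy0 i))) hqC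
    · rw [map_add, map_mul, hβσ, hβq, AlgHom.commutes]
      exact isUnit_add_of_isNilpotent (hσ₀u.mul (isUnit_algebraMap _ (hy0 i))) hqn
  have hU3 : ∀ i, IsUnit (1 - q' - σ * algebraMap ℂ T (y i)) := fun i => by
    refine hunit _ ?_ ?_
    · rw [map_sub, map_sub, map_mul, map_one, hασ, hαq, AlgHom.commutes, sub_right_comm,
        sub_eq_add_neg]
      exact isUnit_add_of_isNilpotent (hgeo _) hqC.neg
    · rw [map_sub, map_sub, map_mul, map_one, hβσ, hβq, AlgHom.commutes]
      have e : 1 - q - σ₀ * algebraMap ℂ Q (y i) = (1 - q) * algebraMap ℂ Q (1 - y i / a) := by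
        rw [map_sub, map_one, hdiv, hσ₀]
        ring
      rw [e]
      exact hq1.mul (isUnit_algebraMap Q (hya1 i))
  obtain ⟨τ, hτ⟩ := hσ.exists_right_inv
  have hτu : IsUnit τ := IsUnit.of_mul_eq_one σ (by rw [mul_comm, hτ])
  obtain ⟨r', hr''⟩ := hq'1.exists_right_inv
  choose u hu using fun i => (hU3 i).exists_right_inv
  -- The point `y/(1 - s y)` with `s = σ/(1-q')`, written as `y (1-q')/(1 - q' - σ y)`.
  set x : Fin n → T := fun i => algebraMap ℂ T (y i) * (1 - q') * u i with hx
  have hxs : ∀ i, (1 - σ * r' * algebraMap ℂ T (y i)) * x i = algebraMap ℂ T (y i) := fun i => by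
    rw [hx]
    linear_combination (algebraMap ℂ T (y i)) * hu i +
      (-algebraMap ℂ T (y i) * σ * algebraMap ℂ T (y i) * u i) * hr''
  have hxu : ∀ i, IsUnit (x i) := fun i =>
    ((isUnit_algebraMap T (hy0 i)).mul hq'1).mul (IsUnit.of_mul_eq_one _ (by rw [mul_comm]; exact hu i))
  have hsu : ∀ i, IsUnit (1 - σ * r' * algebraMap ℂ T (y i)) := fun i => by
    refine isUnit_of_mul_isUnit_left (y := x i) ?_
    rw [hxs]
    exact isUnit_algebraMap T (hy0 i)
  have hxD : IsUnit (MvPolynomial.aeval x (axes n * diagonals n)) := by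
    rw [map_mul]
    refine (isUnit_aeval_axes hxu).mul (isUnit_aeval_diagonals fun i j hij => ?_)
    have e : (1 - σ * r' * algebraMap ℂ T (y i)) * (1 - σ * r' * algebraMap ℂ T (y j)) *
        (x i - x j) = algebraMap ℂ T (y i - y j) := by
      rw [map_sub]
      linear_combination (1 - σ * r' * algebraMap ℂ T (y j)) * hxs i -
        (1 - σ * r' * algebraMap ℂ T (y i)) * hxs j
    refine isUnit_of_mul_isUnit_right (x := (1 - σ * r' * algebraMap ℂ T (y i)) *
      (1 - σ * r' * algebraMap ℂ T (y j))) ?_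
    rw [e]
    exact isUnit_algebraMap T (sub_ne_zero.2 (hy.ne hij.ne))
  have haT : IsUnit (MvPolynomial.aeval (Fin.append (fun i => algebraMap ℂ T (y i))
      ![τ, -(q' * τ)]) (diagonals (n + 2))) := by
    refine isUnit_aeval_append hy (fun i => ?_) (fun i => ?_) ?_
    · have e : algebraMap ℂ T (y i) - τ = τ * (σ * algebraMap ℂ T (y i) - 1) := by
        linear_combination (-algebraMap ℂ T (y i)) * hτ
      rw [e]
      exact hτu.mul (hU1 i)
    · have e : algebraMap ℂ T (y i) - -(q' * τ) = τ * (σ * algebraMap ℂ T (y i) + q') := by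
        linear_combination (-algebraMap ℂ T (y i)) * hτ
      rw [e]
      exact hτu.mul (hU2 i)
    · have e : τ - -(q' * τ) = τ * (1 + q') := by ring
      rw [e]
      exact hτu.mul hq'2
  have hD := (divisors n).mul_mem (axes_mem_divisors n) (diagonals_mem_divisors n)
  have hZ : ∀ k i, A.genusZeroSeries B (Fin.append v ![(b k i : V), (b' k i : V)]) ∈
      rational (diagonals (n + 2)) := fun k i => hB.genusZeroSeries_mem_rational
    (fun i => (hv i).1) (b k i).2 (b' k i).2
  have ht := fun M => tr_prodModes_mem_rational (A := A) (fun i => (hv i).1) M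
  have hmap : ∀ {S : Type u} [CommRing S] [Algebra ℂ S] (φ : T →ₐ[ℂ] S),
      φ ((∑ k ∈ Finset.range (m + 1), (-(q' * τ ^ 2)) ^ k *
        ∑ i, A.genusZero B (Fin.append v ![(b k i : V), (b' k i : V)])
          (Fin.append (fun i => algebraMap ℂ T (y i)) ![τ, -(q' * τ)])) *
        ∏ i, (1 - σ * r' * algebraMap ℂ T (y i)) ^ (2 * wt i)) =
      (∑ k ∈ Finset.range (m + 1), (-(φ q' * φ τ ^ 2)) ^ k *
        ∑ i, A.genusZero B (Fin.append v ![(b k i : V), (b' k i : V)])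
          (Fin.append (fun i => algebraMap ℂ S (y i)) ![φ τ, -(φ q' * φ τ)])) *
        ∏ i, (1 - φ σ * φ r' * algebraMap ℂ S (y i)) ^ (2 * wt i) := by
    intro S _ _ φ
    have e : (fun j => φ (Fin.append (fun i => algebraMap ℂ T (y i)) ![τ, -(q' * τ)] j)) =
        Fin.append (fun i => algebraMap ℂ S (y i)) ![φ τ, -(φ q' * φ τ)] := by
      funext j
      refine Fin.addCases (fun j => ?_) (fun j => ?_) j
      · simp
      · fin_cases j <;> simp [Fin.append_right]
    simp only [map_mul, map_sum, map_pow, map_neg, map_prod, map_sub, map_one, AlgHom.commutes,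
      genusZero, map_ratValue (diagonals_mem_divisors _) haT φ (hZ _ _), e]
  have hmap' : ∀ {S : Type u} [CommRing S] [Algebra ℂ S] (φ : T →ₐ[ℂ] S),
      φ (∑ M ∈ Finset.range (m + 1), q' ^ M *
        ratValue (fun κ => A.tr M (A.prodModes v κ)) (axes n * diagonals n) x) =
      ∑ M ∈ Finset.range (m + 1), φ q' ^ M *
        ratValue (fun κ => A.tr M (A.prodModes v κ)) (axes n * diagonals n) fun i => φ (x i) := by
    intro S _ _ φ
    simp only [map_mul, map_sum, map_pow, map_ratValue hD hxD φ (ht _)]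
  have hατ : α τ = HahnSeries.single (-1) 1 := by
    refine hX.mul_left_cancel ?_
    rw [← hασ, ← map_mul, hτ, hασ, hsingle, map_one]
  have hαr : α r' = HahnSeries.C r := by
    have h1 : IsUnit (1 - HahnSeries.C q : LaurentSeries Q) := hqC.isUnit_one_sub
    refine h1.mul_left_cancel ?_
    rw [← hαq, ← map_one α, ← map_sub, ← map_mul, hr'', map_sub, hαq, map_one, ← map_one HahnSeries.C,
      ← map_sub, ← map_mul, hr]
  have hαs : ∀ i, 1 - α σ * α r' * algebraMap ℂ (LaurentSeries Q) (y i) =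
      scaleHom r (1 - PowerSeries.C (y i) * PowerSeries.X) := fun i => by
    rw [map_sub, map_mul, map_one, scaleHom_C, scaleHom_X, hασ, hαr, mul_comm (algebraMap _ _ _),
      mul_comm (HahnSeries.single 1 1), HahnSeries.C_mul_eq_smul]
    congr 2
    ext j
    simp [HahnSeries.coeff_single]
  have key : (∑ k ∈ Finset.range (m + 1), (-(q' * τ ^ 2)) ^ k *
      ∑ i, A.genusZero B (Fin.append v ![(b k i : V), (b' k i : V)])
        (Fin.append (fun i => algebraMap ℂ T (y i)) ![τ, -(q' * τ)])) *
      ∏ i, (1 - σ * r' * algebraMap ℂ T (y i)) ^ (2 * wt i) =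
      ∑ M ∈ Finset.range (m + 1), q' ^ M *
        ratValue (fun κ => A.tr M (A.prodModes v κ)) (axes n * diagonals n) x := by
    have h1 : -(HahnSeries.C q * HahnSeries.single (-1) 1) =
        (HahnSeries.single (-1) (-q) : LaurentSeries Q) := by
      rw [HahnSeries.C_mul_eq_smul]
      ext j
      simp [HahnSeries.coeff_single]
    have h2 : -(HahnSeries.C q * HahnSeries.single (-1) 1 ^ 2) =
        (HahnSeries.single (-2) (-q) : LaurentSeries Q) := by
      rw [HahnSeries.C_mul_eq_smul, HahnSeries.single_pow]
      ext j
      simp [HahnSeries.coeff_single]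
    have hyD : IsUnit (MvPolynomial.aeval y (axes n * diagonals n)) := by
      rw [map_mul]
      exact (isUnit_aeval_axes fun i => (hy0 i).isUnit).mul
        (isUnit_aeval_diagonals fun i j hij => (sub_ne_zero.2 (hy.ne hij.ne)).isUnit)
    have hs : sewPoint q y = Fin.append (fun i => algebraMap ℂ (LaurentSeries Q) (y i))
        ![α τ, -(α q' * α τ)] := by
      rw [hατ, hαq, h1]
      rfl
    have hu' : IsUnit (MvPolynomial.aeval (sewPoint q y) (diagonals (n + 2))) := by
      have h3 := haT.map α
      rw [MvPolynomial.comp_aeval_apply] at h3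
      convert h3 using 3
      rw [hs]
      funext j
      refine Fin.addCases (fun j => ?_) (fun j => ?_) j
      · simp
      · fin_cases j <;> simp [Fin.append_right]
    have hfin := hB.sum_genusZero_sewPoint b b' hb hv hq hr' hyD hu'
    have hpt : (fun i => α (x i)) = fun i => scaleHom r (specialPoint (y i)) := by
      funext i
      have h3 : IsUnit (scaleHom r (1 - PowerSeries.C (y i) * PowerSeries.X)) := by
        rw [← hαs, ← AlgHom.commutes α, ← map_mul, ← map_mul, ← map_one α, ← map_sub]
        exact (hsu i).map α
      refine h3.mul_left_cancel ?_
      rw [← map_mul, one_sub_mul_specialPoint, scaleHom_C, ← hαs, ← AlgHom.commutes α, ← map_mul,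
        ← map_mul, ← map_one α, ← map_sub, ← map_mul, hxs]
    refine hα ?_
    rw [hmap α, hmap' α, hpt, hατ, hαq, h2, ← hατ, ← hαq, ← hs, hαq, ← hfin, map_prod]
    simp only [hαs, map_pow]
  have hβτ : β τ = w := by
    refine hσ₀u.mul_left_cancel ?_
    rw [← hβσ, ← map_mul, hτ, hβσ, hσw, map_one]
  have hβr : β r' = r := by
    refine hq1.mul_left_cancel ?_
    rw [← hβq, ← map_one β, ← map_sub, ← map_mul, hr'', map_sub, hβq, map_one, hr]
  -- At `σ₀` the parameter `s = σ₀/(1-q)` is the constant `1/a`, so the points no longer depend on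
  -- `q`.
  have hβs : ∀ i, 1 - β σ * β r' * algebraMap ℂ Q (y i) = 1 - algebraMap ℂ Q (y i / a) := fun i => by
    rw [hβσ, hβr, hdiv, hσ₀]
    linear_combination (-algebraMap ℂ Q a⁻¹ * algebraMap ℂ Q (y i)) * hr
  have hβx : (fun i => β (x i)) = fun i => algebraMap ℂ Q (y i / (1 - y i / a)) := by
    funext i
    have h3 : algebraMap ℂ Q (1 - y i / a) * β (x i) = algebraMap ℂ Q (y i) := by
      rw [map_sub, map_one, ← hβs, ← AlgHom.commutes β, ← map_mul, ← map_mul, ← map_one β, ← map_sub,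
        ← map_mul, hxs]
    refine (isUnit_algebraMap Q (hya1 i)).mul_left_cancel ?_
    rw [h3, ← map_mul, mul_div_cancel₀ _ (hya1 i)]
  have hfin := congrArg β key
  rw [hmap β, hmap' β, hβx, hβτ, hβq] at hfin
  simp only [hβs] at hfin
  exact hfin

end VOA

/-! ### From truncations to power series in `q` -/

namespace VOA

open FormalSeries

variable {V : Type*} [AddCommGroup V] [Module ℂ V] {A : VOA V}
variable {B : LinearMap.BilinForm ℂ V} {n : ℕ} {wt : Fin n → ℕ} {v : Fin n → V}

theorem prodModes_smul (c : Fin n → ℂ) (k : Fin n → ℤ) :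
    A.prodModes (fun i => c i • v i) k = (∏ i, c i) • A.prodModes v k := by
  induction n with
  | zero => simp [prodModes_zero]
  | succ n ih =>
    rw [prodModes_succ, prodModes_succ, Fin.prod_univ_succ, mode_smul]
    have := ih (v := v ∘ Fin.succ) (c ∘ Fin.succ) (k ∘ Fin.succ)
    rw [mul_smul, smul_mul_assoc, ← mul_smul_comm (∏ i : Fin n, c i.succ)]
    exact congrArg (fun T => c 0 • (A.mode (v 0) (k 0) * T)) this

theorem traceSeries_smul (m : ℕ) (c : Fin n → ℂ) :
    A.traceSeries m (fun i => c i • v i) =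
      (∏ i, c i) • fun κ => A.tr m (A.prodModes v κ) := by
  funext κ
  rw [Pi.smul_apply, ← map_smul, ← prodModes_smul]
  rfl

theorem tr_prodModes_eq_zero (hv : ∀ i, v i ∈ A.wtSpace (wt i)) (m : ℕ) {κ : Fin n → ℤ}
    (h : ∑ i, (κ i + 1) ≠ ((∑ i, wt i : ℕ) : ℤ)) : A.tr m (A.prodModes v κ) = 0 := by
  have : A.proj m ∘ₗ A.prodModes v κ ∘ₗ (A.wtSpace m).subtype = 0 := by
    ext x
    have h1 := prodModes_weight hv (weight_of_mem x.2) κ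
    have h2 := proj_L_zero (A := A) m (A.prodModes v κ x)
    rw [h1, map_smul, ← sub_eq_zero, ← sub_smul, smul_eq_zero] at h2
    have h3 : (((m : ℤ) + ∑ i, ((wt i : ℤ) - κ i - 1) : ℤ) : ℂ) - m ≠ 0 := by
      have e : ∑ i, ((wt i : ℤ) - κ i - 1) = ((∑ i, wt i : ℕ) : ℤ) - ∑ i, (κ i + 1) := by
        rw [Nat.cast_sum, ← Finset.sum_sub_distrib]
        exact Finset.sum_congr rfl fun i _ => by ring
      rw [e]
      intro hc
      have : ((((∑ i, wt i : ℕ) : ℤ) - ∑ i, (κ i + 1) : ℤ) : ℂ) = 0 := by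
        rw [← hc]
        push_cast
        ring
      have := Int.cast_eq_zero.1 this
      omega
    have h4 := h2.resolve_left h3
    simpa using congrArg Subtype.val h4
  rw [tr_apply, this, map_zero]

theorem coeff_eq_of_mk_eq {m : ℕ} {f g : ℂ⟦X⟧}
    (h : Ideal.Quotient.mk (Ideal.span {(PowerSeries.X : ℂ⟦X⟧) ^ (m + 1)}) f =
      Ideal.Quotient.mk (Ideal.span {(PowerSeries.X : ℂ⟦X⟧) ^ (m + 1)}) g) :
    PowerSeries.coeff m f = PowerSeries.coeff m g := by
  rw [Ideal.Quotient.eq, Ideal.mem_span_singleton, PowerSeries.X_pow_dvd_iff] at h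
  have := h m (Nat.lt_succ_self m)
  rwa [map_sub, sub_eq_zero] at this

theorem isUnit_aeval_sewing {y : Fin n → ℂ} (hy : Function.Injective y) (hy0 : ∀ i, y i ≠ 0) {a : ℂ}
    (ha : a ≠ 0) (hya : ∀ i, y i ≠ a) {w : ℂ⟦X⟧} (hw : (1 - PowerSeries.X) * w = PowerSeries.C a) :
    IsUnit (MvPolynomial.aeval (Fin.append (fun i => PowerSeries.C (y i))
      ![w, -(PowerSeries.X * w)]) (diagonals (n + 2))) := by
  have hwc : PowerSeries.constantCoeff w = a := by
    have := congrArg PowerSeries.constantCoeff hw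
    simpa using this
  refine isUnit_aeval_append (S := ℂ⟦X⟧) hy (fun i => ?_) (fun i => ?_) ?_
  · rw [PowerSeries.isUnit_iff_constantCoeff]
    simpa [hwc, PowerSeries.algebraMap_apply] using sub_ne_zero.2 (hya i)
  · rw [PowerSeries.isUnit_iff_constantCoeff]
    simpa [PowerSeries.algebraMap_apply] using hy0 i
  · rw [PowerSeries.isUnit_iff_constantCoeff]
    simpa [hwc] using ha

/-- The genus one function in terms of traces, with the handle attached at `0` and `a`. -/
theorem IsLiZ.coeff_genusOne (hB : A.IsLiZ B) {ι : ℕ → Type*} [∀ k, Fintype (ι k)]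
    [∀ k, DecidableEq (ι k)] (b b' : ∀ k, Module.Basis (ι k) ℂ (A.wtSpace k))
    (hb : ∀ k i j, B (b k i : V) (b' k j : V) = if i = j then 1 else 0)
    (hv : ∀ i, A.IsQuasiprimary (wt i) (v i)) {y : Fin n → ℂ}
    (hy : Function.Injective y) (hy0 : ∀ i, y i ≠ 0) {a : ℂ} (ha : a ≠ 0) (hya : ∀ i, y i ≠ a)
    {w : ℂ⟦X⟧} (hw : (1 - PowerSeries.X) * w = PowerSeries.C a) (m : ℕ) :
    PowerSeries.coeff m (A.genusOne B b b' v (fun i => PowerSeries.C (y i)) w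
      (-(PowerSeries.X * w)) (-(PowerSeries.X * w ^ 2))) * ∏ i, (1 - y i / a) ^ (2 * wt i) =
      ratValue (fun κ => A.tr m (A.prodModes v κ)) (axes n * diagonals n)
        fun i => y i / (1 - y i / a) := by
  have hya1 : ∀ i, 1 - y i / a ≠ 0 := fun i h => hya i (by
    rw [sub_eq_zero, eq_div_iff ha, one_mul] at h
    exact h.symm)
  have hu := isUnit_aeval_sewing hy hy0 ha hya hw
  have hx : IsUnit (MvPolynomial.aeval (fun i => y i / (1 - y i / a)) (axes n * diagonals n)) := by
    rw [map_mul]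
    refine (isUnit_aeval_axes fun i => (div_ne_zero (hy0 i) (hya1 i)).isUnit).mul
      (isUnit_aeval_diagonals fun i j hij => (sub_ne_zero.2 fun h => hij.ne (hy ?_)).isUnit)
    rw [div_eq_div_iff (hya1 i) (hya1 j)] at h
    linear_combination h
  have hD := (divisors n).mul_mem (axes_mem_divisors n) (diagonals_mem_divisors n)
  -- The coefficient of `q^m` is determined modulo `q^{m+1}`, where `q` is nilpotent and the
  -- truncated sewing formula applies.
  set π := Ideal.Quotient.mkₐ ℂ (Ideal.span {(PowerSeries.X : ℂ⟦X⟧) ^ (m + 1)}) with hπ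
  have hq : π PowerSeries.X ^ (m + 1) = 0 := by
    rw [← map_pow]
    exact Ideal.Quotient.eq_zero_iff_mem.2 (Ideal.mem_span_singleton_self _)
  have key := hB.sum_genusZero_mul_prod b b' hb hv hq hy hy0 ha hya (w := π w) (by
    rw [← map_one π, ← map_sub, ← map_mul, hw]
    exact π.commutes a)
  have e : (fun j => π (Fin.append (fun i => PowerSeries.C (y i))
      ![w, -(PowerSeries.X * w)] j)) = Fin.append (fun i => algebraMap ℂ _ (y i))
        ![π w, -(π PowerSeries.X * π w)] := by
    funext j
    refine Fin.addCases (fun j => ?_) (fun j => ?_) j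
    · rw [Fin.append_left, Fin.append_left]
      exact π.commutes _
    · fin_cases j <;> simp [Fin.append_right]
  have hZ : ∀ k i, A.genusZeroSeries B (Fin.append v ![(b k i : V), (b' k i : V)]) ∈
      rational (diagonals (n + 2)) := fun k i => hB.genusZeroSeries_mem_rational
    (fun i => (hv i).1) (b k i).2 (b' k i).2
  have hr : ∀ M, ratValue (fun κ => A.tr M (A.prodModes v κ)) (axes n * diagonals n)
      (fun i => algebraMap ℂ (ℂ⟦X⟧ ⧸ Ideal.span {(PowerSeries.X : ℂ⟦X⟧) ^ (m + 1)})
        (y i / (1 - y i / a))) = π (PowerSeries.C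
          (ratValue (fun κ => A.tr M (A.prodModes v κ)) (axes n * diagonals n)
            fun i => y i / (1 - y i / a))) := fun M =>
    (map_ratValue hD hx (Algebra.ofId ℂ _)
      (tr_prodModes_mem_rational (fun i => (hv i).1) M)).symm.trans (π.commutes _).symm
  have hL : π ((∑ k ∈ Finset.range (m + 1), (-(PowerSeries.X * w ^ 2)) ^ k *
      ∑ i, A.genusZero B (Fin.append v ![(b k i : V), (b' k i : V)])
        (Fin.append (fun i => PowerSeries.C (y i)) ![w, -(PowerSeries.X * w)])) *
      PowerSeries.C (∏ i, (1 - y i / a) ^ (2 * wt i))) =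
      π (∑ M ∈ Finset.range (m + 1), PowerSeries.X ^ M * PowerSeries.C
        (ratValue (fun κ => A.tr M (A.prodModes v κ)) (axes n * diagonals n)
          fun i => y i / (1 - y i / a))) := by
    have hc : π (PowerSeries.C (∏ i, (1 - y i / a) ^ (2 * wt i))) =
        ∏ i, (1 - algebraMap ℂ (ℂ⟦X⟧ ⧸ Ideal.span {(PowerSeries.X : ℂ⟦X⟧) ^ (m + 1)})
          (y i / a)) ^ (2 * wt i) := by
      refine (π.commutes _).trans ?_
      rw [map_prod]
      refine Finset.prod_congr rfl fun i _ => ?_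
      rw [map_pow, map_sub, map_one]
    have hL' : ∀ k i, π (A.genusZero B (Fin.append v ![(b k i : V), (b' k i : V)])
        (Fin.append (fun i => PowerSeries.C (y i)) ![w, -(PowerSeries.X * w)])) =
        A.genusZero B (Fin.append v ![(b k i : V), (b' k i : V)])
          (Fin.append (fun i => algebraMap ℂ _ (y i)) ![π w, -(π PowerSeries.X * π w)]) :=
      fun k i => by
        rw [genusZero, map_ratValue (diagonals_mem_divisors _) hu π (hZ k i), e]
        rfl
    rw [map_mul, hc]
    simp only [map_sum, map_mul, map_pow, map_neg, hL', ← hr]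
    exact key
  have h1 := coeff_eq_of_mk_eq hL
  rw [PowerSeries.coeff_mul_C] at h1
  rw [genusOne, PowerSeries.coeff_mk]
  refine h1.trans ?_
  rw [map_sum, Finset.sum_eq_single m]
  · rw [PowerSeries.coeff_mul_C, PowerSeries.coeff_X_pow_self, one_mul]
  · intro M _ hM
    rw [PowerSeries.coeff_mul_C, PowerSeries.coeff_X_pow, if_neg (Ne.symm hM), zero_mul]
  · intro h
    exact absurd (Finset.self_mem_range_succ m) h

/-- The genus one function is translation invariant. -/
theorem IsLiZ.genusOne_add_const (hB : A.IsLiZ B) {ι : ℕ → Type*} [∀ k, Fintype (ι k)]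
    (b b' : ∀ k, Module.Basis (ι k) ℂ (A.wtSpace k)) (hv : ∀ i, v i ∈ A.wtSpace (wt i))
    {y : Fin n → ℂ} {w w' : ℂ⟦X⟧} (ρ : ℂ⟦X⟧)
    (hu : IsUnit (MvPolynomial.aeval (Fin.append (fun i => PowerSeries.C (y i)) ![w, w'])
      (diagonals (n + 2)))) (c : ℂ) :
    A.genusOne B b b' v (fun i => PowerSeries.C (y i + c)) (w + PowerSeries.C c)
      (w' + PowerSeries.C c) ρ = A.genusOne B b b' v (fun i => PowerSeries.C (y i)) w w' ρ := by
  have e : Fin.append (fun i => PowerSeries.C (y i + c)) ![w + PowerSeries.C c, w' + PowerSeries.C c] =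
      fun j => Fin.append (fun i => PowerSeries.C (y i)) ![w, w'] j + PowerSeries.C c := by
    funext j
    refine Fin.addCases (fun j => ?_) (fun j => ?_) j
    · simp
    · fin_cases j <;> simp [Fin.append_right]
  have h : ∀ k i, A.genusZero B (Fin.append v ![(b k i : V), (b' k i : V)])
      (Fin.append (fun i => PowerSeries.C (y i + c)) ![w + PowerSeries.C c, w' + PowerSeries.C c]) =
      A.genusZero B (Fin.append v ![(b k i : V), (b' k i : V)])
        (Fin.append (fun i => PowerSeries.C (y i)) ![w, w']) := fun k i => by
    rw [genusZero, e, ratValue_add_const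
      (hB.genusZeroSeries_mem_rational hv (b k i).2 (b' k i).2)
      (translate_prodModes_vac _ hB.vac_L_neg_one) _ hu]
    rfl
  simp only [genusOne, h]

end VOA

/-! ### The sewing parameters and the coordinate `ζ` -/

theorem exp_mul_deriv_of_eventuallyEq {ζ : ℂ → ℂ} {W W' z : ℂ} (hz : z ≠ W)
    (hζ : DifferentiableAt ℂ ζ z)
    (h : ∀ᶠ t in nhds z, Complex.exp (ζ t) = (t - W') / (t - W)) :
    Complex.exp (ζ z) * deriv ζ z = (W' - W) / (z - W) ^ 2 := by
  have hne := sub_ne_zero.2 hz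
  have h1 : HasDerivAt (fun t => Complex.exp (ζ t)) (Complex.exp (ζ z) * deriv ζ z) z :=
    hζ.hasDerivAt.cexp
  have h2 : HasDerivAt (fun t => (t - W') / (t - W)) ((1 * (z - W) - (z - W') * 1) / (z - W) ^ 2) z :=
    ((hasDerivAt_id z).sub_const W').div ((hasDerivAt_id z).sub_const W) hne
  rw [h1.unique (h2.congr_of_eventuallyEq h)]
  congr 1
  ring

/-- Subtracting `W_{-1}` from both attaching points brings the parameters to the form `w = a/(1-q)`,
`-q w`, `-q w²` with `a = W_1 - W_{-1}`, as `IsLiZ.coeff_genusOne` requires; the next two lemmas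
treat the other two. -/
theorem one_sub_X_mul_schottkyW (W W' : ℂ) :
    (1 - PowerSeries.X) * (schottkyW W W' - PowerSeries.C W') = PowerSeries.C (W - W') := by
  have h : (1 - PowerSeries.X : ℂ⟦X⟧) * (1 - PowerSeries.X)⁻¹ = 1 :=
    PowerSeries.mul_inv_cancel _ (by simp)
  rw [schottkyW, map_sub]
  linear_combination (PowerSeries.C W - PowerSeries.X * PowerSeries.C W') * h

theorem schottkyW_sub (W W' : ℂ) : schottkyW W' W - PowerSeries.C W' =
    -(PowerSeries.X * (schottkyW W W' - PowerSeries.C W')) := by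
  have h : (1 - PowerSeries.X : ℂ⟦X⟧) * (1 - PowerSeries.X)⁻¹ = 1 :=
    PowerSeries.mul_inv_cancel _ (by simp)
  rw [schottkyW, schottkyW]
  linear_combination (PowerSeries.C W' * (1 + PowerSeries.X)) * h

theorem schottkyRho_eq (W W' : ℂ) : schottkyRho W W' =
    -(PowerSeries.X * (schottkyW W W' - PowerSeries.C W') ^ 2) := by
  have hu : IsUnit ((1 - PowerSeries.X : ℂ⟦X⟧) ^ 2) := by
    rw [PowerSeries.isUnit_iff_constantCoeff]
    simp
  have h : ((1 - PowerSeries.X : ℂ⟦X⟧) ^ 2) * ((1 - PowerSeries.X) ^ 2)⁻¹ = 1 :=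
    PowerSeries.mul_inv_cancel _ (by simp)
  have h1 := one_sub_X_mul_schottkyW W W'
  have h2 : (PowerSeries.C ((W' - W) ^ 2) : ℂ⟦X⟧) = PowerSeries.C (W - W') ^ 2 := by
    rw [← map_pow]
    congr 1
    ring
  refine hu.mul_left_cancel ?_
  rw [schottkyRho, h2, ← h1]
  linear_combination (-(PowerSeries.X * ((1 - PowerSeries.X) *
    (schottkyW W W' - PowerSeries.C W')) ^ 2)) * h

end

theorem mainTheorem3 {V : Type*} [AddCommGroup V] [Module ℂ V] (A : VOA V)
    (hs : A.IsSimple) (hc : A.IsStrongCFTType) (hd : A.IsSelfDual)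
    -- a homogeneous basis `b` of `V` and its dual basis `b'` with respect to the Li-Z metric
    {ι : ℕ → Type*} [∀ k, Fintype (ι k)] [∀ k, DecidableEq (ι k)]
    (b b' : ∀ k, Module.Basis (ι k) ℂ (A.wtSpace k))
    (hb : ∀ k i j, VOA.liZ hs hc hd (b k i : V) (b' k j : V) = if i = j then 1 else 0)
    -- quasiprimary vectors
    {n : ℕ} (wt : Fin n → ℕ) (v : Fin n → V) (hv : ∀ i, A.IsQuasiprimary (wt i) (v i))
    -- the fixed points `W = W_1`, `W' = W_{-1}` and the insertion points
    (W W' : ℂ) (hW : W ≠ W') (z : Fin n → ℂ) (hz : Function.Injective z)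
    (hzW : ∀ i, z i ≠ W) (hzW' : ∀ i, z i ≠ W')
    -- `ζ i` is a branch of `log ((z - W_{-1}) / (z - W_1))` near `z i`
    (ζ : Fin n → ℂ → ℂ) (hζ : ∀ i, DifferentiableAt ℂ (ζ i) (z i))
    (hζ_exp : ∀ i, ∀ᶠ t in nhds (z i), Complex.exp (ζ i t) = (t - W') / (t - W)) :
    -- the correlation functions and traces involved are expansions of rational functions
    (∀ k i, VOA.IsRationalSeries
      (A.genusZeroSeries (VOA.liZ hs hc hd) (Fin.append v ![(b k i : V), (b' k i : V)]))
      (VOA.diagonals (n + 2))) ∧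
    (∀ m, VOA.IsRationalSeries
      (A.traceSeries m fun i => Complex.exp (wt i * ζ i (z i)) • v i)
      (VOA.axes n * VOA.diagonals n)) ∧
    -- equality of the coefficients of `∏ dz_i ^ wt(v_i)`, using `dζ_i = ζ_i'(z_i) dz_i`
    A.genusOne (VOA.liZ hs hc hd) b b' v (fun i => PowerSeries.C (z i))
        (schottkyW W W') (schottkyW W' W) (schottkyRho W W') =
      A.zhuTrace wt v (fun i => ζ i (z i)) *
        PowerSeries.C (∏ i, deriv (ζ i) (z i) ^ wt i) := by
  have hB : A.IsLiZ (VOA.liZ hs hc hd) := (VOA.existsUnique_liZ hs hc hd).choose_spec.1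
  have hwt : ∀ i, v i ∈ A.wtSpace (wt i) := fun i => (hv i).1
  have hD := (FormalSeries.divisors n).mul_mem (FormalSeries.axes_mem_divisors n)
    (FormalSeries.diagonals_mem_divisors n)
  refine ⟨fun k i => FormalSeries.isRationalSeries_of_mem (FormalSeries.diagonals_mem_divisors _)
    (hB.genusZeroSeries_mem_rational hwt (b k i).2 (b' k i).2), fun m => ?_, ?_⟩
  · rw [VOA.traceSeries_smul]
    exact FormalSeries.isRationalSeries_of_mem hD
      (Submodule.smul_mem _ _ (VOA.tr_prodModes_mem_rational hwt m))
  have ha : W - W' ≠ 0 := sub_ne_zero.2 hW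
  have hy0 : ∀ i, z i - W' ≠ 0 := fun i => sub_ne_zero.2 (hzW' i)
  have hya : ∀ i, z i - W' ≠ W - W' := fun i h => hzW i (sub_left_injective h)
  have hy : Function.Injective fun i => z i - W' := fun i j h => hz (sub_left_injective h)
  have hzW0 : ∀ i, z i - W ≠ 0 := fun i => sub_ne_zero.2 (hzW i)
  have hw := one_sub_X_mul_schottkyW W W'
  have hu := VOA.isUnit_aeval_sewing hy hy0 ha hya hw
  have htrans := hB.genusOne_add_const b b' hwt (schottkyRho W W') hu W'
  rw [← schottkyW_sub] at htrans
  simp only [sub_add_cancel] at htrans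
  have hexp : ∀ i, Complex.exp (ζ i (z i)) = (z i - W') / (z i - W) := fun i =>
    (hζ_exp i).self_of_nhds
  ext m
  have h1 := hB.coeff_genusOne b b' hb hv hy hy0 ha hya hw m
  rw [← schottkyW_sub, ← schottkyRho_eq, ← htrans] at h1
  rw [PowerSeries.coeff_mul_C, VOA.zhuTrace, PowerSeries.coeff_mk, VOA.traceSeries_smul]
  have hmem := VOA.tr_prodModes_mem_rational (A := A) hwt m
  have hedge : IsUnit (MvPolynomial.aeval (fun i => Complex.exp (ζ i (z i)))
      (VOA.axes n * VOA.diagonals n)) := by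
    rw [map_mul]
    refine (FormalSeries.isUnit_aeval_axes fun i => (Complex.exp_ne_zero _).isUnit).mul
      (FormalSeries.isUnit_aeval_diagonals fun i j hij => (sub_ne_zero.2 fun h => ?_).isUnit)
    rw [hexp, hexp, div_eq_div_iff (hzW0 i) (hzW0 j)] at h
    have h2 : (z i - z j) * (W' - W) = 0 := by linear_combination h
    exact (mul_ne_zero (sub_ne_zero.2 (hz.ne hij.ne)) (sub_ne_zero.2 hW.symm)) h2
  obtain ⟨d₁, hd₁⟩ := FormalSeries.isHomogeneous_axes n
  obtain ⟨d₂, hd₂⟩ := FormalSeries.isHomogeneous_diagonals n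
  -- Grading makes the trace function homogeneous of degree `-∑ wt_i`, which allows the points `-a
  -- e^{ζ_i}` found by sewing to be rescaled to `e^{ζ_i}`.
  have h2 := FormalSeries.ratValue_smul_point hD (hd₁.mul hd₂) hmem (r := ∑ i, wt i)
    (fun κ hκ => VOA.tr_prodModes_eq_zero hwt m hκ) hedge (c := -(W - W')) (neg_ne_zero.2 ha)
  have hpt : (fun i => -(W - W') • Complex.exp (ζ i (z i))) =
      fun i => (z i - W') / (1 - (z i - W') / (W - W')) := by
    funext i
    have h3 : 1 - (z i - W') / (W - W') = -(z i - W) / (W - W') := by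
      field_simp
      ring
    have := hzW0 i
    rw [hexp, h3, smul_eq_mul]
    field_simp
  rw [hpt, ← h1, smul_eq_mul] at h2
  rw [FormalSeries.ratValue_smul hD hedge _ hmem, ← h2, smul_eq_mul, ← Finset.prod_pow_eq_pow_sum]
  -- Zhu's factor `e^{wt ζ}`, the rescaling factor `(-a)^{wt}`, the automorphy factor `(1 -
  -- y/a)^{2wt}` and `(dζ/dz)^{wt}` cancel: each is a power `wt`, and `e^ζ dζ/dz = -a/(z - W_1)²`
  -- while `1 - y/a = -(z - W_1)/a`.
  have hone : (∏ i, Complex.exp (wt i * ζ i (z i))) * (∏ i, (-(W - W')) ^ wt i) *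
      (∏ i, (1 - (z i - W') / (W - W')) ^ (2 * wt i)) * ∏ i, deriv (ζ i) (z i) ^ wt i = 1 := by
    rw [← Finset.prod_mul_distrib, ← Finset.prod_mul_distrib, ← Finset.prod_mul_distrib]
    refine Finset.prod_eq_one fun i _ => ?_
    rw [Complex.exp_nat_mul, pow_mul, ← mul_pow, ← mul_pow, ← mul_pow]
    have h3 := exp_mul_deriv_of_eventuallyEq (hzW i) (hζ i) (hζ_exp i)
    have h4 : Complex.exp (ζ i (z i)) * -(W - W') * (1 - (z i - W') / (W - W')) ^ 2 *
        deriv (ζ i) (z i) = 1 := by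
      have := hzW0 i
      have h5 : Complex.exp (ζ i (z i)) * -(W - W') * (1 - (z i - W') / (W - W')) ^ 2 *
        deriv (ζ i) (z i) = Complex.exp (ζ i (z i)) * deriv (ζ i) (z i) *
          (-(W - W') * (1 - (z i - W') / (W - W')) ^ 2) := by ring
      rw [h5, h3]
      have h6 : 1 - (z i - W') / (W - W') = -(z i - W) / (W - W') := by
        field_simp
        ring
      rw [h6, ← neg_sub W W']
      field_simp
    rw [h4, one_pow]
  linear_combination (-(PowerSeries.coeff m (A.genusOne (VOA.liZ hs hc hd) b b' v
    (fun i => PowerSeries.C (z i)) (schottkyW W W') (schottkyW W' W) (schottkyRho W W')))) * hone
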